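/- **Setting.** Let $\mathcal T$ be a triangulation of the torus $T$ by $n$ triangles, i.e. $T$ is obtained from $n$ triangles by pairing their sides (two sides of one triangle may be paired). The vertices of each triangle are labelled $0,1,2$, compatibly with an orientation of $T$. Let $\lambda,\mu$ be a basis of $H_1(T)$ and identify the universal cover of $T$ with $\mathbb R^2$ so that the deck group is $\mathbb Z^2$, with $\lambda,\mu$ acting as the translations by $(1,0),(0,1)$. For $z\in(\mathbb C\setminus\{0,1\})^n$ the $j$-th triangle has modulus $z_j$, i.e. the shape of the triangle $0,1,z_j$; its corners $0,1,2$ have moduli $z_j$, $1/(1-z_j)$, $1-1/z_j$. It is fat if $\Im z_j>0$, flat if $z_j\in\mathbb R$, negatively oriented if $\Im z_j<0$. Let $\mathcal C(z)$ say that at each vertex of $\mathcal T$ the product of the moduli of the corners is $1$, and $\mathcal C^*(z)$ that moreover the sum of their arguments is $2\pi$. When $\Im z_j\ge 0$ for all $j$ the arguments are those in $[0,\pi]$; near such a point they are extended by continuity. For a simplicial loop $\gamma$ put $h(z)([\gamma])=(-1)^{m}L_z(\gamma)$, where $m$ is the number of vertices of $\gamma$ and $L_z(\gamma)$ is the product of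 the moduli of all corners which $\gamma$ leaves on its right, when $T$ is viewed so that the vertices $0,1,2$ of each triangle are in counterclockwise order (on its left, when $T$ is viewed from the other side). **Assumptions.** Let $z^{(0)}$ satisfy $\mathcal C^*$ and $h(z^{(0)})(\lambda)=h(z^{(0)})(\mu)=1$, with $\Im z^{(0)}_j\ge 0$ for all $j$ and $\Im z^{(0)}_j>0$ for some $j$. Assume that there is a Euclidean structure on $T$ inducing on the $j$-th triangle, for all $j$, the structure with modulus $z^{(0)}_j$ (flat triangles being collapsed to segments). Call foliated components the maximal families of flat triangles connected through common sides. Assume that each is a bigon: glued along its inner sides it is a triangulated polygon without interior vertices, all of whose vertices have angle $\pi$ except two, the ends, which have angle $0$, and no side is the longest side of two flat triangles. Assume that bigons meet each other and themselves at most at their ends. **The structure defined by $z$.** Gluing each flat triangle of $z^{(0)}$ to its neighbour along its longest side groups the triangles into polygons $\tilde\sigma_i$, each with exactly one fat triangle. Placing triangles of moduli $z_j$ side by side determines, up to similarity, vertices in $\mathbb C$ for each $\tilde\sigma_i$. A similarity structure on $T$ (an atlas with changes of charts $w\mapsto aw+b$, $a\neq0$) is *defined by $z$* if it induces on each $\tilde\sigma_i$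 the structure of the planar polygon with these vertices and straight sides: some developing map sends the vertices of each lifted triangle to a non-degenerate triple of modulus $z_j$, sends each side of each lifted polygon homeomorphically to a segment, and is injective on each lifted polygon. **Proposition.** There is an open neighbourhood $\mathcal U$ of $z^{(0)}$ in $(\mathbb C\setminus\{0,1\})^n$ such that, with $\mathcal D=\{z\in\mathcal U:\mathcal C(z)\}$: 1. The arguments of the corners are defined by continuity on $\mathcal U$, and $\mathcal C(z)\Leftrightarrow\mathcal C^*(z)$ for $z\in\mathcal U$. 2. For $z\in\mathcal D$: $h(z)(\lambda)=1$ if and only if $h(z)(\mu)=1$. 3. For $z\in\mathcal D$ the numbers $h(z)(\lambda),h(z)(\mu)$ lie in $\{|w-1|<1\}$. With $u(z)=\log h(z)(\lambda)$, $v(z)=\log h(z)(\mu)$, where $\log$ is the holomorphic branch with $\log 1=0$, there is $\tau\in\mathbb C\setminus\mathbb R$ such that $v(z)/u(z)\to\tau$ as $z\to z^{(0)}$ in $\mathcal D$ with $u(z)\ne0$. 4. Each $z\in\mathcal D$ defines on $T$ a similarity structure $\mathfrak s(z)$, unique up to a homeomorphism of $T$ that has a lift to $\mathbb R^2$ commuting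 with $\mathbb Z^2$. 5. For $z\in\mathcal D$, $\mathfrak s(z)$ is compatible with a Euclidean structure on $T$ if and only if $h(z)(\lambda)=1$. 6. If $z\in\mathcal D$ and $h(z)(\lambda)\neq1$, then, after changing the identification of the universal cover with $\mathbb R^2$ by a homeomorphism of $\mathbb R^2$ commuting with $\mathbb Z^2$, a developing map for $\mathfrak s(z)$ is $(x,y)\mapsto\exp(u(z)x+v(z)y)$. Here $h(z)(\lambda)$ and $h(z)(\mu)$ may be computed with any simplicial loops in the classes $\lambda,\mu$. -/

import Mathlib

open Set Filter Topology

noncomputable section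

/-! ## Similarity and Euclidean structures on a surface -/

/-- Maps of (open subsets of) `ℂ` that are locally `w ↦ a w + b` with `a ∈ S`. -/
def affinePregroupoid (S : Submonoid ℂ) : Pregroupoid ℂ where
  property f u := ∀ x ∈ u, ∃ a ∈ S, ∃ b : ℂ, ∀ᶠ y in 𝓝 x, f y = a * y + b
  comp := by
    intro f g u v hf hg _ _ _ x hx
    obtain ⟨a, ha, b, h⟩ := hf x hx.1
    obtain ⟨a', ha', b', h'⟩ := hg (f x) hx.2
    have hc : ContinuousAt f x := by
      have : ContinuousAt (fun y : ℂ => a * y + b) x := by fun_prop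
      exact this.congr (h.mono fun y hy => hy.symm)
    refine ⟨a' * a, S.mul_mem ha' ha, a' * b + b', ?_⟩
    filter_upwards [h, hc.eventually h'] with y hy hy'
    rw [Function.comp_apply, hy', hy]
    ring
  id_mem := fun x _ => ⟨1, S.one_mem, 0, Eventually.of_forall fun y => by simp⟩
  locality := by
    intro f u _ h x hx
    obtain ⟨v, _, hxv, hv⟩ := h x hx
    exact hv x ⟨hx, hxv⟩
  congr := by
    intro f g u hu hfg hf x hx
    obtain ⟨a, ha, b, h⟩ := hf x hx
    refine ⟨a, ha, b, ?_⟩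
    filter_upwards [h, hu.mem_nhds hx] with y hy hyu
    rw [hfg y hyu, hy]

/-- The pseudogroup of local homeomorphisms of `ℂ` of the form `w ↦ a w + b`, `a ≠ 0`
(oriented similarities, i.e. complex affine maps). -/
def similarityGroupoid : StructureGroupoid ℂ :=
  (affinePregroupoid (nonZeroDivisors ℂ)).groupoid

/-- The pseudogroup of local homeomorphisms of `ℂ` of the form `w ↦ a w + b`, `|a| = 1`
(oriented isometries). -/
def euclideanGroupoid : StructureGroupoid ℂ :=
  (affinePregroupoid (Submonoid.unitSphere ℂ)).groupoid

/-- A geometric structure on `T` modelled on `ℂ`: an atlas whose changes of charts lie in `G`. -/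
structure GeometricStructure (G : StructureGroupoid ℂ) (T : Type*) [TopologicalSpace T] where
  chartedSpace : ChartedSpace ℂ T
  hasGroupoid : HasGroupoid T G

/-- The maximal atlas of a geometric structure. -/
def GeometricStructure.charts {G : StructureGroupoid ℂ} {T : Type*} [TopologicalSpace T]
    (s : GeometricStructure G T) : Set (OpenPartialHomeomorph T ℂ) :=
  letI := s.chartedSpace
  G.maximalAtlas T

/-- Oriented similarity structures (= complex affine structures) on `T`. -/
abbrev SimilarityStructure (T : Type*) [TopologicalSpace T] :=
  GeometricStructure similarityGroupoid T

/-- Oriented Euclidean structures on `T`. -/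
abbrev EuclideanStructure (T : Type*) [TopologicalSpace T] :=
  GeometricStructure euclideanGroupoid T

/-- The similarity structure `s` is compatible with some Euclidean structure. -/
def SimilarityStructure.CompatibleWithEuclidean {T : Type*} [TopologicalSpace T]
    (s : SimilarityStructure T) : Prop :=
  ∃ e : EuclideanStructure T, e.charts ⊆ GeometricStructure.charts s

/-- `D` is a developing map for `s`, where `p : X → T` is the universal covering: locally, `D` is
a chart of `s` composed with `p`. -/
def SimilarityStructure.IsDevelopingMap {T X : Type*} [TopologicalSpace T] [TopologicalSpace X]
    (s : SimilarityStructure T) (p : X → T) (D : X → ℂ) : Prop :=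
  ∀ x, ∃ e ∈ GeometricStructure.charts s, p x ∈ e.source ∧ ∀ᶠ y in 𝓝 x, D y = e (p y)

/-- The vector of `ℝ²` with integer coordinates `(m, n)`. -/
def intVec (m n : ℤ) : ℝ × ℝ := (m, n)

/-- Homeomorphisms of `ℝ²` commuting with the translations in `ℤ²`. -/
def CommutesWithIntTranslations (φ : (ℝ × ℝ) ≃ₜ (ℝ × ℝ)) : Prop :=
  ∀ (x : ℝ × ℝ) (m n : ℤ), φ (x + intVec m n) = φ x + intVec m n

/-- `s` and `s'` differ by a homeomorphism of `T` which has a lift to the universal cover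
`p : ℝ² → T` commuting with all deck transformations (for the torus: which is isotopic to the
identity). -/
def SimilarityStructure.Isotopic {T : Type*} [TopologicalSpace T] (p : ℝ × ℝ → T)
    (s s' : SimilarityStructure T) : Prop :=
  ∃ (F : T ≃ₜ T) (φ : (ℝ × ℝ) ≃ₜ (ℝ × ℝ)), CommutesWithIntTranslations φ ∧
    (∀ x, F (p x) = p (φ x)) ∧
    ∀ e ∈ GeometricStructure.charts s',
      F.transOpenPartialHomeomorph e ∈ GeometricStructure.charts s

/-! ## Triangulated surfaces -/

/-- A closed triangulated surface: `n` triangles, each with vertices `0, 1, 2` in the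
counterclockwise order; side `(j, i)` goes from vertex `i` to vertex `i + 1` of triangle `j`.
Sides are paired, and paired sides are glued with reversed direction.
As everywhere in the theory of ideal triangulations, a triangle may be glued to itself and two
simplices may share more than one face. -/
structure TriangulatedSurface (n : ℕ) where
  pairing : Equiv.Perm (Fin n × Fin 3)
  involutive : ∀ c, pairing (pairing c) = c
  ne_self : ∀ c, pairing c ≠ c

namespace TriangulatedSurface

variable {n : ℕ} (K : TriangulatedSurface n)

/-- The gluing of points of sides: side `(j, i)` is glued to its partner `(j', i')`, vertex `i`
going to vertex `i' + 1` and vertex `i + 1` to vertex `i'` (barycentric coordinates). -/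
def GlueRel (a b : Fin n × stdSimplex ℝ (Fin 3)) : Prop :=
  ∃ i i' : Fin 3, K.pairing (a.1, i) = (b.1, i') ∧ a.2 (i + 2) = 0 ∧ b.2 (i' + 2) = 0 ∧
    a.2 i = b.2 (i' + 1) ∧ a.2 (i + 1) = b.2 i'

/-- The surface: the quotient of the disjoint union of the triangles by the gluing. -/
def Space : Type := Quot K.GlueRel

instance : TopologicalSpace K.Space :=
  inferInstanceAs (TopologicalSpace (Quot K.GlueRel))

/-- The characteristic map of triangle `j`. -/
def toSpace (j : Fin n) (x : stdSimplex ℝ (Fin 3)) : K.Space := Quot.mk _ (j, x)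

/-- `p` exhibits `ℝ²` as the universal cover of the surface, with deck transformation group `ℤ²`.
So the surface is a torus; the class of the loops lifting to paths from `x` to `x + (1, 0)`,
respectively to `x + (0, 1)`, is called `λ`, respectively `μ`, and `λ, μ` is a basis of the first
homology group. (For every torus and every basis of its first homology there is such a `p`.) -/
structure IsTorusCovering (p : ℝ × ℝ → K.Space) : Prop where
  isCoveringMap : IsCoveringMap p
  surjective : Function.Surjective p
  fibers : ∀ x y, p x = p y ↔ ∃ m k : ℤ, y = x + intVec m k

/-- A lift to `ℝ²` of one of the triangles of the triangulation. -/
structure LiftedTriangle (p : ℝ × ℝ → K.Space) where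
  idx : Fin n
  map : C(stdSimplex ℝ (Fin 3), ℝ × ℝ)
  lifts : ∀ x, p (map x) = K.toSpace idx x

/-- The `i`-th vertex of a lifted triangle. -/
def LiftedTriangle.vertex {K : TriangulatedSurface n} {p : ℝ × ℝ → K.Space}
    (t : K.LiftedTriangle p) (i : Fin 3) : ℝ × ℝ := t.map (stdSimplex.vertex i)

/-! ### Corners, and the consistency equations

A pair `c = (j, i)` stands for the corner of triangle `j` at its vertex `i`, for the side of `j`
from vertex `i` to vertex `i + 1`, and for the edge of the triangulation that this side becomes,
with its direction. Every directed edge arises so exactly once. -/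

/-- The next corner, counterclockwise, around the same vertex of the surface. -/
def rot : Equiv.Perm (Fin n × Fin 3) :=
  ((Equiv.refl (Fin n)).prodCongr (Equiv.addRight (2 : Fin 3))).trans K.pairing

/-- Corners at the same vertex of the surface. -/
def SameVertex (c c' : Fin n × Fin 3) : Prop := K.rot.SameCycle c c'

open Classical in
/-- The corners around the vertex of `c`. -/
def corners (c : Fin n × Fin 3) : Finset (Fin n × Fin 3) :=
  Finset.univ.filter fun c' => K.SameVertex c c'

end TriangulatedSurface

/-- The modulus of a corner: the triangle of modulus `w` is similar to `0, 1, w`, and its moduli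
at the vertices `0, 1, 2` are `w`, `1 / (1 - w)`, `1 - 1 / w`. -/
def cornerModulus {n : ℕ} (z : Fin n → ℂ) (c : Fin n × Fin 3) : ℂ :=
  ![z c.1, 1 / (1 - z c.1), 1 - 1 / z c.1] c.2

/-- The argument of a corner for `z` near `z₀`: the branch, continuous near `z₀`, which at `z₀` is
the argument in `[0, π]` when the moduli `z₀` are in the upper half-plane or real. -/
def cornerArg {n : ℕ} (z₀ z : Fin n → ℂ) (c : Fin n × Fin 3) : ℝ :=
  (cornerModulus z₀ c).arg + (cornerModulus z c / cornerModulus z₀ c).arg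

/-- `z` has all its coordinates in `ℂ ∖ {0, 1}`. -/
def Nondegenerate {n : ℕ} (z : Fin n → ℂ) : Prop := ∀ j, z j ≠ 0 ∧ z j ≠ 1

namespace TriangulatedSurface

variable {n : ℕ} (K : TriangulatedSurface n)

/-- Consistency equations without arguments: the product of the moduli around each vertex
is `1`. -/
def Consistent (z : Fin n → ℂ) : Prop :=
  ∀ c, ∏ c' ∈ K.corners c, cornerModulus z c' = 1

/-- Consistency equations: moreover, the sum of the arguments around each vertex is `2π`. -/
def ConsistentArg (z₀ z : Fin n → ℂ) : Prop :=
  K.Consistent z ∧ ∀ c, ∑ c' ∈ K.corners c, cornerArg z₀ z c' = 2 * Real.pi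

/-! ### Simplicial loops and the homomorphism `h(z)` -/

/-- The directed edge path `γ` has a lift to `ℝ²` from `x` to `y`. -/
def LiftsTo (p : ℝ × ℝ → K.Space) : List (Fin n × Fin 3) → ℝ × ℝ → ℝ × ℝ → Prop
  | [], x, y => x = y
  | d :: γ, x, y => ∃ t : K.LiftedTriangle p, t.idx = d.1 ∧ t.vertex d.2 = x ∧
      LiftsTo p γ (t.vertex (d.2 + 1)) y

/-- `γ` is a simplicial loop, given as the list of its directed edges, in the class
`m λ + k μ`. -/
def IsLoop (p : ℝ × ℝ → K.Space) (m k : ℤ) (γ : List (Fin n × Fin 3)) : Prop :=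
  γ ≠ [] ∧ ∃ x, K.LiftsTo p γ x (x + intVec m k)

/-- For consecutive edges `d, d'` of a path, the number of corners met when turning
counterclockwise around their common vertex from the reversed edge of `d` to `d'`. -/
def turn (d d' : Fin n × Fin 3) : ℕ := sInf {N | (K.rot ^ N) (K.pairing d) = d'}

/-- The product of the moduli of these corners. -/
def turnModulus (z : Fin n → ℂ) (d d' : Fin n × Fin 3) : ℂ :=
  ∏ l ∈ Finset.range (K.turn d d'), cornerModulus z ((K.rot ^ l) (K.pairing d))

/-- `h(z)([γ])`: the sign `(-1)` to the number of vertices of `γ`, times the product of the moduli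
of all the corners on one side of `γ`. This side is the right of `γ` when the surface is viewed so
that vertices `0, 1, 2` of each triangle are in counterclockwise order (as in `ℂ`), that is, the
left of `γ` when it is viewed from the other side. With this choice `h(z)` is the linear part of
the holonomy; the other choice would give its inverse. -/
def hol (z : Fin n → ℂ) (γ : List (Fin n × Fin 3)) : ℂ :=
  (-1) ^ γ.length * ((γ.zip (γ.rotate 1)).map fun q => K.turnModulus z q.1 q.2).prod

/-- `M` equations (completeness): `h(z)(λ) = h(z)(μ) = 1`. -/
def Complete (p : ℝ × ℝ → K.Space) (z : Fin n → ℂ) : Prop :=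
  (∀ γ, K.IsLoop p 1 0 γ → K.hol z γ = 1) ∧ (∀ γ, K.IsLoop p 0 1 γ → K.hol z γ = 1)

/-- There is on the torus a Euclidean structure `ℂ / (ℤ ω₁ + ℤ ω₂)` inducing on each triangle `j`
the structure with modulus `z₀ j` (a collapsed one when `z₀ j` is real): `f` is the lift to the
universal covers of the map which collapses the flat triangles. -/
def InducesEuclidean (p : ℝ × ℝ → K.Space) (z₀ : Fin n → ℂ) : Prop :=
  ∃ (ω₁ ω₂ : ℂ) (f : ℝ × ℝ → ℂ), LinearIndependent ℝ ![ω₁, ω₂] ∧ Continuous f ∧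
    (∀ (x : ℝ × ℝ) (m k : ℤ), f (x + intVec m k) = f x + m * ω₁ + k * ω₂) ∧
    ∀ t : K.LiftedTriangle p, ∃ a b : ℂ, a ≠ 0 ∧
      ∀ x, f (t.map x) = a * ((x 1 : ℂ) + (x 2 : ℂ) * z₀ t.idx) + b

end TriangulatedSurface

/-! ### Flat triangles and bigons -/

/-- Triangle `j` is flat. -/
def IsFlat {n : ℕ} (z₀ : Fin n → ℂ) (j : Fin n) : Prop := (z₀ j).im = 0

/-- Side `c` is the longest side of a flat triangle: the one with angle zero at each endpoint. -/
def IsLongSide {n : ℕ} (z₀ : Fin n → ℂ) (c : Fin n × Fin 3) : Prop :=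
  IsFlat z₀ c.1 ∧ (cornerModulus z₀ c).arg = 0 ∧ (cornerModulus z₀ (c.1, c.2 + 1)).arg = 0

/-- Corner `c` is the corner with angle `π` of a flat triangle. -/
def IsMidCorner {n : ℕ} (z₀ : Fin n → ℂ) (c : Fin n × Fin 3) : Prop :=
  IsFlat z₀ c.1 ∧ (cornerModulus z₀ c).arg = Real.pi

namespace TriangulatedSurface

variable {n : ℕ} (K : TriangulatedSurface n)

/-- Flat triangles with a common side. -/
def FlatAdj (z₀ : Fin n → ℂ) (j j' : Fin n) : Prop :=
  IsFlat z₀ j ∧ IsFlat z₀ j' ∧ ∃ i i', K.pairing (j, i) = (j', i')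

/-- The foliated component of the flat triangle `j`: the flat triangles which can be reached from
`j` through sides separating two flat triangles. -/
def foliatedComponent (z₀ : Fin n → ℂ) (j : Fin n) : Set (Fin n) :=
  {j' | Relation.ReflTransGen (K.FlatAdj z₀) j j'}

/-- From corner `c` one reaches `c'`, turning around their vertex through flat corners only. -/
def FlatTurn (z₀ : Fin n → ℂ) (c c' : Fin n × Fin 3) : Prop :=
  ∃ k : ℕ, (∀ l ≤ k, IsFlat z₀ ((K.rot ^ l) c).1) ∧ (K.rot ^ k) c = c'

/-- Flat corners in the same flat sector of a vertex; the flat sectors at the vertices of the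
surface are the vertices of the foliated components. -/
def SameSector (z₀ : Fin n → ℂ) (c c' : Fin n × Fin 3) : Prop :=
  K.FlatTurn z₀ c c' ∨ K.FlatTurn z₀ c' c

/-- A foliated component `C` is a bigon. -/
structure IsBigon (z₀ : Fin n → ℂ) (C : Set (Fin n)) : Prop where
  /-- The component, glued along its inner sides only, is a disc with all its vertices on the
  boundary: the graph dual to its triangulation is a tree. -/
  disc : {c : Fin n × Fin 3 | c.1 ∈ C ∧ (K.pairing c).1 ∈ C}.ncard + 2 = 2 * C.ncard
  /-- All the vertices of this polygon have angle `0` (the ends) or `π`. As there are two more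
  vertices than triangles, and each triangle has a single angle `π`, it has exactly two ends. -/
  angle_le : ∀ c c', c.1 ∈ C → c'.1 ∈ C → IsMidCorner z₀ c → IsMidCorner z₀ c' →
    K.SameSector z₀ c c' → c = c'
  /-- No inner edge crosses the bigon all the way along the longest sides of both its
  neighbours. -/
  long_side : ∀ c, c.1 ∈ C → (K.pairing c).1 ∈ C → IsLongSide z₀ c →
    ¬ IsLongSide z₀ (K.pairing c)

/-- Foliated components are bigons that intersect each other (and themselves) at their ends only:
a vertex of the surface which is not an end of a bigon having it as a vertex belongs to a single
flat sector. -/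
structure FoliatedByBigons (z₀ : Fin n → ℂ) : Prop where
  bigon : ∀ j, IsFlat z₀ j → K.IsBigon z₀ (K.foliatedComponent z₀ j)
  ends_only : ∀ c c', IsMidCorner z₀ c → IsFlat z₀ c'.1 → K.SameVertex c c' →
    K.SameSector z₀ c c'

/-! ### The similarity structure defined by `z` -/

/-- `t'` is the neighbour of the lifted flat triangle `t` along its longest side. -/
def LongNeighbour (p : ℝ × ℝ → K.Space) (z₀ : Fin n → ℂ) (t t' : K.LiftedTriangle p) : Prop :=
  ∃ i i', K.pairing (t.idx, i) = (t'.idx, i') ∧ IsLongSide z₀ (t.idx, i) ∧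
    t.vertex i = t'.vertex (i' + 1) ∧ t.vertex (i + 1) = t'.vertex i'

/-- Gluing every flat triangle to its neighbour along the longest side groups the triangles into
polygons, each with exactly one fat triangle. This is the relation, between lifted triangles, of
belonging to the same lifted polygon. -/
def SamePolygon (p : ℝ × ℝ → K.Space) (z₀ : Fin n → ℂ) :
    K.LiftedTriangle p → K.LiftedTriangle p → Prop :=
  Relation.EqvGen (K.LongNeighbour p z₀)

/-- The sides of the polygons: those along which no gluing was done. -/
def IsPolygonSide (z₀ : Fin n → ℂ) (c : Fin n × Fin 3) : Prop :=
  ¬ IsLongSide z₀ c ∧ ¬ IsLongSide z₀ (K.pairing c)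

/-- `s` is a similarity structure defined by the moduli `z` (near `z₀`): the triangles of modulus
`z j`, possibly flat or negatively oriented, determine the vertices in `ℂ` of each of the polygons
obtained by gluing every triangle that is flat for `z₀` along its longest side; and `s` induces on
each of these polygons the structure of the planar polygon with these vertices. In terms of a
developing map `D`:
* the vertices of each lifted triangle have images forming a triangle of modulus `z j`;
* each side of a polygon is mapped homeomorphically to a straight segment;
* each lifted polygon is embedded by `D`. -/
def Defines (p : ℝ × ℝ → K.Space) (z₀ z : Fin n → ℂ) (s : SimilarityStructure K.Space) : Prop :=
  ∃ D : ℝ × ℝ → ℂ, s.IsDevelopingMap p D ∧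
    (∀ t : K.LiftedTriangle p, D (t.vertex 1) ≠ D (t.vertex 0) ∧
      D (t.vertex 2) - D (t.vertex 0) = z t.idx * (D (t.vertex 1) - D (t.vertex 0))) ∧
    (∀ (t : K.LiftedTriangle p) (i : Fin 3), K.IsPolygonSide z₀ (t.idx, i) →
      InjOn (fun x => D (t.map x)) {x | x (i + 2) = 0} ∧
      (fun x => D (t.map x)) '' {x | x (i + 2) = 0} =
        segment ℝ (D (t.vertex i)) (D (t.vertex (i + 1)))) ∧
    (∀ t t' : K.LiftedTriangle p, K.SamePolygon p z₀ t t' →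
      ∀ x x', D (t.map x) = D (t'.map x') → t.map x = t'.map x')

end TriangulatedSurface

end

open Set Filter Topology
noncomputable section
/-! ## Points of the standard triangle -/

/-! Call a function `Q` on the vertices of the lifted triangulation a placement for `z` if the three
vertices of each lifted triangle go to a triangle of modulus `z j`. The equations C(z) say that
triangles laid side by side around a vertex close up, so, the plane being simply connected, they are
equivalent to the absence of obstruction to a placement (`exists_isPlacement`). Two placements
differ by one affine map (`IsPlacement.exists_affine`). Composing with a deck transformation gives
another placement, so `Q` is equivariant: the generators act by `ζ ↦ a ζ + b` and `ζ ↦ a' ζ + b'`.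
Multiplying the turns along a loop shows that `a`, `a'` are the numbers h(z)(λ), h(z)(μ)
(`IsPlacement.hol_eq`). If `Q` is normalised at two vertices, these coefficients depend continuously
on `z`, and they tend to `1, ω₁, 1, ω₂`, where `ω₁, ω₂` are the periods of the Euclidean structure.
The two affine maps commute, that is `(a' - 1) b = (a - 1) b'`. Hence `a = 1 ↔ a' = 1` near `z₀`,
and `log a' / log a` behaves like `b' / b` and tends to `τ = ω₂ / ω₁`, which is not real.

A similarity structure is obtained from an equivariant local homeomorphism `D` that extends `Q` and
is affine on the polygon sides (`exists_extendsPlacement`). If all triangles are fat, `D` is the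
piecewise affine extension: angle sums at vertices are positive multiples of `2π`, and the count `2
V = n` of vertices and triangles forces each to be exactly `2π`. Flat triangles are removed one at a
time. Among all longest sides of flat triangles take a longest one. Its other neighbour is fat, and
exchanging the diagonal of the quadrilateral formed by the two triangles gives two fat triangles
with the same vertices and the same placement. Only sides interior to polygons are ever exchanged,
so the polygon sides survive to the end. The bigon hypothesis enters by ensuring that no side is the
longest side of two flat triangles.

Everything else is read from `D`. If `a = 1`, then `D` is at bounded distance from a linear
isomorphism, hence is a proper local homeomorphism of the plane, hence a homeomorphism. If `a ≠ 1`,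
the holonomy has a common fixed point `b / (1 - a)`, very far away because `b` stays near `ω₁ ≠ 0`.
A maximum principle (`norm_sub_le_of_isOpenMap`) bounds `D` on a fundamental domain by its values at
vertices, so that `D - b / (1 - a)` has a global logarithm `L`. This `L` is quasiperiodic with
periods `log a`, `log a'`, which are independent as their ratio is near `τ`, so `L` is a
homeomorphism by the same argument (`exists_homeomorph_of_quasiperiodic`). Comparing the
homeomorphisms `L` of two structures gives uniqueness; comparing `L` with the linear map having the
same periods gives the exponential normal form. Injectivity of `D` at the scale of a polygon follows
since `L` stays close to a linear map. Finally, compatibility with a Euclidean structure means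
unitary holonomy. If `a ≠ 1` this would make `log a' / log a` real, which it is not; if `a = 1` the
holonomy consists of translations. -/

/-- The point of the standard triangle with coordinates `a, b, c` at `i, i + 1, i + 2`. -/
def triPoint (i : Fin 3) (a b c : ℝ) (ha : 0 ≤ a) (hb : 0 ≤ b) (hc : 0 ≤ c) (h : a + b + c = 1) :
    stdSimplex ℝ (Fin 3) :=
  ⟨fun k => if k = i then a else if k = i + 1 then b else c, by
    refine ⟨fun k => by dsimp only; split_ifs <;> assumption, ?_⟩
    fin_cases i <;> simp [Fin.sum_univ_three] <;> linarith⟩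

section triPoint
variable {i : Fin 3} {a b c : ℝ} {ha : 0 ≤ a} {hb : 0 ≤ b} {hc : 0 ≤ c} {h : a + b + c = 1}

theorem triPoint_zero : triPoint i a b c ha hb hc h i = a := by
  change (if _ then _ else _) = _
  simp

theorem triPoint_one : triPoint i a b c ha hb hc h (i + 1) = b := by
  change (if _ then _ else _) = _
  fin_cases i <;> simp

theorem triPoint_two : triPoint i a b c ha hb hc h (i + 2) = c := by
  change (if _ then _ else _) = _
  fin_cases i <;> simp

end triPoint

theorem Fin3.forall_iff_add (i : Fin 3) (P : Fin 3 → Prop) :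
    (∀ k, P k) ↔ P i ∧ P (i + 1) ∧ P (i + 2) := by
  constructor
  · exact fun h => ⟨h _, h _, h _⟩
  · rintro ⟨h0, h1, h2⟩ k
    fin_cases i <;> fin_cases k <;> simp_all

theorem Fin3.eq_or (i k : Fin 3) : k = i ∨ k = i + 1 ∨ k = i + 2 := by
  revert i k; decide

theorem Fin3.add_two_add_one (i : Fin 3) : i + 2 + 1 = i := by revert i; decide
theorem Fin3.add_two_add_two (i : Fin 3) : i + 2 + 2 = i + 1 := by revert i; decide
theorem Fin3.add_one_add_one (i : Fin 3) : i + 1 + 1 = i + 2 := by revert i; decide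
theorem Fin3.add_one_add_two (i : Fin 3) : i + 1 + 2 = i := by revert i; decide
theorem Fin3.ne_add_one (i : Fin 3) : i ≠ i + 1 := by revert i; decide
theorem Fin3.ne_add_two (i : Fin 3) : i ≠ i + 2 := by revert i; decide
theorem Fin3.add_one_ne_add_two (i : Fin 3) : i + 1 ≠ i + 2 := by revert i; decide

theorem Fin3.sum_eq {M : Type*} [AddCommMonoid M] (i : Fin 3) (f : Fin 3 → M) :
    ∑ k, f k = f i + f (i + 1) + f (i + 2) := by
  rw [Fin.sum_univ_three]
  fin_cases i <;> simp <;> abel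

theorem stdSimplex.add_add_eq_one (i : Fin 3) (x : stdSimplex ℝ (Fin 3)) :
    x i + x (i + 1) + x (i + 2) = 1 := by
  rw [← Fin3.sum_eq i, stdSimplex.sum_eq_one]

theorem stdSimplex.ext_of (i : Fin 3) {x y : stdSimplex ℝ (Fin 3)} (h0 : x i = y i)
    (h1 : x (i + 1) = y (i + 1)) : x = y := by
  have hx := stdSimplex.add_add_eq_one i x
  have hy := stdSimplex.add_add_eq_one i y
  apply stdSimplex.ext
  funext k
  exact (Fin3.forall_iff_add i (fun k => x k = y k)).2 ⟨h0, h1, by linarith⟩ k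

theorem stdSimplex.eq_vertex {x : stdSimplex ℝ (Fin 3)} {k : Fin 3} (h : x k = 1) :
    x = stdSimplex.vertex k := by
  have hx := stdSimplex.add_add_eq_one k x
  have h1 := stdSimplex.zero_le x (k + 1)
  have h2 := stdSimplex.zero_le x (k + 2)
  refine stdSimplex.ext_of k (by simp [h]) ?_
  rw [stdSimplex.vertex_coe, Pi.single_eq_of_ne (Fin3.ne_add_one k).symm]
  linarith

theorem stdSimplex.vertex_self (k : Fin 3) :
    (stdSimplex.vertex k : stdSimplex ℝ (Fin 3)) k = 1 := by simp

theorem stdSimplex.vertex_of_ne {k l : Fin 3} (h : l ≠ k) :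
    (stdSimplex.vertex k : stdSimplex ℝ (Fin 3)) l = 0 := by
  rw [stdSimplex.vertex_coe, Pi.single_eq_of_ne h]

theorem stdSimplex.continuous_coord (k : Fin 3) :
    Continuous fun x : stdSimplex ℝ (Fin 3) => x k :=
  (continuous_apply k).comp continuous_subtype_val

/-- This instance and the next one are what the lifting criterion for the covering `p` asks of the
domain. -/
instance : SimplyConnectedSpace (stdSimplex ℝ (Fin 3)) := by
  have : ContractibleSpace (stdSimplex ℝ (Fin 3)) :=
    (convex_stdSimplex ℝ (Fin 3)).contractibleSpace ⟨_, (stdSimplex.vertex 0).2⟩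
  infer_instance

instance : LocallyPathConnectedSpace (stdSimplex ℝ (Fin 3)) :=
  (convex_stdSimplex ℝ (Fin 3)).locallyPathConnectedSpace

/-- `x` on side `i` and `x'` on side `i'` correspond to each other when the sides are glued. -/
def Glued (i i' : Fin 3) (x x' : stdSimplex ℝ (Fin 3)) : Prop :=
  x (i + 2) = 0 ∧ x' (i' + 2) = 0 ∧ x i = x' (i' + 1) ∧ x (i + 1) = x' i'

theorem Glued.symm {i i' : Fin 3} {x x' : stdSimplex ℝ (Fin 3)} (h : Glued i i' x x') :
    Glued i' i x' x := ⟨h.2.1, h.1, h.2.2.2.symm, h.2.2.1.symm⟩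

theorem Glued.vertex_left (i i' : Fin 3) :
    Glued i i' (stdSimplex.vertex i) (stdSimplex.vertex (i' + 1)) := by
  refine ⟨?_, ?_, ?_, ?_⟩ <;> fin_cases i <;> fin_cases i' <;> simp

theorem Glued.vertex_right (i i' : Fin 3) :
    Glued i i' (stdSimplex.vertex (i + 1)) (stdSimplex.vertex i') :=
  (Glued.vertex_left i' i).symm

theorem Glued.unique {i i' : Fin 3} {x x' x'' : stdSimplex ℝ (Fin 3)} (h : Glued i i' x x')
    (h' : Glued i i' x x'') : x' = x'' :=
  stdSimplex.ext_of i' (h.2.2.2.symm.trans h'.2.2.2) (h.2.2.1.symm.trans h'.2.2.1)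

/-- The point at `s` of side `i`. -/
def sidePoint (i : Fin 3) (s : unitInterval) : stdSimplex ℝ (Fin 3) :=
  triPoint i (1 - s) s 0 (by linarith [s.2.2]) s.2.1 le_rfl (by ring)

theorem continuous_sidePoint (i : Fin 3) : Continuous (sidePoint i) := by
  refine Continuous.subtype_mk (continuous_pi fun k => ?_) _
  split_ifs <;> fun_prop

theorem exists_sidePoint {i : Fin 3} {x : stdSimplex ℝ (Fin 3)} (h : x (i + 2) = 0) :
    ∃ s, sidePoint i s = x := by
  have hx := stdSimplex.add_add_eq_one i x
  refine ⟨⟨x (i + 1), stdSimplex.zero_le x _, stdSimplex.le_one x _⟩, ?_⟩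
  refine stdSimplex.ext_of i ?_ ?_
  · rw [sidePoint, triPoint_zero]; change 1 - x (i + 1) = _; linarith
  · rw [sidePoint, triPoint_one]

theorem glued_sidePoint (i i' : Fin 3) (s : unitInterval) :
    Glued i i' (sidePoint i s) (sidePoint i' (unitInterval.symm s)) := by
  refine ⟨triPoint_two, triPoint_two, ?_, ?_⟩
  · rw [sidePoint, triPoint_zero, sidePoint, triPoint_one]; simp
  · rw [sidePoint, triPoint_one, sidePoint, triPoint_zero]; simp

theorem Glued.exists_right {i : Fin 3} (i' : Fin 3) {x : stdSimplex ℝ (Fin 3)}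
    (h : x (i + 2) = 0) : ∃ x', Glued i i' x x' := by
  obtain ⟨s, rfl⟩ := exists_sidePoint h
  exact ⟨_, glued_sidePoint i i' s⟩

/-! ### Lifts of triangles to the universal cover, and their adjacency. -/

namespace TriangulatedSurface

variable {n : ℕ} {K : TriangulatedSurface n}

theorem rot_apply (c : Fin n × Fin 3) : K.rot c = K.pairing (c.1, c.2 + 2) := rfl

theorem rot_add_one (c : Fin n × Fin 3) : K.rot (c.1, c.2 + 1) = K.pairing c := by
  rw [rot_apply, Fin3.add_one_add_two]

theorem SameVertex.rot_right {c c' : Fin n × Fin 3} (h : K.SameVertex c c') :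
    K.SameVertex c (K.rot c') := Equiv.Perm.sameCycle_apply_right.2 h

theorem sameVertex_pairing (c : Fin n × Fin 3) : K.SameVertex (c.1, c.2 + 1) (K.pairing c) := by
  rw [← rot_add_one]
  exact SameVertex.rot_right (Equiv.Perm.SameCycle.refl _ _)

theorem GlueRel.symm {a b : Fin n × stdSimplex ℝ (Fin 3)} (h : K.GlueRel a b) : K.GlueRel b a := by
  obtain ⟨i, i', h1, h2⟩ := h
  exact ⟨i', i, by rw [← h1, K.involutive], Glued.symm h2⟩

/-- The gluing relation is symmetric, so points are identified exactly when a chain of single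
gluings joins them; later arguments are inductions on this chain. -/
theorem toSpace_eq_iff {a b : Fin n × stdSimplex ℝ (Fin 3)} :
    K.toSpace a.1 a.2 = K.toSpace b.1 b.2 ↔ Relation.ReflTransGen K.GlueRel a b := by
  constructor
  · intro h
    have h' : Relation.EqvGen K.GlueRel a b := Quot.eqvGen_exact h
    clear h
    induction h' with
    | rel _ _ h => exact .single h
    | refl _ => exact .refl
    | symm _ _ _ ih => 
      have _ : Std.Symm K.GlueRel := ⟨fun _ _ h => h.symm⟩
      exact Relation.ReflTransGen.stdSymm.symm _ _ ih
    | trans _ _ _ _ _ ih1 ih2 => exact ih1.trans ih2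
  · intro h
    induction h with
    | refl => rfl
    | tail _ h ih => exact ih.trans (Quot.sound h)

theorem continuous_toSpace (j : Fin n) : Continuous (K.toSpace j) :=
  continuous_quot_mk.comp (by fun_prop : Continuous fun x : stdSimplex ℝ (Fin 3) => (j, x))

variable {p : ℝ × ℝ → K.Space}

namespace LiftedTriangle

@[ext]
theorem ext' {t t' : K.LiftedTriangle p} (h : t.idx = t'.idx) (h' : ∀ x, t.map x = t'.map x) :
    t = t' := by
  obtain ⟨j, f, hf⟩ := t
  obtain ⟨j', f', hf'⟩ := t'
  obtain rfl : j = j' := h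
  obtain rfl : f = f' := ContinuousMap.ext h'
  rfl

/-- The simplex is simply connected, so the characteristic map lifts through `p`, with the image of
one point prescribed. -/
theorem exists_map_eq (hp : K.IsTorusCovering p) {j : Fin n} {x : stdSimplex ℝ (Fin 3)}
    {y : ℝ × ℝ} (h : p y = K.toSpace j x) : ∃ t : K.LiftedTriangle p, t.idx = j ∧ t.map x = y := by
  obtain ⟨F, ⟨h1, h2⟩, -⟩ := hp.isCoveringMap.existsUnique_continuousMap_lifts
    ⟨K.toSpace j, continuous_toSpace j⟩ x y h
  exact ⟨⟨j, F, fun x => congrFun h2 x⟩, rfl, h1⟩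

theorem eq_of_map_eq (hp : K.IsTorusCovering p) {t t' : K.LiftedTriangle p} (h : t.idx = t'.idx)
    {x : stdSimplex ℝ (Fin 3)} (hx : t.map x = t'.map x) : t = t' := by
  refine ext' h fun y => congrFun (hp.isCoveringMap.eq_of_comp_eq t.map.continuous t'.map.continuous
    ?_ x hx) y
  funext z
  rw [Function.comp_apply, Function.comp_apply, t.lifts, t'.lifts, h]

theorem exists_eq_map (hp : K.IsTorusCovering p) (y : ℝ × ℝ) :
    ∃ (t : K.LiftedTriangle p) (x : stdSimplex ℝ (Fin 3)), t.map x = y := by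
  obtain ⟨⟨j, x⟩, h⟩ := Quot.exists_rep (p y)
  obtain ⟨t, -, h⟩ := exists_map_eq hp (j := j) (x := x) h.symm
  exact ⟨t, x, h⟩

theorem exists_idx (hp : K.IsTorusCovering p) (j : Fin n) : ∃ t : K.LiftedTriangle p, t.idx = j := by
  obtain ⟨y, hy⟩ := hp.surjective (K.toSpace j (stdSimplex.vertex 0))
  obtain ⟨t, h, -⟩ := exists_map_eq hp hy
  exact ⟨t, h⟩

/-- The translate of a lifted triangle by a vector of the lattice. -/
def translate (hp : K.IsTorusCovering p) (t : K.LiftedTriangle p) (m k : ℤ) :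
    K.LiftedTriangle p where
  idx := t.idx
  map := ⟨fun x => t.map x + intVec m k, by fun_prop⟩
  lifts x := by
    rw [← t.lifts]
    exact ((hp.fibers _ _).2 ⟨m, k, rfl⟩).symm

theorem translate_map (hp : K.IsTorusCovering p) (t : K.LiftedTriangle p) (m k : ℤ)
    (x : stdSimplex ℝ (Fin 3)) : (t.translate hp m k).map x = t.map x + intVec m k := rfl

theorem translate_idx (hp : K.IsTorusCovering p) (t : K.LiftedTriangle p) (m k : ℤ) :
    (t.translate hp m k).idx = t.idx := rfl

theorem translate_vertex (hp : K.IsTorusCovering p) (t : K.LiftedTriangle p) (m k : ℤ)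
    (i : Fin 3) : (t.translate hp m k).vertex i = t.vertex i + intVec m k := rfl

theorem exists_translate (hp : K.IsTorusCovering p) {t t' : K.LiftedTriangle p}
    (h : t.idx = t'.idx) : ∃ m k, t' = t.translate hp m k := by
  have h1 : p (t.vertex 0) = p (t'.vertex 0) := by
    rw [vertex, vertex, t.lifts, t'.lifts, h]
  obtain ⟨m, k, h2⟩ := (hp.fibers _ _).1 h1
  exact ⟨m, k, eq_of_map_eq hp h.symm (x := stdSimplex.vertex 0) h2⟩

/-- Every lifted triangle is a lattice translate of one of `n` representatives. If a representative
and its translate both have points within `R` of the origin that correspond to each other, the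
translation vector has norm at most `2 R`. -/
theorem finite_meet (hp : K.IsTorusCovering p) {B : Set (ℝ × ℝ)} (hB : Bornology.IsBounded B) :
    {t : K.LiftedTriangle p | (range t.map ∩ B).Nonempty}.Finite := by
  choose T hT using exists_idx hp
  have hbd : Bornology.IsBounded (B ∪ ⋃ j, range (T j).map) :=
    hB.union ((Bornology.isBounded_iUnion).2 fun j => (isCompact_range (T j).map.continuous).isBounded)
  obtain ⟨R, hR⟩ := hbd.subset_closedBall 0
  obtain ⟨N, hN⟩ := exists_nat_ge (R + R)
  have hfin : ((univ : Set (Fin n)) ×ˢ (Icc (-N : ℤ) N ×ˢ Icc (-N : ℤ) N)).Finite :=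
    Set.finite_univ.prod ((finite_Icc _ _).prod (finite_Icc _ _))
  refine (hfin.image fun q => (T q.1).translate hp q.2.1 q.2.2).subset ?_
  rintro t ⟨_, ⟨x, rfl⟩, hx⟩
  obtain ⟨m, k, h⟩ := exists_translate hp (hT t.idx)
  refine ⟨(t.idx, m, k), ?_, h.symm⟩
  have h1 := hR (Or.inl hx)
  have h2 := hR (Or.inr (mem_iUnion.2 ⟨t.idx, ⟨x, rfl⟩⟩))
  rw [h, translate_map] at h1
  rw [mem_closedBall_zero_iff] at h1 h2
  have h3 : ‖intVec m k‖ ≤ N := by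
    calc ‖intVec m k‖ = ‖((T t.idx).map x + intVec m k) - (T t.idx).map x‖ := by simp
      _ ≤ R + R := (norm_sub_le _ _).trans (add_le_add h1 h2)
      _ ≤ N := hN
  have h4 : |(m : ℝ)| ≤ N := (norm_fst_le (intVec m k)).trans h3
  have h5 : |(k : ℝ)| ≤ N := (norm_snd_le (intVec m k)).trans h3
  rw [abs_le] at h4 h5
  refine ⟨mem_univ _, ⟨?_, ?_⟩, ?_, ?_⟩ <;> [have := h4.1; have := h4.2; have := h5.1; have := h5.2] <;>
    exact_mod_cast this

theorem locallyFinite (hp : K.IsTorusCovering p) :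
    LocallyFinite fun t : K.LiftedTriangle p => range t.map := by
  intro y
  exact ⟨Metric.ball y 1, Metric.ball_mem_nhds _ one_pos, finite_meet hp Metric.isBounded_ball⟩

theorem isClosed_range (t : K.LiftedTriangle p) : IsClosed (range t.map) :=
  (isCompact_range t.map.continuous).isClosed

/-- Near a point, only the lifted triangles containing this point are met. -/
theorem eventually_mem (hp : K.IsTorusCovering p) (y : ℝ × ℝ) :
    ∀ᶠ y' in 𝓝 y, ∀ t : K.LiftedTriangle p, y' ∈ range t.map → y ∈ range t.map := by
  have h := (locallyFinite hp).iInter_compl_mem_nhds (fun t => t.isClosed_range) y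
  filter_upwards [h] with y' hy' t ht
  by_contra hn
  exact (mem_iInter₂.1 hy' t hn) ht

end LiftedTriangle

/-- The lifted triangles `t` and `t'` have a common side, side `i` of `t` and side `i'` of `t'`. -/
def Adj (t t' : K.LiftedTriangle p) (i i' : Fin 3) : Prop :=
  K.pairing (t.idx, i) = (t'.idx, i') ∧ ∀ x x', Glued i i' x x' → t.map x = t'.map x'

theorem Adj.symm {t t' : K.LiftedTriangle p} {i i' : Fin 3} (h : Adj t t' i i') :
    Adj t' t i' i :=
  ⟨by rw [← h.1, K.involutive], fun x x' hx => (h.2 _ _ hx.symm).symm⟩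

theorem Adj.vertex_left {t t' : K.LiftedTriangle p} {i i' : Fin 3} (h : Adj t t' i i') :
    t.vertex i = t'.vertex (i' + 1) := h.2 _ _ (Glued.vertex_left i i')

theorem Adj.vertex_right {t t' : K.LiftedTriangle p} {i i' : Fin 3} (h : Adj t t' i i') :
    t.vertex (i + 1) = t'.vertex i' := h.2 _ _ (Glued.vertex_right i i')

/-- The two sides lift the same path of the surface; agreeing at one point, they agree everywhere.
-/
theorem adj_of_glued (hp : K.IsTorusCovering p) {t t' : K.LiftedTriangle p} {i i' : Fin 3}
    (h : K.pairing (t.idx, i) = (t'.idx, i')) {x x' : stdSimplex ℝ (Fin 3)} (hg : Glued i i' x x')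
    (hx : t.map x = t'.map x') : Adj t t' i i' := by
  refine ⟨h, fun y y' hy => ?_⟩
  obtain ⟨s, rfl⟩ := exists_sidePoint hg.1
  obtain ⟨r, rfl⟩ := exists_sidePoint hy.1
  obtain rfl := hg.unique (glued_sidePoint i i' s)
  obtain rfl := hy.unique (glued_sidePoint i i' r)
  have := hp.isCoveringMap.eq_of_comp_eq
    (g₁ := fun s => t.map (sidePoint i s))
    (g₂ := fun s => t'.map (sidePoint i' (unitInterval.symm s)))
    (t.map.continuous.comp (continuous_sidePoint i))
    (t'.map.continuous.comp ((continuous_sidePoint i').comp unitInterval.continuous_symm))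
    ?_ s hx
  · exact congrFun this r
  · funext u
    change p _ = p _
    rw [t.lifts, t'.lifts]
    exact Quot.sound ⟨i, i', h, glued_sidePoint i i' u⟩

theorem exists_adj (hp : K.IsTorusCovering p) (t : K.LiftedTriangle p) (i : Fin 3) :
    ∃ t' : K.LiftedTriangle p, ∃ i', Adj t t' i i' := by
  obtain ⟨t', h1, h2⟩ := LiftedTriangle.exists_map_eq hp (j := (K.pairing (t.idx, i)).1)
    (x := stdSimplex.vertex ((K.pairing (t.idx, i)).2 + 1)) (y := t.vertex i) (by
      rw [LiftedTriangle.vertex, t.lifts]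
      exact Quot.sound ⟨i, (K.pairing (t.idx, i)).2, rfl, Glued.vertex_left _ _⟩)
  exact ⟨t', (K.pairing (t.idx, i)).2, adj_of_glued hp (by rw [h1]) (Glued.vertex_left _ _) h2.symm⟩

theorem Adj.unique (hp : K.IsTorusCovering p) {t t' t'' : K.LiftedTriangle p} {i i' i'' : Fin 3}
    (h : Adj t t' i i') (h' : Adj t t'' i i'') : t' = t'' ∧ i' = i'' := by
  have h1 := h.1.symm.trans h'.1
  rw [Prod.mk.injEq] at h1
  obtain ⟨h1, rfl⟩ := h1
  exact ⟨LiftedTriangle.eq_of_map_eq hp h1 (h.vertex_left.symm.trans h'.vertex_left), rfl⟩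

/-- Points of lifted triangles are identified only through common sides. -/
theorem chain_of_map_eq (hp : K.IsTorusCovering p) {t t' : K.LiftedTriangle p}
    {x x' : stdSimplex ℝ (Fin 3)} (h : t.map x = t'.map x') :
    Relation.ReflTransGen (fun a b : K.LiftedTriangle p × stdSimplex ℝ (Fin 3) =>
      ∃ i i', Adj a.1 b.1 i i' ∧ Glued i i' a.2 b.2) (t, x) (t', x') := by
  have h1 : K.toSpace t.idx x = K.toSpace t'.idx x' := by rw [← t.lifts, ← t'.lifts, h]
  have h2 := (toSpace_eq_iff (a := (t.idx, x)) (b := (t'.idx, x'))).1 h1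
  generalize hb : (t'.idx, x') = b at h2
  induction h2 generalizing t' x' with
  | refl =>
    rw [Prod.mk.injEq] at hb
    obtain ⟨hb, rfl⟩ := hb
    rw [LiftedTriangle.eq_of_map_eq hp hb.symm h]
  | @tail b c hab hbc ih =>
    subst hb
    obtain ⟨i', i, h3, h4⟩ := hbc
    -- The chain of the surface is lifted from its end: the neighbour of `t'` across the last glued
    -- side lifts the last triangle but one.
    obtain ⟨t'', i'', h5⟩ := exists_adj hp t' i
    have h6 : K.pairing (t'.idx, i) = (b.1, i') := by rw [← h3, K.involutive]
    have h7 := h6.symm.trans h5.1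
    rw [Prod.mk.injEq] at h7
    obtain ⟨h7, rfl⟩ := h7
    have h8 : t''.map b.2 = t'.map x' := (h5.2 _ _ (Glued.symm h4)).symm
    have h9 := ih (t' := t'') (x' := b.2) (h.trans h8.symm) (by rw [← t.lifts, ← t''.lifts, h, h8])
      (by rw [← h7])
    exact h9.tail ⟨i', i, h5.symm, h4⟩

/-- A gluing matches barycentric coordinates, and a vertex with nonzero coordinate is not the one
opposite the glued side, so it passes to the next triangle of the chain. This makes the coordinate
of a point of the plane at a vertex well defined. -/
theorem exists_vertex_eq_of_map_eq (hp : K.IsTorusCovering p) {t t' : K.LiftedTriangle p}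
    {x x' : stdSimplex ℝ (Fin 3)} (h : t.map x = t'.map x') {k : Fin 3} (hk : 0 < x k) :
    ∃ k', x' k' = x k ∧ t'.vertex k' = t.vertex k ∧ K.SameVertex (t.idx, k) (t'.idx, k') := by
  replace h := chain_of_map_eq hp h
  generalize hb : (t', x') = b at h
  induction h generalizing t' x' with
  | refl =>
    rw [Prod.mk.injEq] at hb
    obtain ⟨rfl, rfl⟩ := hb
    exact ⟨k, rfl, rfl, Equiv.Perm.SameCycle.refl _ _⟩
  | @tail b c _ hbc ih =>
    subst hb
    obtain ⟨l, h1, h2, h3⟩ := ih (t' := b.1) (x' := b.2) rfl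
    obtain ⟨i, i', h4, h5⟩ := hbc
    dsimp only at h4 h5
    rcases Fin3.eq_or i l with rfl | rfl | rfl
    · refine ⟨i' + 1, by rw [← h1, h5.2.2.1], by rw [← h2, h4.vertex_left], ?_⟩
      refine h3.trans ?_
      have := sameVertex_pairing (K := K) (t'.idx, i')
      rw [h4.symm.1] at this
      exact this.symm
    · refine ⟨i', by rw [← h1, h5.2.2.2], by rw [← h2, h4.vertex_right], ?_⟩
      refine h3.trans ?_
      rw [← h4.1]
      exact sameVertex_pairing (K := K) (b.1.idx, i)
    · rw [h5.1] at h1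
      linarith

theorem sameVertex_of_vertex_eq (hp : K.IsTorusCovering p) {t t' : K.LiftedTriangle p}
    {k k' : Fin 3} (h : t.vertex k = t'.vertex k') : K.SameVertex (t.idx, k) (t'.idx, k') := by
  obtain ⟨l, h1, h2, h3⟩ := exists_vertex_eq_of_map_eq hp (k := k) h (by simp)
  have : l = k' := by
    by_contra hn
    rw [stdSimplex.vertex_of_ne hn] at h1
    simp at h1
  rwa [this] at h3

/-- A compatible family of continuous maps on the lifted triangles defines a continuous map. -/
theorem exists_glue (hp : K.IsTorusCovering p) {Y : Type*} [TopologicalSpace Y]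
    (φ : K.LiftedTriangle p → stdSimplex ℝ (Fin 3) → Y) (hφ : ∀ t, Continuous (φ t))
    (hc : ∀ t t' i i', Adj t t' i i' → ∀ x x', Glued i i' x x' → φ t x = φ t' x') :
    ∃ D : ℝ × ℝ → Y, Continuous D ∧ ∀ t x, D (t.map x) = φ t x := by
  have hwd : ∀ t t' : K.LiftedTriangle p, ∀ x x', t.map x = t'.map x' → φ t x = φ t' x' := by
    intro t t' x x' h
    replace h := chain_of_map_eq hp h
    generalize hb : (t', x') = b at h
    induction h generalizing t' x' with
    | refl =>
      rw [Prod.mk.injEq] at hb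
      obtain ⟨rfl, rfl⟩ := hb
      rfl
    | @tail b c _ hbc ih =>
      subst hb
      obtain ⟨i, i', h4, h5⟩ := hbc
      exact (ih b.1 b.2 rfl).trans (hc _ _ _ _ h4 _ _ h5)
  choose T X hTX using LiftedTriangle.exists_eq_map (K := K) (p := p) hp
  have hD : ∀ t x, φ (T (t.map x)) (X (t.map x)) = φ t x := fun t x => hwd _ _ _ _ (hTX _)
  refine ⟨fun y => φ (T y) (X y), ?_, hD⟩
  -- By local finiteness, continuity may be checked on each closed lifted triangle, whose topology
  -- is the quotient topology of the compact simplex.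
  refine (LiftedTriangle.locallyFinite hp).continuous ?_ (fun t => t.isClosed_range) ?_
  · exact eq_univ_of_forall fun y => mem_iUnion.2 ⟨T y, X y, hTX y⟩
  · intro t
    have hq : IsQuotientMap (rangeFactorization t.map) :=
      IsClosedMap.isQuotientMap (t.map.continuous.subtype_mk _).isClosedMap
        (t.map.continuous.subtype_mk _) rangeFactorization_surjective
    rw [continuousOn_iff_continuous_domRestrict]
    refine hq.continuous_iff.2 ?_
    convert hφ t using 1
    funext x
    exact hD t x

/-- The triangulation of the universal cover is connected. -/
theorem eq_of_adj_invariant (hp : K.IsTorusCovering p) {α : Type*} (s : K.LiftedTriangle p → α)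
    (hs : ∀ t t' i i', Adj t t' i i' → s t = s t') (t t' : K.LiftedTriangle p) : s t = s t' := by
  -- For the discrete topology on `α`, the glued map is a continuous map from the connected plane to
  -- a discrete space.
  let _ : TopologicalSpace α := ⊥
  have _ : DiscreteTopology α := ⟨rfl⟩
  obtain ⟨D, hD, hD'⟩ := exists_glue hp (fun t _ => s t) (fun t => continuous_const)
    fun t t' i i' h x x' _ => hs t t' i i' h
  rw [← hD' t (stdSimplex.vertex 0), ← hD' t' (stdSimplex.vertex 0)]
  exact PreconnectedSpace.constant inferInstance hD

theorem reflTransGen_adj (hp : K.IsTorusCovering p) (t t' : K.LiftedTriangle p) :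
    Relation.ReflTransGen (fun a b : K.LiftedTriangle p => ∃ i i', Adj a b i i') t t' := by
  have := eq_of_adj_invariant hp (fun s => Relation.ReflTransGen
    (fun a b : K.LiftedTriangle p => ∃ i i', Adj a b i i') t s) (fun s s' i i' h => by
      refine propext ⟨fun h' => h'.tail ⟨i, i', h⟩, fun h' => h'.tail ⟨i', i, h.symm⟩⟩) t t'
  exact this ▸ Relation.ReflTransGen.refl

end TriangulatedSurface

/-! ## Products along the orbits of a permutation -/

section orbits

variable {ι : Type*} (r : Equiv.Perm ι)

theorem Equiv.Perm.minimalPeriod_pos' [Finite ι] (x : ι) : 0 < Function.minimalPeriod r x :=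
  Function.minimalPeriod_pos_of_mem_periodicPts
    (Function.Injective.mem_periodicPts r.injective x)

theorem Equiv.Perm.pow_minimalPeriod (x : ι) : (r ^ Function.minimalPeriod r x) x = x := by
  have := Function.iterate_minimalPeriod (f := r) (x := x)
  rwa [Equiv.Perm.iterate_eq_pow] at this

theorem Equiv.Perm.pow_injOn_minimalPeriod (x : ι) :
    Set.InjOn (fun l : ℕ => (r ^ l) x) (Set.Iio (Function.minimalPeriod r x)) := by
  intro a ha b hb h
  refine Function.iterate_injOn_Iio_minimalPeriod ha hb ?_
  simpa only [Equiv.Perm.iterate_eq_pow] using h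

theorem Equiv.Perm.SameCycle.exists_lt_minimalPeriod [Finite ι] {x y : ι} (h : r.SameCycle x y) :
    ∃ l < Function.minimalPeriod r x, (r ^ l) x = y := by
  obtain ⟨k, hk⟩ := h.exists_nat_pow_eq
  refine ⟨k % Function.minimalPeriod r x, Nat.mod_lt _ (r.minimalPeriod_pos' x), ?_⟩
  rw [← hk]
  have := Function.iterate_mod_minimalPeriod_eq (f := r) (x := x) (n := k)
  simpa only [Equiv.Perm.iterate_eq_pow] using this

variable [Fintype ι]

theorem Equiv.Perm.prod_range_minimalPeriod {M : Type*} [CommMonoid M] [DecidableRel r.SameCycle] (m : ι → M) (x : ι) :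
    ∏ l ∈ Finset.range (Function.minimalPeriod r x), m ((r ^ l) x) =
      ∏ y ∈ Finset.univ.filter (fun y => r.SameCycle x y), m y := by
  symm
  refine (Finset.prod_nbij (fun l : ℕ => (r ^ l) x) ?_ ?_ ?_ fun _ _ => rfl).symm
  · intro l _
    simp only [Finset.mem_filter, Finset.mem_univ, true_and]
    exact ⟨l, by simp⟩
  · intro a ha b hb h
    exact r.pow_injOn_minimalPeriod x (by simpa using ha) (by simpa using hb) h
  · intro y hy
    simp only [Finset.coe_filter, Finset.mem_univ, true_and, mem_ofPred_eq] at hy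
    obtain ⟨l, h1, h2⟩ := Equiv.Perm.SameCycle.exists_lt_minimalPeriod r hy
    exact ⟨l, by simpa using h1, h2⟩

theorem Equiv.Perm.prod_range_eq_one {M : Type*} [CommMonoid M] [DecidableRel r.SameCycle] (m : ι → M)
    (hm : ∀ x, ∏ y ∈ Finset.univ.filter (fun y => r.SameCycle x y), m y = 1) {x : ι} {d : ℕ}
    (hd : (r ^ d) x = x) : ∏ l ∈ Finset.range d, m ((r ^ l) x) = 1 := by
  have h1 : Function.minimalPeriod r x ∣ d := by
    refine Function.IsPeriodicPt.minimalPeriod_dvd ?_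
    rw [Function.IsPeriodicPt, Function.IsFixedPt, Equiv.Perm.iterate_eq_pow, hd]
  obtain ⟨q, rfl⟩ := h1
  clear hd
  induction q with
  | zero => simp
  | succ q ih =>
    rw [mul_add, mul_one, Finset.prod_range_add, ih, one_mul]
    have h2 : (r ^ (Function.minimalPeriod r x * q)) x = x := by
      rw [pow_mul]
      exact Function.IsFixedPt.perm_pow (r.pow_minimalPeriod x) q
    rw [← hm x, ← r.prod_range_minimalPeriod]
    refine Finset.prod_congr rfl fun l _ => ?_
    rw [add_comm, pow_add, Equiv.Perm.mul_apply, h2]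

/-- `w x` is the product of `m` along the orbit from a chosen representative to `x`; it does not
depend on the number of steps because products over closed orbits are `1`. With corner moduli for
`m`, the values of `w` are the directions of the successive sides at a vertex. -/
theorem Equiv.Perm.exists_cocycle_eq [DecidableRel r.SameCycle] (m : ι → ℂ) (hm0 : ∀ x, m x ≠ 0)
    (hm : ∀ x, ∏ y ∈ Finset.univ.filter (fun y => r.SameCycle x y), m y = 1) :
    ∃ w : ι → ℂ, (∀ x, w x ≠ 0) ∧ ∀ x, w (r x) = m x * w x := by
  classical
  let rep : ι → ι := fun x => (Quotient.mk (Equiv.Perm.SameCycle.setoid r) x).out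
  have hrep : ∀ x, r.SameCycle (rep x) x := fun x =>
    Quotient.exact (s := Equiv.Perm.SameCycle.setoid r) (Quotient.out_eq _)
  have hrep' : ∀ x, rep (r x) = rep x := fun x => by
    have : Quotient.mk (Equiv.Perm.SameCycle.setoid r) (r x) =
        Quotient.mk (Equiv.Perm.SameCycle.setoid r) x :=
      Quotient.sound (s := Equiv.Perm.SameCycle.setoid r)
        (Equiv.Perm.sameCycle_apply_left.2 (Equiv.Perm.SameCycle.refl r x))
    exact congrArg Quotient.out this
  choose k hk using fun x => (hrep x).exists_nat_pow_eq
  have key : ∀ (x : ι) (a b : ℕ), a ≤ b → (r ^ a) x = (r ^ b) x →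
      ∏ l ∈ Finset.range a, m ((r ^ l) x) = ∏ l ∈ Finset.range b, m ((r ^ l) x) := by
    intro x a b hab h
    obtain ⟨d, rfl⟩ := Nat.exists_eq_add_of_le hab
    rw [Finset.prod_range_add]
    have h1 : (r ^ d) ((r ^ a) x) = (r ^ a) x := by
      rw [← Equiv.Perm.mul_apply, ← pow_add, add_comm, ← h]
    have h2 := r.prod_range_eq_one m hm h1
    have h3 : ∏ l ∈ Finset.range d, m ((r ^ (a + l)) x) = 1 := by
      rw [← h2]
      refine Finset.prod_congr rfl fun l _ => ?_
      rw [add_comm, pow_add, Equiv.Perm.mul_apply]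
    rw [h3, mul_one]
  have key' : ∀ (x : ι) (a b : ℕ), (r ^ a) x = (r ^ b) x →
      ∏ l ∈ Finset.range a, m ((r ^ l) x) = ∏ l ∈ Finset.range b, m ((r ^ l) x) := by
    intro x a b h
    rcases le_total a b with hab | hab
    · exact key x a b hab h
    · exact (key x b a hab h.symm).symm
  refine ⟨fun x => ∏ l ∈ Finset.range (k x), m ((r ^ l) (rep x)),
    fun x => Finset.prod_ne_zero_iff.2 fun l _ => hm0 _, fun x => ?_⟩
  have h1 : (r ^ k (r x)) (rep x) = (r ^ (k x + 1)) (rep x) := by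
    have h2 := hk (r x)
    rw [hrep'] at h2
    rw [h2, pow_succ', Equiv.Perm.mul_apply, hk]
  dsimp only
  rw [hrep', key' _ _ _ h1, Finset.prod_range_succ, hk, mul_comm]

end orbits

/-! ## Sections of local systems on simply connected spaces -/

/-- With discrete fibre the total space is a covering of `B`, so the identity of the simply
connected base lifts; `s i` is this lift read in the chart `i`. -/
theorem FiberBundleCore.exists_section {ι B F : Type*} [TopologicalSpace B] [TopologicalSpace F]
    [DiscreteTopology F] [SimplyConnectedSpace B] [LocallyPathConnectedSpace B] [Nonempty F]
    (Z : FiberBundleCore ι B F) :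
    ∃ s : ι → B → F, (∀ i, ContinuousOn (s i) (Z.baseSet i)) ∧
      ∀ i j, ∀ x ∈ Z.baseSet i ∩ Z.baseSet j, s j x = Z.coordChange i j x (s i x) := by
  have cov : IsCoveringMap (Bundle.TotalSpace.proj : Z.TotalSpace → B) :=
    FiberBundle.isCoveringMap (F := F) (E := Z.Fiber)
  obtain ⟨b⟩ : Nonempty B := inferInstance
  obtain ⟨f⟩ : Nonempty F := inferInstance
  obtain ⟨Γ, ⟨-, h2⟩, -⟩ := cov.existsUnique_continuousMap_lifts (ContinuousMap.id B) b
    (⟨b, f⟩ : Z.TotalSpace) rfl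
  have hΓ : ∀ x, (Γ x).proj = x := fun x => congrFun h2 x
  refine ⟨fun i x => (Z.localTriv i (Γ x)).2, fun i => ?_, ?_⟩
  · refine continuous_snd.comp_continuousOn ?_
    refine (Z.localTriv i).continuousOn_toFun.comp Γ.continuous.continuousOn fun x hx => ?_
    rw [Z.mem_localTriv_source]
    rwa [hΓ]
  · intro i j x hx
    dsimp only
    rw [Z.localTriv_apply, Z.localTriv_apply]
    dsimp only
    rw [hΓ]
    exact (Z.coordChange_comp _ _ _ x ⟨⟨Z.mem_baseSet_at x, hx.1⟩, hx.2⟩ _).symm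

/-! ### Local systems on the triangulated plane are trivial. -/

namespace TriangulatedSurface

variable {n : ℕ} {K : TriangulatedSurface n} {p : ℝ × ℝ → K.Space}

/-- Side `i` of a lifted triangle. -/
def LiftedTriangle.side (t : K.LiftedTriangle p) (i : Fin 3) : Set (ℝ × ℝ) :=
  t.map '' {x | x (i + 2) = 0}

theorem LiftedTriangle.side_subset (t : K.LiftedTriangle p) (i : Fin 3) : t.side i ⊆ range t.map :=
  image_subset_range _ _

theorem LiftedTriangle.isClosed_side (t : K.LiftedTriangle p) (i : Fin 3) :
    IsClosed (t.side i) :=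
  ((isClosed_eq (stdSimplex.continuous_coord _) continuous_const).isCompact.image
    t.map.continuous).isClosed

theorem LiftedTriangle.eventually_mem_side (hp : K.IsTorusCovering p) (y : ℝ × ℝ) :
    ∀ᶠ y' in 𝓝 y, ∀ (t : K.LiftedTriangle p) (i : Fin 3), y' ∈ t.side i → y ∈ t.side i := by
  have h : ∀ i : Fin 3, ∀ᶠ y' in 𝓝 y, ∀ t : K.LiftedTriangle p, y' ∈ t.side i → y ∈ t.side i := by
    intro i
    have h := ((locallyFinite hp).subset fun t => t.side_subset i).iInter_compl_mem_nhds
      (fun t => t.isClosed_side i) y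
    filter_upwards [h] with y' hy' t ht
    by_contra hn
    exact (mem_iInter₂.1 hy' t hn) ht
  filter_upwards [eventually_all.2 h] with y' hy' t i
  exact hy' i t

/-- The points near `y` meeting only triangles and sides which contain `y`. -/
def smallStar (K : TriangulatedSurface n) (p : ℝ × ℝ → K.Space) (y : ℝ × ℝ) : Set (ℝ × ℝ) :=
  {y' | (∀ t : K.LiftedTriangle p, y' ∈ range t.map → y ∈ range t.map) ∧
    ∀ (t : K.LiftedTriangle p) (i : Fin 3), y' ∈ t.side i → y ∈ t.side i}

theorem smallStar_mem_nhds (hp : K.IsTorusCovering p) (y : ℝ × ℝ) : K.smallStar p y ∈ 𝓝 y :=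
  (LiftedTriangle.eventually_mem hp y).and (LiftedTriangle.eventually_mem_side hp y)

theorem isOpen_smallStar (hp : K.IsTorusCovering p) (y : ℝ × ℝ) : IsOpen (K.smallStar p y) := by
  refine isOpen_iff_mem_nhds.2 fun y' hy' => ?_
  filter_upwards [smallStar_mem_nhds hp y'] with y'' h
  exact ⟨fun t ht => hy'.1 t (h.1 t ht), fun t i ht => hy'.2 t i (h.2 t i ht)⟩

theorem self_mem_smallStar (y : ℝ × ℝ) : y ∈ K.smallStar p y :=
  ⟨fun _ h => h, fun _ _ h => h⟩

/-- `σ y` is a solution near `y`. Two local solutions differ by a left factor that is the same for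
all triangles at a point. These factors are the transition functions of a bundle over the plane with
discrete fibre `G`, and a global section of it corrects the local solutions into one global
solution. -/
theorem exists_localSystem_section_of_adj (hp : K.IsTorusCovering p) {G : Type*} [Group G]
    (g : Fin n × Fin 3 → G) (σ : ℝ × ℝ → K.LiftedTriangle p → G)
    (hσ : ∀ y (t t' : K.LiftedTriangle p) i i', Adj t t' i i' → y ∈ t.side i →
      σ y t' = σ y t * g (t.idx, i)) :
    ∃ ξ : K.LiftedTriangle p → G, ∀ t t' i i', Adj t t' i i' → ξ t' = ξ t * g (t.idx, i) := by
  let _ : TopologicalSpace G := ⊥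
  have _ : DiscreteTopology G := ⟨rfl⟩
  -- Crossing a side multiplies both solutions on the right by the same element, which cancels in
  -- the quotient.
  have indep : ∀ y₁ y₂ y, y ∈ K.smallStar p y₁ → y ∈ K.smallStar p y₂ →
      ∀ t t' : K.LiftedTriangle p, y ∈ range t.map → y ∈ range t'.map →
        σ y₁ t * (σ y₂ t)⁻¹ = σ y₁ t' * (σ y₂ t')⁻¹ := by
    rintro y₁ y₂ y h1 h2 t t' ⟨x, rfl⟩ ⟨x', hx'⟩
    have h := chain_of_map_eq hp hx'.symm
    generalize hb : (t', x') = b at h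
    induction h generalizing t' x' with
    | refl =>
      rw [Prod.mk.injEq] at hb
      obtain ⟨rfl, rfl⟩ := hb
      rfl
    | @tail b c _ hbc ih =>
      subst hb
      obtain ⟨i, i', h4, h5⟩ := hbc
      have h6 : b.1.map b.2 = t.map x := by rw [h4.2 _ _ h5, hx']
      have h7 : t.map x ∈ b.1.side i := ⟨b.2, h5.1, h6⟩
      rw [ih b.1 b.2 h6 rfl, hσ y₁ _ _ _ _ h4 (h1.2 _ _ h7), hσ y₂ _ _ _ _ h4 (h2.2 _ _ h7)]
      group
  choose T X hTX using LiftedTriangle.exists_eq_map (K := K) (p := p) hp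
  have hT : ∀ y, y ∈ range (T y).map := fun y => ⟨X y, hTX y⟩
  let Z : FiberBundleCore (ℝ × ℝ) (ℝ × ℝ) G :=
    { baseSet := K.smallStar p
      isOpen_baseSet := isOpen_smallStar hp
      indexAt := id
      mem_baseSet_at := self_mem_smallStar
      coordChange := fun y₁ y₂ y r => r * (σ y₁ (T y) * (σ y₂ (T y))⁻¹)
      coordChange_self := fun i x _ v => by simp
      continuousOn_coordChange := by
        rintro y₁ y₂ ⟨y, r⟩ ⟨⟨h1, h2⟩, -⟩
        refine ContinuousAt.continuousWithinAt ?_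
        refine (continuousAt_const (y := r * (σ y₁ (T y) * (σ y₂ (T y))⁻¹))).congr ?_
        have h3 : ∀ᶠ q : (ℝ × ℝ) × G in 𝓝 (y, r), q.1 ∈ K.smallStar p y ∧ q.2 = r := by
          rw [nhds_prod_eq, nhds_discrete G]
          exact Filter.Eventually.prod_mk (pa := fun q => q ∈ K.smallStar p y)
            (pb := fun q => q = r) (smallStar_mem_nhds hp y) (eventually_pure.2 rfl)
        filter_upwards [h3] with q hq
        rw [hq.2]
        congr 1
        exact indep y₁ y₂ y h1 h2 _ _ (hT y) (hq.1.1 _ (hT q.1))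
      coordChange_comp := fun i j k x _ v => by group }
  obtain ⟨s, hs1, hs2⟩ := Z.exists_section
  -- The corrected solution a priori depends on a point of the triangle; it is locally constant,
  -- hence constant on the simplex.
  let η : K.LiftedTriangle p → stdSimplex ℝ (Fin 3) → G := fun t x =>
    s (t.map x) (t.map x) * σ (t.map x) t
  have hη : ∀ t, Continuous (η t) := by
    intro t
    rw [continuous_iff_continuousAt]
    intro x
    refine (continuousAt_const (y := η t x)).congr ?_
    have h1 : ∀ᶠ y in 𝓝 (t.map x), s (t.map x) y = s (t.map x) (t.map x) := by
      have := (hs1 (t.map x)).continuousAt (smallStar_mem_nhds hp _)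
      rw [ContinuousAt, nhds_discrete G, tendsto_pure] at this
      exact this
    filter_upwards [t.map.continuous.continuousAt.eventually h1,
      t.map.continuous.continuousAt.eventually (smallStar_mem_nhds hp (t.map x))] with x' h2 h3
    have h4 := hs2 (t.map x) (t.map x') (t.map x') ⟨h3, self_mem_smallStar _⟩
    have h5 := indep (t.map x) (t.map x') (t.map x') h3 (self_mem_smallStar _) (T (t.map x')) t
      (hT _) ⟨x', rfl⟩
    change _ = s (t.map x') (t.map x') * σ (t.map x') t
    rw [h4]
    change _ = s (t.map x) (t.map x') * _ * _
    rw [h5, h2]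
    change s (t.map x) (t.map x) * σ (t.map x) t = _
    group
  have hη' : ∀ t x x', η t x = η t x' := fun t x x' =>
    PreconnectedSpace.constant inferInstance (hη t)
  refine ⟨fun t => η t (stdSimplex.vertex 0), fun t t' i i' h => ?_⟩
  dsimp only
  rw [hη' t _ (stdSimplex.vertex i), hη' t' _ (stdSimplex.vertex (i' + 1))]
  change s (t'.vertex (i' + 1)) (t'.vertex (i' + 1)) * σ (t'.vertex (i' + 1)) t' =
    s (t.vertex i) (t.vertex i) * σ (t.vertex i) t * _
  rw [← h.vertex_left, hσ (t.vertex i) t t' i i' h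
    ⟨stdSimplex.vertex i, (Glued.vertex_left i i').1, rfl⟩, mul_assoc]

/-- A system of transition maps along the sides whose holonomy around the vertices is trivial can
be trivialized on the universal cover. -/
theorem exists_localSystem_section (hp : K.IsTorusCovering p)
    (hinj : ∀ t : K.LiftedTriangle p, Function.Injective t.vertex) {G : Type*} [Group G]
    (g W : Fin n × Fin 3 → G) (hg : ∀ c, g (K.pairing c) = (g c)⁻¹)
    (hW : ∀ c, W (K.pairing c) = W (c.1, c.2 + 1) * g c) :
    ∃ ξ : K.LiftedTriangle p → G, ∀ t t' i i', Adj t t' i i' → ξ t' = ξ t * g (t.idx, i) := by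
  classical
  choose T X hTX using LiftedTriangle.exists_eq_map (K := K) (p := p) hp
  have hpos : ∀ y, ∃ k, 0 < X y k := by
    intro y
    by_contra! h
    have h1 := stdSimplex.add_add_eq_one 0 (X y)
    linarith [h 0, h (0 + 1), h (0 + 2)]
  choose k hk using hpos
  -- Near `y`, take a vertex at which `y` has positive coordinate. Every side through `y` contains
  -- it, and `W` at the corner there is a local solution by `hW`. The value `1` serves for triangles
  -- without this vertex, which have no side through `y`.
  refine exists_localSystem_section_of_adj hp g (fun y t =>
    if h : ∃ l, t.vertex l = (T y).vertex (k y) then W (t.idx, h.choose) else 1) ?_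
  intro y t t' i i' hadj hy
  have key : ∀ (s : K.LiftedTriangle p) (l : Fin 3), s.vertex l = (T y).vertex (k y) →
      (if h : ∃ l, s.vertex l = (T y).vertex (k y) then W (s.idx, h.choose) else 1) =
        W (s.idx, l) := by
    intro s l hl
    have h : ∃ l, s.vertex l = (T y).vertex (k y) := ⟨l, hl⟩
    rw [dif_pos h, hinj s (h.choose_spec.trans hl.symm)]
  obtain ⟨x, hx, hxy⟩ := hy
  obtain ⟨l, h1, h2, -⟩ := exists_vertex_eq_of_map_eq hp ((hTX y).trans hxy.symm) (hk y)
  rcases Fin3.eq_or i l with rfl | rfl | rfl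
  · rw [key t l h2, key t' (i' + 1) (by rw [← h2, hadj.vertex_left])]
    have := hW (t'.idx, i')
    rw [← hadj.1, hg, K.involutive] at this
    rw [this, hadj.1]
    simp
  · rw [key t _ h2, key t' i' (by rw [← h2, hadj.vertex_right]), ← hadj.1]
    exact hW (t.idx, i)
  · have h3 := hk y
    rw [← h1] at h3
    exact absurd hx h3.ne'

end TriangulatedSurface

/-! ## Placements of the vertices in the plane -/

/-- The vertices of the model triangle `0, 1, z j`. -/
def stdPos {n : ℕ} (z : Fin n → ℂ) (j : Fin n) : Fin 3 → ℂ := ![0, 1, z j]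

/-- The sides of the model triangles. -/
def sideVec {n : ℕ} (z : Fin n → ℂ) (c : Fin n × Fin 3) : ℂ :=
  stdPos z c.1 (c.2 + 1) - stdPos z c.1 c.2

section model
variable {n : ℕ} {z : Fin n → ℂ}

theorem sideVec_zero (j : Fin n) : sideVec z (j, 0) = 1 := by simp [sideVec, stdPos]
theorem sideVec_one (j : Fin n) : sideVec z (j, 1) = z j - 1 := by simp [sideVec, stdPos]
theorem sideVec_two (j : Fin n) : sideVec z (j, 2) = -z j := by simp [sideVec, stdPos]

theorem sideVec_ne_zero (hz : Nondegenerate z) (c : Fin n × Fin 3) : sideVec z c ≠ 0 := by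
  obtain ⟨j, i⟩ := c
  have h0 := (hz j).1
  have h1 := (hz j).2
  fin_cases i
  · exact (sideVec_zero j).symm ▸ one_ne_zero
  · exact (sideVec_one (z := z) j).symm ▸ sub_ne_zero.2 h1
  · exact (sideVec_two (z := z) j).symm ▸ neg_ne_zero.2 h0

/-- The three formulas for the moduli are one: the ratio of the two sides leaving the corner, the
side that arrives there being reversed. -/
theorem cornerModulus_eq (hz : Nondegenerate z) (c : Fin n × Fin 3) :
    cornerModulus z c = -sideVec z (c.1, c.2 + 2) / sideVec z c := by
  obtain ⟨j, i⟩ := c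
  have h0 := (hz j).1
  have h1 := sub_ne_zero.2 (hz j).2
  have h1' := sub_ne_zero.2 (hz j).2.symm
  fin_cases i
  · simp [cornerModulus, sideVec, stdPos]
  · simp [cornerModulus, sideVec, stdPos]
    field_simp
    ring
  · simp [cornerModulus, sideVec, stdPos]
    field_simp
    ring

theorem cornerModulus_ne_zero (hz : Nondegenerate z) (c : Fin n × Fin 3) :
    cornerModulus z c ≠ 0 := by
  rw [cornerModulus_eq hz]
  exact div_ne_zero (neg_ne_zero.2 (sideVec_ne_zero hz _)) (sideVec_ne_zero hz _)

end model

/-- The affine transformation `w ↦ a w + b`. -/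
def affEquiv (a b : ℂ) (ha : a ≠ 0) : ℂ ≃ᵃ[ℂ] ℂ :=
  (LinearEquiv.smulOfNeZero ℂ ℂ a ha).toAffineEquiv.trans (AffineEquiv.constVAdd ℂ ℂ b)

theorem affEquiv_apply (a b : ℂ) (ha : a ≠ 0) (w : ℂ) : affEquiv a b ha w = a * w + b := by
  simp [affEquiv, add_comm]

theorem AffineEquiv.apply_eq (e : ℂ ≃ᵃ[ℂ] ℂ) (w : ℂ) : e w = (e 1 - e 0) * w + e 0 := by
  have h : ∀ w : ℂ, e w = w * e.linear 1 + e 0 := by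
    intro w
    have h := e.map_vadd 0 w
    simp only [vadd_eq_add, add_zero] at h
    rw [h, show w = w • (1 : ℂ) by simp, map_smul]
    simp
  rw [h w, h 1]
  ring

namespace TriangulatedSurface

variable {n : ℕ} {K : TriangulatedSurface n} {p : ℝ × ℝ → K.Space}

/-- The values of `Q` at the vertices of the lifted triangles form triangles of moduli `z`. -/
def IsPlacement (K : TriangulatedSurface n) (p : ℝ × ℝ → K.Space) (z : Fin n → ℂ)
    (Q : ℝ × ℝ → ℂ) : Prop :=
  ∀ t : K.LiftedTriangle p, Q (t.vertex 1) ≠ Q (t.vertex 0) ∧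
    Q (t.vertex 2) - Q (t.vertex 0) = z t.idx * (Q (t.vertex 1) - Q (t.vertex 0))

namespace IsPlacement

variable {z : Fin n → ℂ} {Q Q' : ℝ × ℝ → ℂ}

theorem apply_vertex (hQ : K.IsPlacement p z Q) (t : K.LiftedTriangle p) (i : Fin 3) :
    Q (t.vertex i) =
      Q (t.vertex 0) + (Q (t.vertex 1) - Q (t.vertex 0)) * stdPos z t.idx i := by
  fin_cases i
  · simp [stdPos]
  · simp [stdPos]
  · have := (hQ t).2
    simp only [stdPos, Fin.reduceFinMk, Matrix.cons_val]
    linear_combination this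

theorem sub_eq (hQ : K.IsPlacement p z Q) (t : K.LiftedTriangle p) (i : Fin 3) :
    Q (t.vertex (i + 1)) - Q (t.vertex i) =
      (Q (t.vertex 1) - Q (t.vertex 0)) * sideVec z (t.idx, i) := by
  rw [hQ.apply_vertex t (i + 1), hQ.apply_vertex t i, sideVec]
  ring

theorem sub_ne_zero (hQ : K.IsPlacement p z Q) (hz : Nondegenerate z) (t : K.LiftedTriangle p)
    (i : Fin 3) : Q (t.vertex (i + 1)) - Q (t.vertex i) ≠ 0 := by
  rw [hQ.sub_eq]
  exact mul_ne_zero (_root_.sub_ne_zero.2 (hQ t).1) (sideVec_ne_zero hz _)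

theorem vertex_injective (hQ : K.IsPlacement p z Q) (hz : Nondegenerate z)
    (t : K.LiftedTriangle p) : Function.Injective t.vertex := by
  intro i k h
  have h' : Q (t.vertex i) = Q (t.vertex k) := by rw [h]
  rcases Fin3.eq_or i k with rfl | rfl | rfl
  · rfl
  · exact absurd (_root_.sub_eq_zero.2 h'.symm) (hQ.sub_ne_zero hz t i)
  · have := hQ.sub_ne_zero hz t (i + 2)
    rw [Fin3.add_two_add_one] at this
    exact absurd (_root_.sub_eq_zero.2 h') this

/-- Position of a vertex in terms of the endpoints of a side. -/
theorem apply_vertex' (hQ : K.IsPlacement p z Q) (hz : Nondegenerate z) (t : K.LiftedTriangle p)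
    (i l : Fin 3) : Q (t.vertex l) = Q (t.vertex i) + (Q (t.vertex (i + 1)) - Q (t.vertex i)) *
      ((stdPos z t.idx l - stdPos z t.idx i) / sideVec z (t.idx, i)) := by
  have h := sideVec_ne_zero hz (t.idx, i)
  rw [hQ.sub_eq, hQ.apply_vertex t l, hQ.apply_vertex t i]
  field_simp
  ring

theorem comp_add (hp : K.IsTorusCovering p) (hQ : K.IsPlacement p z Q) (m k : ℤ) :
    K.IsPlacement p z fun x => Q (x + intVec m k) :=
  fun t => hQ (t.translate hp m k)

theorem comp_affine (hQ : K.IsPlacement p z Q) {a b : ℂ} (ha : a ≠ 0) :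
    K.IsPlacement p z fun x => a * Q x + b := by
  intro t
  obtain ⟨h1, h2⟩ := hQ t
  refine ⟨fun h => h1 (mul_left_cancel₀ ha (add_right_cancel h)), ?_⟩
  linear_combination a * h2

/-- Two placements with the same moduli differ by a similarity. -/
theorem exists_affine (hp : K.IsTorusCovering p) (hQ : K.IsPlacement p z Q)
    (hQ' : K.IsPlacement p z Q') (hz : Nondegenerate z) :
    ∃ a b : ℂ, a ≠ 0 ∧ ∀ (t : K.LiftedTriangle p) (i : Fin 3),
      Q' (t.vertex i) = a * Q (t.vertex i) + b := by
  let A : K.LiftedTriangle p → ℂ := fun t =>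
    (Q' (t.vertex 1) - Q' (t.vertex 0)) / (Q (t.vertex 1) - Q (t.vertex 0))
  let B : K.LiftedTriangle p → ℂ := fun t => Q' (t.vertex 0) - A t * Q (t.vertex 0)
  have h1 : ∀ t i, Q' (t.vertex i) = A t * Q (t.vertex i) + B t := by
    intro t i
    have h0 := _root_.sub_ne_zero.2 (hQ t).1
    rw [hQ'.apply_vertex t i, hQ.apply_vertex t i]
    simp only [A, B]
    field_simp
    ring
  -- The affine maps of adjacent triangles agree at the two distinct endpoints of the common side,
  -- so they coincide.
  have h2 : ∀ t t' i i', Adj t t' i i' → (A t, B t) = (A t', B t') := by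
    intro t t' i i' h
    have e1 := h1 t i
    have e2 := h1 t (i + 1)
    have e3 := h1 t' (i' + 1)
    have e4 := h1 t' i'
    rw [← h.vertex_left] at e3
    rw [← h.vertex_right] at e4
    have e5 : A t = A t' := by
      refine mul_right_cancel₀ (hQ.sub_ne_zero hz t i) ?_
      linear_combination e1 - e2 - e3 + e4
    refine Prod.ext e5 ?_
    dsimp only
    rw [e5] at e1
    linear_combination e3 - e1
  by_cases hne : Nonempty (K.LiftedTriangle p)
  · obtain ⟨t₀⟩ := hne
    refine ⟨A t₀, B t₀, div_ne_zero (_root_.sub_ne_zero.2 (hQ' t₀).1)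
      (_root_.sub_ne_zero.2 (hQ t₀).1), fun t i => ?_⟩
    have h3 := eq_of_adj_invariant hp (fun t => (A t, B t)) h2 t t₀
    rw [Prod.mk.injEq] at h3
    rw [h1, h3.1, h3.2]
  · exact ⟨1, 0, one_ne_zero, fun t => (hne ⟨t⟩).elim⟩

end IsPlacement

/-- The consistency equations suffice for the existence of a placement. -/
theorem exists_isPlacement (hp : K.IsTorusCovering p) {z : Fin n → ℂ} (hz : Nondegenerate z)
    (hinj : ∀ t : K.LiftedTriangle p, Function.Injective t.vertex) (hc : K.Consistent z) :
    ∃ Q, K.IsPlacement p z Q := by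
  have hc' : ∀ c, ∏ c' ∈ @Finset.filter _ (fun c' => K.rot.SameCycle c c')
      (fun _ => Classical.propDecidable _) Finset.univ, cornerModulus z c' = 1 := hc
  obtain ⟨w, hw0, hw⟩ := @Equiv.Perm.exists_cocycle_eq _ K.rot _
    (fun _ _ => Classical.propDecidable _) (cornerModulus z) (cornerModulus_ne_zero hz) hc'
  have hS := sideVec_ne_zero hz
  have hmul : ∀ (a b a' b' : ℂ) (ha : a ≠ 0) (ha' : a' ≠ 0),
      affEquiv a b ha * affEquiv a' b' ha' =
        affEquiv (a * a') (a * b' + b) (mul_ne_zero ha ha') := by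
    intro a b a' b' ha ha'
    ext w
    rw [AffineEquiv.mul_def, AffineEquiv.trans_apply, affEquiv_apply, affEquiv_apply,
      affEquiv_apply]
    ring
  have hcongr : ∀ (a b a' b' : ℂ) (ha : a ≠ 0) (ha' : a' ≠ 0), a = a' → b = b' →
      affEquiv a b ha = affEquiv a' b' ha' := by
    rintro a b a' b' ha ha' rfl rfl
    rfl
  have hα : ∀ c, -sideVec z c / sideVec z (K.pairing c) ≠ 0 := fun c =>
    div_ne_zero (neg_ne_zero.2 (hS _)) (hS _)
  let P : Fin n × Fin 3 → ℂ := fun c => stdPos z c.1 c.2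
  let P' : Fin n × Fin 3 → ℂ := fun c => stdPos z c.1 (c.2 + 1)
  have hP : ∀ c, P' c = P c + sideVec z c := fun c => by simp only [P, P', sideVec]; ring
  -- `g c` lays the model of the neighbouring triangle against side `c` of the model triangle,
  -- taking the endpoints of `K.pairing c` to those of `c` in reverse order.
  let g : Fin n × Fin 3 → (ℂ ≃ᵃ[ℂ] ℂ) := fun c =>
    affEquiv (-sideVec z c / sideVec z (K.pairing c))
      (P c - -sideVec z c / sideVec z (K.pairing c) * P' (K.pairing c)) (hα c)
  -- `W c` places the model with corner `c` at the origin and its first side equal to `w c`; by the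
  -- cocycle property of `w`, the triangles around a vertex then fit together.
  let W : Fin n × Fin 3 → (ℂ ≃ᵃ[ℂ] ℂ) := fun c =>
    affEquiv (w c / sideVec z c) (-(w c / sideVec z c * P c)) (div_ne_zero (hw0 c) (hS c))
  obtain ⟨ξ, hξ⟩ := exists_localSystem_section hp hinj g W (by
    intro c
    rw [eq_inv_iff_mul_eq_one]
    have h1 := hS c
    have h2 := hS (K.pairing c)
    have : (1 : ℂ ≃ᵃ[ℂ] ℂ) = affEquiv 1 0 one_ne_zero := by
      ext w
      simp [affEquiv_apply]
    simp only [g]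
    rw [hmul, this]
    refine hcongr _ _ _ _ _ _ ?_ ?_
    · rw [K.involutive]; field_simp
    · rw [K.involutive, hP, hP]; field_simp; ring) (by
    intro c
    have h1 := hS c
    have h2 := hS (K.pairing c)
    have h3 := hS (c.1, c.2 + 1)
    have h4 : w (K.pairing c) = -sideVec z c / sideVec z (c.1, c.2 + 1) * w (c.1, c.2 + 1) := by
      rw [← rot_add_one, hw, cornerModulus_eq hz]
      dsimp only
      rw [Fin3.add_one_add_two]
    have h5 : P (c.1, c.2 + 1) = P' c := rfl
    simp only [g, W]
    rw [hmul]
    refine hcongr _ _ _ _ _ _ ?_ ?_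
    · rw [h4]; field_simp
    · rw [h4, h5, hP, hP]; field_simp; ring)
  classical
  -- `ξ t` places the model of `t` in the plane. All triangles at a vertex assign it the same
  -- position, as one sees along a chain of adjacent triangles.
  have key : ∀ (t t' : K.LiftedTriangle p) (k k' : Fin 3), t.vertex k = t'.vertex k' →
      ξ t (stdPos z t.idx k) = ξ t' (stdPos z t'.idx k') := by
    have adj : ∀ (t t' : K.LiftedTriangle p) i i', Adj t t' i i' → ξ t (stdPos z t.idx i) =
        ξ t' (stdPos z t'.idx (i' + 1)) := by
      intro t t' i i' h
      have h2 := hS (t'.idx, i')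
      rw [hξ t t' i i' h, AffineEquiv.mul_def, AffineEquiv.trans_apply]
      congr 1
      simp only [g, affEquiv_apply]
      rw [h.1]
      change _ = -sideVec z (t.idx, i) / _ * P' (t'.idx, i') + (P (t.idx, i) - _)
      simp only [P]
      ring
    intro t t' k k' h
    replace h := chain_of_map_eq (t := t) (t' := t') (x := stdSimplex.vertex k)
      (x' := stdSimplex.vertex k') hp h
    generalize hb : (t', (stdSimplex.vertex k' : stdSimplex ℝ (Fin 3))) = b at h
    induction h generalizing t' k' with
    | refl =>
      rw [Prod.mk.injEq] at hb
      obtain ⟨rfl, hb⟩ := hb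
      rw [stdSimplex.vertex_injective hb]
    | @tail b c _ hbc ih =>
      subst hb
      obtain ⟨i, i', h4, h5⟩ := hbc
      dsimp only at h4 h5
      have h6 : k' ≠ i' + 2 := by
        rintro rfl
        have := h5.2.1
        rw [stdSimplex.vertex_self] at this
        exact one_ne_zero this
      rcases Fin3.eq_or i' k' with rfl | rfl | rfl
      · have : b.2 = stdSimplex.vertex (i + 1) := h5.symm.unique (Glued.vertex_left k' i)
        rw [ih b.1 (i + 1) (by rw [← this]), adj _ _ _ _ h4.symm]
      · have : b.2 = stdSimplex.vertex i := h5.symm.unique (Glued.vertex_right i' i)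
        rw [ih b.1 i (by rw [← this]), adj _ _ _ _ h4]
      · exact absurd rfl h6
  refine ⟨fun y => if h : ∃ q : K.LiftedTriangle p × Fin 3, q.1.vertex q.2 = y then
    ξ h.choose.1 (stdPos z h.choose.1.idx h.choose.2) else 0, ?_⟩
  have hQ : ∀ (t : K.LiftedTriangle p) (k : Fin 3),
      (if h : ∃ q : K.LiftedTriangle p × Fin 3, q.1.vertex q.2 = t.vertex k then
        ξ h.choose.1 (stdPos z h.choose.1.idx h.choose.2) else 0) = ξ t (stdPos z t.idx k) := by
    intro t k
    have h : ∃ q : K.LiftedTriangle p × Fin 3, q.1.vertex q.2 = t.vertex k := ⟨(t, k), rfl⟩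
    rw [dif_pos h]
    exact key _ _ _ _ h.choose_spec
  intro t
  dsimp only
  rw [hQ, hQ, hQ]
  constructor
  · intro h
    have := (ξ t).injective h
    simp [stdPos] at this
  · rw [(ξ t).apply_eq (stdPos z t.idx 2), (ξ t).apply_eq (stdPos z t.idx 1),
      (ξ t).apply_eq (stdPos z t.idx 0)]
    simp [stdPos]
    ring

/-! ## The holonomy of a simplicial loop -/

theorem exists_rot_lift (hp : K.IsTorusCovering p) (t : K.LiftedTriangle p) (k : Fin 3) :
    ∃ (t' : K.LiftedTriangle p) (k' : Fin 3), (t'.idx, k') = K.rot (t.idx, k) ∧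
      t'.vertex k' = t.vertex k ∧ t'.vertex (k' + 1) = t.vertex (k + 2) := by
  obtain ⟨t', k', h⟩ := exists_adj hp t (k + 2)
  refine ⟨t', k', h.1.symm, ?_, h.vertex_left.symm⟩
  rw [← h.vertex_right, Fin3.add_two_add_one]

theorem IsPlacement.modulus_mul {z : Fin n → ℂ} {Q : ℝ × ℝ → ℂ} (hQ : K.IsPlacement p z Q)
    (hz : Nondegenerate z) (t : K.LiftedTriangle p) (k : Fin 3) :
    Q (t.vertex (k + 2)) - Q (t.vertex k) =
      cornerModulus z (t.idx, k) * (Q (t.vertex (k + 1)) - Q (t.vertex k)) := by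
  have h := hQ.sub_eq t (k + 2)
  have h' := sideVec_ne_zero hz (t.idx, k)
  rw [Fin3.add_two_add_one] at h
  rw [hQ.sub_eq, cornerModulus_eq hz]
  field_simp
  linear_combination -h

/-- Turning around a vertex multiplies the sides by the moduli of the corners. -/
theorem IsPlacement.exists_rot_pow (hp : K.IsTorusCovering p) {z : Fin n → ℂ} {Q : ℝ × ℝ → ℂ}
    (hQ : K.IsPlacement p z Q) (hz : Nondegenerate z) (t : K.LiftedTriangle p) (k : Fin 3)
    (N : ℕ) : ∃ (t' : K.LiftedTriangle p) (k' : Fin 3), (t'.idx, k') = (K.rot ^ N) (t.idx, k) ∧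
      t'.vertex k' = t.vertex k ∧ Q (t'.vertex (k' + 1)) - Q (t'.vertex k') =
        (∏ l ∈ Finset.range N, cornerModulus z ((K.rot ^ l) (t.idx, k))) *
          (Q (t.vertex (k + 1)) - Q (t.vertex k)) := by
  induction N with
  | zero => exact ⟨t, k, rfl, rfl, by simp⟩
  | succ N ih =>
    obtain ⟨t', k', h1, h2, h3⟩ := ih
    obtain ⟨t'', k'', h4, h5, h6⟩ := exists_rot_lift hp t' k'
    refine ⟨t'', k'', ?_, h5.trans h2, ?_⟩
    · rw [h4, h1, pow_succ', Equiv.Perm.mul_apply]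
    · rw [h5, h6, hQ.modulus_mul hz, h3, Finset.prod_range_succ, h1]
      ring

/-- The rotation starts from the edge `(t, i)` reversed, whence the minus sign. The infimum defining
`K.turn` is attained because both corners are at the same vertex of the surface. -/
theorem IsPlacement.turn (hp : K.IsTorusCovering p) {z : Fin n → ℂ} {Q : ℝ × ℝ → ℂ}
    (hQ : K.IsPlacement p z Q) (hz : Nondegenerate z) {t t' : K.LiftedTriangle p} {i i' : Fin 3}
    (h : t.vertex (i + 1) = t'.vertex i') :
    Q (t'.vertex (i' + 1)) - Q (t'.vertex i') =
      -K.turnModulus z (t.idx, i) (t'.idx, i') * (Q (t.vertex (i + 1)) - Q (t.vertex i)) := by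
  obtain ⟨s, k, hs⟩ := exists_adj hp t i
  have hsv : s.vertex k = t'.vertex i' := by rw [← hs.vertex_right, h]
  have hne : {N : ℕ | (K.rot ^ N) (K.pairing (t.idx, i)) = (t'.idx, i')}.Nonempty := by
    rw [hs.1]
    exact (sameVertex_of_vertex_eq hp hsv).exists_nat_pow_eq
  have hN : (K.rot ^ K.turn (t.idx, i) (t'.idx, i')) (K.pairing (t.idx, i)) = (t'.idx, i') :=
    Nat.sInf_mem hne
  obtain ⟨t'', k'', h1, h2, h3⟩ := hQ.exists_rot_pow hp hz s k (K.turn (t.idx, i) (t'.idx, i'))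
  rw [← hs.1, hN, Prod.mk.injEq] at h1
  obtain ⟨h1, rfl⟩ := h1
  obtain rfl : t'' = t' := LiftedTriangle.eq_of_map_eq hp h1 (h2.trans hsv)
  rw [h3, turnModulus, hs.1, hs.vertex_right, hs.vertex_left]
  ring

/-- The form suited to induction: an open path `γ`, preceded by an edge `(t, i)` and followed by an
edge `(t', i')`, both of which take part in the turns. -/
theorem IsPlacement.prod_turnModulus (hp : K.IsTorusCovering p) {z : Fin n → ℂ} {Q : ℝ × ℝ → ℂ}
    (hQ : K.IsPlacement p z Q) (hz : Nondegenerate z) (γ : List (Fin n × Fin 3))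
    {t t' : K.LiftedTriangle p} {i i' : Fin 3} (h : K.LiftsTo p γ (t.vertex (i + 1)) (t'.vertex i')) :
    Q (t'.vertex (i' + 1)) - Q (t'.vertex i') = (-1) ^ (γ.length + 1) *
      ((((t.idx, i) :: γ).zip (γ ++ [(t'.idx, i')])).map fun q => K.turnModulus z q.1 q.2).prod *
        (Q (t.vertex (i + 1)) - Q (t.vertex i)) := by
  induction γ generalizing t i with
  | nil =>
    rw [hQ.turn hp hz (show t.vertex (i + 1) = t'.vertex i' from h)]
    simp
  | cons d γ ih =>
    obtain ⟨s, h1, h2, h3⟩ := h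
    rw [ih h3, hQ.turn hp hz h2.symm, h1]
    simp only [List.length_cons, List.cons_append, List.zip_cons_cons, List.map_cons,
      List.prod_cons]
    ring

/-- After all the turns of the loop, including the one from the last edge to the first, the first
edge has become its translate, whose image under `Q` is `a` times the original one. -/
theorem IsPlacement.hol_eq (hp : K.IsTorusCovering p) {z : Fin n → ℂ} {Q : ℝ × ℝ → ℂ}
    (hQ : K.IsPlacement p z Q) (hz : Nondegenerate z) {m k : ℤ} {a b : ℂ}
    (hab : ∀ (t : K.LiftedTriangle p) (i : Fin 3),
      Q (t.vertex i + intVec m k) = a * Q (t.vertex i) + b)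
    {γ : List (Fin n × Fin 3)} (hγ : K.IsLoop p m k γ) : K.hol z γ = a := by
  obtain ⟨hne, x, hx⟩ := hγ
  obtain _ | ⟨d, γ⟩ := γ
  · exact absurd rfl hne
  · obtain ⟨t, h1, h2, h3⟩ := hx
    rw [← h2] at h3
    have h4 := hQ.prod_turnModulus hp hz γ (t' := t.translate hp m k) (i' := d.2) h3
    rw [LiftedTriangle.translate_vertex, LiftedTriangle.translate_vertex, hab, hab,
      LiftedTriangle.translate_idx, h1] at h4
    have h5 : (d :: γ).rotate 1 = γ ++ [d] := by simp
    refine mul_right_cancel₀ (hQ.sub_ne_zero hz t d.2) ?_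
    rw [hol, h5, List.length_cons, ← h4]
    ring

/-! ## Continuous dependence of the placements on the moduli -/

/-- Triangles are laid one after another along a chain of adjacent triangles from `t₀`. Each new
position is a rational function of the two endpoints of the common side and of one modulus, with
nonvanishing denominator at `z₀`. -/
theorem exists_continuousAt_position (hp : K.IsTorusCovering p) {z₀ : Fin n → ℂ}
    (hz₀ : Nondegenerate z₀) (t₀ : K.LiftedTriangle p) (a₀ b₀ : ℂ) (t : K.LiftedTriangle p) :
    ∃ P : Fin 3 → (Fin n → ℂ) → ℂ, (∀ i, ContinuousAt (P i) z₀) ∧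
      ∀ z Q, Nondegenerate z → K.IsPlacement p z Q → Q (t₀.vertex 0) = b₀ →
        Q (t₀.vertex 1) = a₀ → ∀ i, Q (t.vertex i) = P i z := by
  have hcont : ∀ j i, ContinuousAt (fun z : Fin n → ℂ => stdPos z j i) z₀ := by
    intro j i
    fin_cases i
    · exact continuousAt_const
    · exact continuousAt_const
    · exact (continuous_apply j).continuousAt
  induction reflTransGen_adj hp t₀ t with
  | refl =>
    refine ⟨fun i z => b₀ + (a₀ - b₀) * stdPos z t₀.idx i, fun i => ?_, ?_⟩
    · exact continuousAt_const.add (continuousAt_const.mul (hcont _ _))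
    · rintro z Q - hQ rfl rfl i
      exact hQ.apply_vertex t₀ i
  | @tail t t' _ h ih =>
    obtain ⟨i, i', h⟩ := h
    obtain ⟨P, hP, hPQ⟩ := ih
    refine ⟨fun l z => P (i + 1) z + (P i z - P (i + 1) z) *
      ((stdPos z t'.idx l - stdPos z t'.idx i') / sideVec z (t'.idx, i')), fun l => ?_, ?_⟩
    · refine (hP _).add (((hP _).sub (hP _)).mul (((hcont _ _).sub (hcont _ _)).div ?_ ?_))
      · exact (hcont _ _).sub (hcont _ _)
      · exact sideVec_ne_zero hz₀ _
    · intro z Q hz hQ hb ha l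
      rw [hQ.apply_vertex' hz t' i' l, ← h.vertex_left, ← h.vertex_right,
        hPQ z Q hz hQ hb ha, hPQ z Q hz hQ hb ha]

end TriangulatedSurface

/-! ## Plane sectors -/

/-- With `q = s + s' m`, the quantity `‖m‖ ‖q‖ sin (arg m - arg q)` is the determinant of `q` and
`m`, which equals `s * m.im` and is positive. -/
theorem Complex.arg_lt_arg_of_sector {m : ℂ} (hm : 0 < m.im) {s s' : ℝ} (hs : 0 < s)
    (hs' : 0 ≤ s') : 0 ≤ (s + s' * m).arg ∧ (s + s' * m).arg < m.arg := by
  set q : ℂ := s + s' * m with hq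
  have him : q.im = s' * m.im := by simp [hq]
  have hre : q.re = s + s' * m.re := by simp [hq]
  have hq0 : 0 ≤ q.arg := Complex.arg_nonneg_iff.2 (by rw [him]; positivity)
  refine ⟨hq0, ?_⟩
  have hm0 : m ≠ 0 := fun h => by simp [h] at hm
  have hqne : q ≠ 0 := by
    intro h
    have h1 : q.im = 0 := by rw [h]; rfl
    have h2 : q.re = 0 := by rw [h]; rfl
    rw [him] at h1
    have h3 : s' = 0 := (mul_eq_zero.1 h1).resolve_right hm.ne'
    rw [hre, h3] at h2
    linarith
  have hma : m.arg < Real.pi := Complex.arg_lt_pi_iff.2 (Or.inr hm.ne')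
  have h1 : 0 < Real.sin (m.arg - q.arg) := by
    have hn : 0 < ‖m‖ * ‖q‖ := mul_pos (norm_pos_iff.2 hm0) (norm_pos_iff.2 hqne)
    have h2 : ‖m‖ * ‖q‖ * Real.sin (m.arg - q.arg) = s * m.im := by
      rw [Real.sin_sub]
      have e1 := Complex.norm_mul_sin_arg m
      have e2 := Complex.norm_mul_cos_arg m
      have e3 := Complex.norm_mul_sin_arg q
      have e4 := Complex.norm_mul_cos_arg q
      calc _ = (‖m‖ * Real.sin m.arg) * (‖q‖ * Real.cos q.arg) -
          (‖m‖ * Real.cos m.arg) * (‖q‖ * Real.sin q.arg) := by ring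
        _ = _ := by rw [e1, e2, e3, e4, him, hre]; ring
    have h3 : 0 < ‖m‖ * ‖q‖ * Real.sin (m.arg - q.arg) := by rw [h2]; positivity
    exact (mul_pos_iff_of_pos_left hn).1 h3
  by_contra h
  push Not at h
  have h4 := Complex.arg_le_pi q
  have h5 : Real.sin (m.arg - q.arg) ≤ 0 :=
    Real.sin_nonpos_of_nonpos_of_neg_pi_le (by linarith)
      (by linarith [Complex.arg_nonneg_iff.2 hm.le])
  linarith

theorem Complex.exists_sector_coords {m q : ℂ} (hm : 0 < m.im) (hq0 : q ≠ 0) (hq : 0 ≤ q.arg)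
    (hqm : q.arg < m.arg) : ∃ s s' : ℝ, 0 < s ∧ 0 ≤ s' ∧ q = s + s' * m := by
  have hma : m.arg < Real.pi := Complex.arg_lt_pi_iff.2 (Or.inr hm.ne')
  have hqim : 0 ≤ q.im := Complex.arg_nonneg_iff.1 hq
  have hm0 : m ≠ 0 := fun h => by simp [h] at hm
  refine ⟨q.re - q.im / m.im * m.re, q.im / m.im, ?_, by positivity, ?_⟩
  · have h1 : 0 < Real.sin (m.arg - q.arg) :=
      Real.sin_pos_of_pos_of_lt_pi (by linarith) (by linarith)
    have hn : 0 < ‖m‖ * ‖q‖ := mul_pos (norm_pos_iff.2 hm0) (norm_pos_iff.2 hq0)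
    have h2 : ‖m‖ * ‖q‖ * Real.sin (m.arg - q.arg) = m.im * q.re - m.re * q.im := by
      rw [Real.sin_sub]
      have e1 := Complex.norm_mul_sin_arg m
      have e2 := Complex.norm_mul_cos_arg m
      have e3 := Complex.norm_mul_sin_arg q
      have e4 := Complex.norm_mul_cos_arg q
      calc _ = (‖m‖ * Real.sin m.arg) * (‖q‖ * Real.cos q.arg) -
          (‖m‖ * Real.cos m.arg) * (‖q‖ * Real.sin q.arg) := by ring
        _ = _ := by rw [e1, e2, e3, e4]
    have h3 : 0 < m.im * q.re - m.re * q.im := by rw [← h2]; positivity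
    have h4 : q.re - q.im / m.im * m.re = (m.im * q.re - m.re * q.im) / m.im := by
      field_simp
    rw [h4]
    positivity
  · apply Complex.ext
    · simp
    · simp
      field_simp

theorem Complex.exists_angle {u : ℂ} :
    ∃ φ : ℝ, 0 ≤ φ ∧ φ < 2 * Real.pi ∧ u = ‖u‖ * Complex.exp (φ * Complex.I) := by
  have h := Complex.norm_mul_exp_arg_mul_I u
  have hpi := Real.pi_pos
  by_cases h0 : 0 ≤ u.arg
  · exact ⟨u.arg, h0, by linarith [Complex.arg_le_pi u], h.symm⟩
  · refine ⟨u.arg + 2 * Real.pi, by linarith [Complex.neg_pi_lt_arg u], by linarith, ?_⟩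
    have h2 : Complex.exp ((u.arg + 2 * Real.pi : ℝ) * Complex.I) =
        Complex.exp (u.arg * Complex.I) := by
      rw [Complex.exp_eq_exp_iff_exists_int]
      exact ⟨1, by push_cast; ring⟩
    rw [h2, h]

theorem Complex.angle_unique {a b φ ψ : ℝ} (ha : 0 < a) (hb : 0 < b) (h0 : 0 ≤ φ)
    (h1 : φ < 2 * Real.pi) (h2 : 0 ≤ ψ) (h3 : ψ < 2 * Real.pi)
    (h : (a : ℂ) * Complex.exp (φ * Complex.I) = b * Complex.exp (ψ * Complex.I)) : φ = ψ := by
  have hab : a = b := by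
    have := congrArg norm h
    rwa [norm_mul, norm_mul, Complex.norm_exp_ofReal_mul_I, Complex.norm_exp_ofReal_mul_I,
      mul_one, mul_one, Complex.norm_real, Complex.norm_real, Real.norm_of_nonneg ha.le,
      Real.norm_of_nonneg hb.le] at this
  subst hab
  have h4 := mul_left_cancel₀ (Complex.ofReal_ne_zero.2 ha.ne') h
  rw [Complex.exp_eq_exp_iff_exists_int] at h4
  obtain ⟨k, hk⟩ := h4
  have h5 : φ = ψ + k * (2 * Real.pi) := by
    have : (φ : ℂ) = ((ψ + k * (2 * Real.pi) : ℝ) : ℂ) := by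
      refine mul_right_cancel₀ Complex.I_ne_zero ?_
      rw [hk]
      push_cast
      ring
    exact_mod_cast this
  have hpi := Real.pi_pos
  have h6 : (k : ℝ) < 1 := by
    by_contra hn
    push Not at hn
    nlinarith
  have h7 : (-1 : ℝ) < k := by
    by_contra hn
    push Not at hn
    nlinarith
  have h8 : k = 0 := by
    have h6' : k < 1 := by exact_mod_cast h6
    have h7' : -1 < k := by exact_mod_cast h7
    omega
  rw [h5, h8]
  simp

section sectors

variable {e m : ℕ → ℂ} {L : ℕ}

theorem sector_exp (he : ∀ l, e (l + 1) = m l * e l) (hm : ∀ l, 0 < (m l).im) (l : ℕ) :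
    ∃ r : ℝ, 0 < r ∧ e l = r * Complex.exp ((∑ i ∈ Finset.range l, (m i).arg : ℝ) * Complex.I) *
      e 0 := by
  induction l with
  | zero => exact ⟨1, one_pos, by simp⟩
  | succ l ih =>
    obtain ⟨r, hr, h⟩ := ih
    have hm0 : m l ≠ 0 := fun h => by have := hm l; simp [h] at this
    refine ⟨r * ‖m l‖, mul_pos hr (norm_pos_iff.2 hm0), ?_⟩
    rw [he, Finset.sum_range_succ, h]
    nth_rewrite 1 [← Complex.norm_mul_exp_arg_mul_I (m l)]
    push_cast
    rw [add_mul, Complex.exp_add]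
    ring

/-- The rays `e l` turn counterclockwise by `arg (m l)` at each step and make one full turn. The
sector of `w`, with its first ray and without its second, is found from the first partial sum that
exceeds the angle of `w`. -/
theorem sector_exists (he : ∀ l, e (l + 1) = m l * e l) (he0 : e 0 ≠ 0)
    (hm : ∀ l, 0 < (m l).im) (hsum : ∑ i ∈ Finset.range L, (m i).arg = 2 * Real.pi) {w : ℂ}
    (hw : w ≠ 0) :
    ∃ l < L, ∃ s s' : ℝ, 0 < s ∧ 0 ≤ s' ∧ w = s * e l + s' * e (l + 1) := by
  obtain ⟨φ, h0, h1, h2⟩ := Complex.exists_angle (u := w / e 0)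
  have hex : ∃ l, φ < ∑ i ∈ Finset.range l, (m i).arg := ⟨L, by rwa [hsum]⟩
  classical
  obtain ⟨l, hl⟩ : ∃ l, Nat.find hex = l + 1 := by
    refine Nat.exists_eq_succ_of_ne_zero fun h => ?_
    have := Nat.find_spec hex
    rw [h] at this
    simp at this
    linarith
  have h3 : φ < ∑ i ∈ Finset.range (l + 1), (m i).arg := hl ▸ Nat.find_spec hex
  have h4 : ∑ i ∈ Finset.range l, (m i).arg ≤ φ :=
    not_lt.1 (Nat.find_min hex (show l < Nat.find hex by omega))
  have h5 : l < L := by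
    have := Nat.find_min' hex (show φ < ∑ i ∈ Finset.range L, (m i).arg by rwa [hsum])
    omega
  obtain ⟨r, hr, hel⟩ := sector_exp he hm l
  have hel0 : e l ≠ 0 := by
    rw [hel]
    exact mul_ne_zero (mul_ne_zero (Complex.ofReal_ne_zero.2 hr.ne') (Complex.exp_ne_zero _)) he0
  set Θ := ∑ i ∈ Finset.range l, (m i).arg
  rw [Finset.sum_range_succ] at h3
  have hwn : 0 < ‖w / e 0‖ := norm_pos_iff.2 (div_ne_zero hw he0)
  have h6 : w / e l = (‖w / e 0‖ / r : ℝ) * Complex.exp ((φ - Θ : ℝ) * Complex.I) := by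
    have h7 : w = ‖w / e 0‖ * Complex.exp (φ * Complex.I) * e 0 := by
      rw [← h2]; field_simp
    have h8 : Complex.exp (φ * Complex.I) =
        Complex.exp ((φ - Θ : ℝ) * Complex.I) * Complex.exp (Θ * Complex.I) := by
      rw [← Complex.exp_add]
      congr 1
      push_cast
      ring
    rw [div_eq_iff hel0, hel]
    nth_rewrite 1 [h7]
    rw [h8]
    have : (r : ℂ) ≠ 0 := Complex.ofReal_ne_zero.2 hr.ne'
    push_cast
    field_simp
  have hma : (m l).arg ≤ Real.pi := Complex.arg_le_pi _
  have h9 : (w / e l).arg = φ - Θ := by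
    rw [h6, Complex.exp_mul_I]
    exact Complex.arg_mul_cos_add_sin_mul_I (div_pos hwn hr) ⟨by linarith [Real.pi_pos], by linarith⟩
  obtain ⟨s, s', hs, hs', h⟩ := Complex.exists_sector_coords (hm l) (div_ne_zero hw hel0)
    (by rw [h9]; linarith) (by rw [h9]; linarith)
  refine ⟨l, h5, s, s', hs, hs', ?_⟩
  rw [he, ← mul_assoc, ← add_mul, ← h, div_mul_cancel₀ _ hel0]

/-- The half-open sectors correspond to consecutive disjoint intervals of angles within `[0, 2π)`,
and the angle of `w` there is unique. -/
theorem sector_unique (he : ∀ l, e (l + 1) = m l * e l) (he0 : e 0 ≠ 0)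
    (hm : ∀ l, 0 < (m l).im) (hsum : ∑ i ∈ Finset.range L, (m i).arg = 2 * Real.pi) {w : ℂ}
    {l l' : ℕ} (hl : l < L) (hl' : l' < L) {s s' r r' : ℝ} (hs : 0 < s) (hs' : 0 ≤ s') (hr : 0 < r)
    (hr' : 0 ≤ r') (h : w = s * e l + s' * e (l + 1)) (h' : w = r * e l' + r' * e (l' + 1)) :
    l = l' := by
  have hmono : ∀ a b : ℕ, a ≤ b →
      ∑ i ∈ Finset.range a, (m i).arg ≤ ∑ i ∈ Finset.range b, (m i).arg := fun a b hab =>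
    Finset.sum_le_sum_of_subset_of_nonneg (Finset.range_mono hab)
      fun i _ _ => Complex.arg_nonneg_iff.2 (hm i).le
  have key : ∀ l < L, ∀ s s' : ℝ, 0 < s → 0 ≤ s' → w = s * e l + s' * e (l + 1) →
      ∃ ρ φ : ℝ, 0 < ρ ∧ w / e 0 = ρ * Complex.exp (φ * Complex.I) ∧
        ∑ i ∈ Finset.range l, (m i).arg ≤ φ ∧ φ < ∑ i ∈ Finset.range (l + 1), (m i).arg := by
    intro l hl s s' hs hs' h
    obtain ⟨r, hr, hel⟩ := sector_exp he hm l
    obtain ⟨h1, h2⟩ := Complex.arg_lt_arg_of_sector (hm l) hs hs'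
    set q : ℂ := s + s' * m l
    have hq0 : q ≠ 0 := by
      intro hq
      have h3 : q.im = s' * (m l).im := by simp [q]
      have h4 : q.re = s + s' * (m l).re := by simp [q]
      rw [hq, Complex.zero_im] at h3
      rw [hq, Complex.zero_re] at h4
      have h5 : s' = 0 := (mul_eq_zero.1 h3.symm).resolve_right (hm l).ne'
      rw [h5] at h4
      linarith
    refine ⟨‖q‖ * r, q.arg + ∑ i ∈ Finset.range l, (m i).arg, mul_pos (norm_pos_iff.2 hq0) hr, ?_,
      by linarith, by rw [Finset.sum_range_succ]; linarith⟩
    have h3 : w = q * e l := by rw [h, he]; simp only [q]; ring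
    rw [div_eq_iff he0, h3, hel]
    nth_rewrite 1 [← Complex.norm_mul_exp_arg_mul_I q]
    push_cast
    rw [add_mul, Complex.exp_add]
    ring
  obtain ⟨ρ, φ, h1, h2, h3, h4⟩ := key l hl s s' hs hs' h
  obtain ⟨ρ', φ', h1', h2', h3', h4'⟩ := key l' hl' r r' hr hr' h'
  have hb : φ = φ' := by
    refine Complex.angle_unique h1 h1' ?_ ?_ ?_ ?_ (h2.symm.trans h2')
    · exact (by simpa using hmono 0 l (Nat.zero_le _) : (0 : ℝ) ≤ _).trans h3
    · exact h4.trans_le ((hmono _ _ hl).trans hsum.le)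
    · exact (by simpa using hmono 0 l' (Nat.zero_le _) : (0 : ℝ) ≤ _).trans h3'
    · exact h4'.trans_le ((hmono _ _ hl').trans hsum.le)
  subst hb
  rcases lt_trichotomy l l' with hlt | heq | hlt
  · linarith [hmono (l + 1) l' hlt]
  · exact heq
  · linarith [hmono (l' + 1) l hlt]

end sectors

/-! ## Angle sums -/

/-- The three moduli have product `-1`, so the sum is an odd multiple of `π`. It is nonnegative, and
less than `3π` since an angle `π` at corner `0` leaves angle `0` at corner `1`. -/
theorem sum_arg_cornerModulus {n : ℕ} {z : Fin n → ℂ} (hz : Nondegenerate z) {j : Fin n}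
    (him : 0 ≤ (z j).im) : ∑ i, (cornerModulus z (j, i)).arg = Real.pi := by
  have h0 := (hz j).1
  have h1 := sub_ne_zero.2 (hz j).2.symm
  have hi : ∀ i, 0 ≤ (cornerModulus z (j, i)).im := by
    intro i
    fin_cases i
    · exact him
    · change 0 ≤ (1 / (1 - z j)).im
      rw [one_div, Complex.inv_im]
      simp only [Complex.sub_im, Complex.one_im, zero_sub, neg_neg]
      exact div_nonneg him (Complex.normSq_nonneg _)
    · change 0 ≤ (1 - 1 / z j).im
      rw [one_div, Complex.sub_im, Complex.inv_im, Complex.one_im, zero_sub, neg_div, neg_neg]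
      exact div_nonneg him (Complex.normSq_nonneg _)
  have hprod : ∏ i, cornerModulus z (j, i) = -1 := by
    rw [Fin.prod_univ_three]
    change z j * (1 / (1 - z j)) * (1 - 1 / z j) = -1
    field_simp
    ring
  have hn : ∏ i, ‖cornerModulus z (j, i)‖ = 1 := by
    rw [← norm_prod, hprod]; simp
  have hexp : Complex.exp ((∑ i, (cornerModulus z (j, i)).arg : ℝ) * Complex.I) = -1 := by
    push_cast
    rw [Finset.sum_mul, Complex.exp_sum, ← hprod]
    have : ∏ i, cornerModulus z (j, i) = ∏ i, ((‖cornerModulus z (j, i)‖ : ℂ) *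
        Complex.exp ((cornerModulus z (j, i)).arg * Complex.I)) :=
      Finset.prod_congr rfl fun i _ => (Complex.norm_mul_exp_arg_mul_I _).symm
    rw [this, Finset.prod_mul_distrib, ← Complex.ofReal_prod, hn]
    simp
  rw [← Complex.exp_pi_mul_I, Complex.exp_eq_exp_iff_exists_int] at hexp
  obtain ⟨k, hk⟩ := hexp
  have hk' : ∑ i, (cornerModulus z (j, i)).arg = Real.pi + k * (2 * Real.pi) := by
    have : ((∑ i, (cornerModulus z (j, i)).arg : ℝ) : ℂ) =
        ((Real.pi + k * (2 * Real.pi) : ℝ) : ℂ) := by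
      refine mul_right_cancel₀ Complex.I_ne_zero ?_
      rw [hk]
      push_cast
      ring
    exact_mod_cast this
  have hpi := Real.pi_pos
  have hpos : 0 ≤ ∑ i, (cornerModulus z (j, i)).arg :=
    Finset.sum_nonneg fun i _ => Complex.arg_nonneg_iff.2 (hi i)
  have hlt : ∑ i, (cornerModulus z (j, i)).arg < 3 * Real.pi := by
    have hle : ∀ i, (cornerModulus z (j, i)).arg ≤ Real.pi := fun i => Complex.arg_le_pi _
    rw [Fin.sum_univ_three]
    by_cases h : (cornerModulus z (j, 0)).arg < Real.pi
    · linarith [hle 1, hle 2]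
    · have h2 : (z j).arg = Real.pi := le_antisymm (hle 0) (not_lt.1 h)
      rw [Complex.arg_eq_pi_iff] at h2
      have h3 : (cornerModulus z (j, 1)).arg = 0 := by
        change (1 / (1 - z j)).arg = 0
        rw [Complex.arg_eq_zero_iff_zero_le, one_div]
        have h4 : (1 - z j) = ((1 - (z j).re : ℝ) : ℂ) := by
          apply Complex.ext <;> simp [h2.2]
        rw [h4, ← Complex.ofReal_inv]
        have : (0 : ℝ) ≤ (1 - (z j).re)⁻¹ := inv_nonneg.2 (by linarith)
        exact_mod_cast this
      linarith [hle 0, hle 2]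
  have h6 : (k : ℝ) < 1 := by
    by_contra hc
    push Not at hc
    nlinarith
  have h7 : (-1 : ℝ) < k := by
    by_contra hc
    push Not at hc
    nlinarith
  have h8 : k = 0 := by
    have h6' : k < 1 := by exact_mod_cast h6
    have h7' : -1 < k := by exact_mod_cast h7
    omega
  rw [hk', h8]
  simp

namespace TriangulatedSurface

variable {n : ℕ} {K : TriangulatedSurface n} {p : ℝ × ℝ → K.Space}

/-! ## Vertices of the surface and angle sums -/

/-- The vertex of the surface at a corner. -/
def vtx (K : TriangulatedSurface n) (c : Fin n × Fin 3) : K.Space :=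
  K.toSpace c.1 (stdSimplex.vertex c.2)

theorem vtx_pairing (c : Fin n × Fin 3) : K.vtx (K.pairing c) = K.vtx (c.1, c.2 + 1) :=
  (Quot.sound ⟨c.2, (K.pairing c).2, rfl, Glued.vertex_right _ _⟩ :
    K.toSpace c.1 (stdSimplex.vertex (c.2 + 1)) = K.toSpace _ _).symm

theorem vtx_rot (c : Fin n × Fin 3) : K.vtx (K.rot c) = K.vtx c := by
  rw [rot_apply, vtx_pairing, Fin3.add_two_add_one]

theorem vtx_eq_iff (hp : K.IsTorusCovering p) {c c' : Fin n × Fin 3} :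
    K.vtx c = K.vtx c' ↔ K.SameVertex c c' := by
  constructor
  · intro h
    obtain ⟨y, hy⟩ := hp.surjective (K.vtx c)
    obtain ⟨t, h1, h2⟩ := LiftedTriangle.exists_map_eq hp (j := c.1) hy
    obtain ⟨t', h1', h2'⟩ := LiftedTriangle.exists_map_eq hp (j := c'.1) (hy.trans h)
    have := sameVertex_of_vertex_eq hp (k := c.2) (k' := c'.2) (h2.trans h2'.symm)
    rwa [h1, h1'] at this
  · intro h
    obtain ⟨l, rfl⟩ := Equiv.Perm.SameCycle.exists_nat_pow_eq h
    induction l with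
    | zero => rfl
    | succ l ih =>
      rw [pow_succ', Equiv.Perm.mul_apply, vtx_rot]
      exact ih ⟨l, rfl⟩

theorem range_vtx_finite : (range K.vtx).Finite := finite_range _

open Classical in
/-- Summing over the corners, vertex by vertex. -/
theorem sum_corners (a : Fin n × Fin 3 → ℝ) :
    ∑ v ∈ (K.range_vtx_finite).toFinset, ∑ c with K.vtx c = v, a c = ∑ j, ∑ i, a (j, i) := by
  rw [← Fintype.sum_prod_type']
  exact Finset.sum_fiberwise_of_maps_to (g := K.vtx) (fun c _ => by simp) a

open Classical in
theorem sum_vtx_eq (hp : K.IsTorusCovering p) (a : Fin n × Fin 3 → ℝ) (c : Fin n × Fin 3) :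
    ∑ c' with K.vtx c' = K.vtx c, a c' = ∑ c' ∈ K.corners c, a c' := by
  refine Finset.sum_congr (Finset.ext fun c' => ?_) fun _ _ => rfl
  rw [corners, Finset.mem_filter, Finset.mem_filter, eq_comm, vtx_eq_iff hp]

/-- If all angles sums are `2 π`, then there are twice as many triangles as vertices. -/
theorem two_mul_ncard_vtx (hp : K.IsTorusCovering p) {z : Fin n → ℂ} (hz : Nondegenerate z)
    (him : ∀ j, 0 ≤ (z j).im)
    (hsum : ∀ c, ∑ c' ∈ K.corners c, (cornerModulus z c').arg = 2 * Real.pi) :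
    2 * (range K.vtx).ncard = n := by
  classical
  have h := sum_corners (K := K) fun c => (cornerModulus z c).arg
  have h1 : ∀ v ∈ (K.range_vtx_finite).toFinset,
      ∑ c with K.vtx c = v, (cornerModulus z c).arg = 2 * Real.pi := by
    intro v hv
    rw [Set.Finite.mem_toFinset] at hv
    obtain ⟨c, rfl⟩ := hv
    rw [sum_vtx_eq hp, hsum]
  rw [Finset.sum_congr rfl h1, Finset.sum_congr rfl fun j _ => sum_arg_cornerModulus hz (him j)] at h
  simp only [Finset.sum_const, nsmul_eq_mul, Finset.card_univ, Fintype.card_fin] at h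
  rw [← Set.ncard_eq_toFinset_card _ K.range_vtx_finite] at h
  have h2 : ((range K.vtx).ncard : ℝ) * 2 = n := by
    refine mul_right_cancel₀ Real.pi_ne_zero ?_
    linarith
  rw [mul_comm]
  exact_mod_cast h2

theorem cornerModulus_im_pos {z : Fin n → ℂ} (hz : Nondegenerate z) (c : Fin n × Fin 3)
    (him : 0 < (z c.1).im) : 0 < (cornerModulus z c).im := by
  obtain ⟨j, i⟩ := c
  have h0 := (hz j).1
  have h1 := sub_ne_zero.2 (hz j).2.symm
  fin_cases i
  · exact him
  · change 0 < (1 / (1 - z j)).im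
    rw [one_div, Complex.inv_im]
    simp only [Complex.sub_im, Complex.one_im, zero_sub, neg_neg]
    exact div_pos him (Complex.normSq_pos.2 h1)
  · change 0 < (1 - 1 / z j).im
    rw [one_div, Complex.sub_im, Complex.inv_im, Complex.one_im, zero_sub, neg_div, neg_neg]
    exact div_pos him (Complex.normSq_pos.2 h0)

/-- Conversely, this count forces the angle sums to be `2 π` when all triangles are fat. -/
theorem sum_arg_eq_two_pi (hp : K.IsTorusCovering p) {z : Fin n → ℂ} (hz : Nondegenerate z)
    (him : ∀ j, 0 < (z j).im) (hcard : 2 * (range K.vtx).ncard = n) {Q : ℝ × ℝ → ℂ}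
    (hQ : K.IsPlacement p z Q) (c : Fin n × Fin 3) :
    ∑ l ∈ Finset.range (Function.minimalPeriod K.rot c), (cornerModulus z ((K.rot ^ l) c)).arg =
      2 * Real.pi := by
  classical
  have hpi := Real.pi_pos
  have hi : ∀ c, 0 < (cornerModulus z c).im := fun c => cornerModulus_im_pos hz c (him c.1)
  have harg : ∀ c, 0 < (cornerModulus z c).arg := fun c =>
    lt_of_le_of_ne (Complex.arg_nonneg_iff.2 (hi c).le) fun h => by
      have := (Complex.arg_eq_zero_iff.1 h.symm).2
      exact (hi c).ne' this
  have hrange : ∀ c, ∑ l ∈ Finset.range (Function.minimalPeriod K.rot c),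
      (cornerModulus z ((K.rot ^ l) c)).arg =
        ∑ c' with K.vtx c' = K.vtx c, (cornerModulus z c').arg := by
    intro c
    -- `Multiplicative ℝ` turns the product formula into one for sums.
    have := Equiv.Perm.prod_range_minimalPeriod (M := Multiplicative ℝ) K.rot
      (fun c => Multiplicative.ofAdd (cornerModulus z c).arg) c
    rw [← ofAdd_sum, ← ofAdd_sum] at this
    rw [Multiplicative.ofAdd.injective this]
    refine Finset.sum_congr (Finset.ext fun c' => ?_) fun _ _ => rfl
    rw [Finset.mem_filter, Finset.mem_filter, eq_comm (a := K.vtx c'), vtx_eq_iff hp]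
    rfl
  -- One turn around the vertex brings the side back to itself, so the moduli have product `1` and
  -- the sum of the positive angles is a positive multiple of `2π`.
  have hge : ∀ c, 2 * Real.pi ≤ ∑ c' with K.vtx c' = K.vtx c, (cornerModulus z c').arg := by
    intro c
    obtain ⟨t, ht⟩ := LiftedTriangle.exists_idx hp c.1
    obtain ⟨t', k', h1, h2, h3⟩ := hQ.exists_rot_pow hp hz t c.2 (Function.minimalPeriod K.rot c)
    have hc : (t.idx, c.2) = c := by rw [ht]
    rw [hc, K.rot.pow_minimalPeriod] at h1
    rw [Prod.ext_iff] at h1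
    obtain ⟨h1, rfl⟩ := h1
    obtain rfl : t' = t := LiftedTriangle.eq_of_map_eq hp (h1.trans ht.symm) h2
    rw [hc] at h3
    have h4 : ∏ l ∈ Finset.range (Function.minimalPeriod K.rot c),
        cornerModulus z ((K.rot ^ l) c) = 1 :=
      mul_right_cancel₀ (hQ.sub_ne_zero hz t' c.2) (by rw [← h3, one_mul])
    set S := ∑ l ∈ Finset.range (Function.minimalPeriod K.rot c),
      (cornerModulus z ((K.rot ^ l) c)).arg
    have hn : ∏ l ∈ Finset.range (Function.minimalPeriod K.rot c),
        ‖cornerModulus z ((K.rot ^ l) c)‖ = 1 := by rw [← norm_prod, h4, norm_one]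
    have hexp : Complex.exp ((S : ℝ) * Complex.I) = 1 := by
      rw [Complex.ofReal_sum, Finset.sum_mul, Complex.exp_sum, ← h4]
      have hq : ∏ l ∈ Finset.range (Function.minimalPeriod K.rot c),
          ((‖cornerModulus z ((K.rot ^ l) c)‖ : ℝ) : ℂ) *
            Complex.exp ((cornerModulus z ((K.rot ^ l) c)).arg * Complex.I) =
          ∏ l ∈ Finset.range (Function.minimalPeriod K.rot c), cornerModulus z ((K.rot ^ l) c) :=
        Finset.prod_congr rfl fun l _ => Complex.norm_mul_exp_arg_mul_I _
      rwa [Finset.prod_mul_distrib, ← Complex.ofReal_prod, hn, Complex.ofReal_one, one_mul] at hq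
    rw [Complex.exp_eq_one_iff] at hexp
    obtain ⟨k, hk⟩ := hexp
    have hk' : S = k * (2 * Real.pi) := by
      have : (S : ℂ) = ((k * (2 * Real.pi) : ℝ) : ℂ) := by
        refine mul_right_cancel₀ Complex.I_ne_zero ?_
        rw [hk]
        push_cast
        ring
      exact_mod_cast this
    have hS : 0 < S := Finset.sum_pos (fun l _ => harg _)
      (Finset.nonempty_range_iff.2 (K.rot.minimalPeriod_pos' c).ne')
    rw [← hrange]
    change _ ≤ S
    have hk1 : (0 : ℝ) < k := by
      by_contra hn
      push Not at hn
      nlinarith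
    have hk2 : (1 : ℝ) ≤ k := by
      have : 0 < k := by exact_mod_cast hk1
      exact_mod_cast this
    nlinarith
  have htot := sum_corners (K := K) fun c => (cornerModulus z c).arg
  rw [Finset.sum_congr rfl fun j _ => sum_arg_cornerModulus hz (him j).le] at htot
  simp only [Finset.sum_const, nsmul_eq_mul, Finset.card_univ, Fintype.card_fin] at htot
  have hn : (n : ℝ) = 2 * (K.range_vtx_finite.toFinset.card : ℝ) := by
    rw [← Set.ncard_eq_toFinset_card _ K.range_vtx_finite]
    exact_mod_cast hcard.symm
  have hle : ∀ v ∈ K.range_vtx_finite.toFinset,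
      2 * Real.pi ≤ ∑ c with K.vtx c = v, (cornerModulus z c).arg := by
    intro v hv
    rw [Set.Finite.mem_toFinset] at hv
    obtain ⟨c, rfl⟩ := hv
    exact hge c
  -- The angles add up to `n π`, which is `2π` times the number of vertices, so no inequality is
  -- strict.
  have heq := (Finset.sum_eq_sum_iff_of_le hle).1 (by
    rw [htot, hn]
    simp only [Finset.sum_const, nsmul_eq_mul]
    ring)
  rw [hrange]
  exact (heq _ (by simp)).symm

/-! ## Piecewise linear maps -/

/-- The piecewise affine extension of a function on the vertices. -/
theorem exists_plMap (hp : K.IsTorusCovering p) (Q : ℝ × ℝ → ℂ) :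
    ∃ D : ℝ × ℝ → ℂ, Continuous D ∧ ∀ (t : K.LiftedTriangle p) x,
      D (t.map x) = ∑ i, (x i : ℂ) * Q (t.vertex i) := by
  refine exists_glue hp (fun t x => ∑ i, (x i : ℂ) * Q (t.vertex i)) (fun t => ?_) ?_
  · refine continuous_finsetSum _ fun i _ => ?_
    exact (Complex.continuous_ofReal.comp (stdSimplex.continuous_coord i)).mul continuous_const
  · intro t t' i i' h x x' hx
    rw [Fin3.sum_eq i, Fin3.sum_eq i', hx.1, hx.2.1, hx.2.2.1, hx.2.2.2, h.vertex_left,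
      h.vertex_right, Complex.ofReal_zero]
    ring

/-- The points with a positive coordinate at the vertex `v`. -/
def openStar (K : TriangulatedSurface n) (p : ℝ × ℝ → K.Space) (v : ℝ × ℝ) : Set (ℝ × ℝ) :=
  {y | ∃ (t : K.LiftedTriangle p) (k : Fin 3) (x : stdSimplex ℝ (Fin 3)),
    t.vertex k = v ∧ t.map x = y ∧ 0 < x k}

/-- The complement is a locally finite union of compact sets: in each triangle, the points with
coordinate zero at `v`. -/
theorem isOpen_openStar (hp : K.IsTorusCovering p) (v : ℝ × ℝ) : IsOpen (K.openStar p v) := by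
  have h : (K.openStar p v)ᶜ = ⋃ t : K.LiftedTriangle p,
      t.map '' {x | ∀ k, t.vertex k = v → x k = 0} := by
    ext y
    simp only [mem_compl_iff, mem_iUnion]
    constructor
    · intro hy
      obtain ⟨t, x, rfl⟩ := LiftedTriangle.exists_eq_map hp y
      refine ⟨t, x, fun k hk => ?_, rfl⟩
      by_contra hne
      exact hy ⟨t, k, x, hk, rfl, lt_of_le_of_ne (stdSimplex.zero_le x k) (Ne.symm hne)⟩
    · rintro ⟨t, x, hx, rfl⟩ ⟨t', k', x', h1, h2, h3⟩
      obtain ⟨k, h4, h5, -⟩ := exists_vertex_eq_of_map_eq hp h2 h3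
      rw [hx k (h5.trans h1)] at h4
      exact h3.ne h4
  rw [← isClosed_compl_iff, h]
  refine ((LiftedTriangle.locallyFinite hp).subset fun t => image_subset_range _ _).isClosed_iUnion
    fun t => ?_
  have : IsClosed {x : stdSimplex ℝ (Fin 3) | ∀ k, t.vertex k = v → x k = 0} := by
    simp only [ofPred_forall]
    exact isClosed_iInter fun k => isClosed_iInter fun _ =>
      isClosed_eq (stdSimplex.continuous_coord k) continuous_const
  exact (this.isCompact.image t.map.continuous).isClosed

theorem exists_mem_openStar (hp : K.IsTorusCovering p) (y : ℝ × ℝ) :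
    ∃ (t : K.LiftedTriangle p) (k : Fin 3), y ∈ K.openStar p (t.vertex k) := by
  obtain ⟨t, x, rfl⟩ := LiftedTriangle.exists_eq_map hp y
  by_contra! h
  have h1 := stdSimplex.add_add_eq_one 0 x
  have h2 : ∀ k, x k ≤ 0 := fun k => not_lt.1 fun hk => h t k ⟨t, k, x, rfl, rfl, hk⟩
  linarith [h2 0, h2 (0 + 1), h2 (0 + 2)]

/-- The sequence of the corners around a vertex of the universal cover. -/
theorem exists_rot_seq (hp : K.IsTorusCovering p) (t : K.LiftedTriangle p) (k : Fin 3) :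
    ∃ (T : ℕ → K.LiftedTriangle p) (κ : ℕ → Fin 3), T 0 = t ∧ κ 0 = k ∧
      ∀ l, Adj (T l) (T (l + 1)) (κ l + 2) (κ (l + 1)) := by
  choose N ν hN using fun q : K.LiftedTriangle p × Fin 3 => exists_adj hp q.1 (q.2 + 2)
  let f : ℕ → K.LiftedTriangle p × Fin 3 := fun l =>
    Nat.rec (t, k) (fun _ q => (N q, ν q)) l
  exact ⟨fun l => (f l).1, fun l => (f l).2, rfl, rfl, fun l => hN (f l)⟩

end TriangulatedSurface

theorem Complex.exists_coords {e e' m : ℂ} (h : e' = m * e) (he : e ≠ 0) (hm : 0 < m.im) :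
    ∃ f g : ℂ → ℝ, Continuous f ∧ Continuous g ∧
      ∀ (w : ℂ) (s s' : ℝ), w = s * e + s' * e' ↔ s = f w ∧ s' = g w := by
  refine ⟨fun w => (w / e).re - (w / e).im / m.im * m.re, fun w => (w / e).im / m.im, ?_, ?_, ?_⟩
  · fun_prop
  · fun_prop
  · intro w s s'
    subst h
    have h1 : w = s * e + s' * (m * e) ↔ w / e = s + s' * m := by
      rw [div_eq_iff he]
      constructor <;> intro h <;> rw [h] <;> ring
    rw [h1, Complex.ext_iff]
    simp only [Complex.add_re, Complex.add_im, Complex.mul_re, Complex.mul_im, Complex.ofReal_re,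
      Complex.ofReal_im, zero_mul, sub_zero, add_zero, zero_add]
    constructor
    · rintro ⟨h2, h3⟩
      have h4 : s' = (w / e).im / m.im := by rw [h3]; field_simp
      refine ⟨?_, h4⟩
      rw [← h4, h2]
      ring
    · rintro ⟨h2, h3⟩
      rw [← h3] at h2
      refine ⟨by linarith, ?_⟩
      rw [h3]
      field_simp

namespace TriangulatedSurface

variable {n : ℕ} {K : TriangulatedSurface n} {p : ℝ × ℝ → K.Space}

/-- If all the triangles are fat and the angle sums are `2 π`, then the piecewise affine map is
an open embedding of the open star of each vertex. -/
theorem isOpenEmbedding_openStar (hp : K.IsTorusCovering p) {z : Fin n → ℂ} (hz : Nondegenerate z)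
    (him : ∀ j, 0 < (z j).im) (hcard : 2 * (range K.vtx).ncard = n) {Q D : ℝ × ℝ → ℂ}
    (hQ : K.IsPlacement p z Q) (hD : Continuous D)
    (hDQ : ∀ (t : K.LiftedTriangle p) x, D (t.map x) = ∑ i, (x i : ℂ) * Q (t.vertex i))
    (t₀ : K.LiftedTriangle p) (k₀ : Fin 3) :
    IsOpenEmbedding ((K.openStar p (t₀.vertex k₀)).domRestrict D) := by
  classical
  set v := t₀.vertex k₀ with hv
  obtain ⟨T, κ, hT0, hκ0, hadj⟩ := exists_rot_seq hp t₀ k₀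
  have hvert : ∀ l, (T l).vertex (κ l) = v := by
    intro l
    induction l with
    | zero => rw [hT0, hκ0]
    | succ l ih => rw [← (hadj l).vertex_right, Fin3.add_two_add_one, ih]
  have hidx : ∀ l, ((T l).idx, κ l) = (K.rot ^ l) (t₀.idx, k₀) := by
    intro l
    induction l with
    | zero => rw [hT0, hκ0]; rfl
    | succ l ih => rw [pow_succ', Equiv.Perm.mul_apply, ← ih, rot_apply, (hadj l).1]
  set L := Function.minimalPeriod K.rot (t₀.idx, k₀) with hL
  have hLpos : 0 < L := K.rot.minimalPeriod_pos' _
  have hTL : T L = T 0 ∧ κ L = κ 0 := by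
    have h1 := hidx L
    rw [hL, K.rot.pow_minimalPeriod, ← hL, Prod.mk.injEq] at h1
    obtain ⟨h1, h2⟩ := h1
    refine ⟨?_, h2.trans hκ0.symm⟩
    have h3 := hvert L
    rw [h2] at h3
    rw [hT0]
    exact LiftedTriangle.eq_of_map_eq hp h1 h3
  -- The triangles at `v` are exactly `T 0, …, T (L - 1)`, in cyclic order.
  have hall : ∀ (t : K.LiftedTriangle p) k, t.vertex k = v → ∃ l < L, T l = t ∧ κ l = k := by
    intro t k h
    obtain ⟨l, hl, h1⟩ :=
      (sameVertex_of_vertex_eq hp (hv ▸ h.symm : t₀.vertex k₀ = t.vertex k)).exists_lt_minimalPeriod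
    rw [← hidx, Prod.mk.injEq] at h1
    obtain ⟨h1, rfl⟩ := h1
    exact ⟨l, hl, LiftedTriangle.eq_of_map_eq hp h1 ((hvert l).trans h.symm), rfl⟩
  set e : ℕ → ℂ := fun l => Q ((T l).vertex (κ l + 1)) - Q v with he
  set m : ℕ → ℂ := fun l => cornerModulus z ((T l).idx, κ l) with hmdef
  have hm : ∀ l, 0 < (m l).im := fun l => cornerModulus_im_pos hz _ (him _)
  have he2 : ∀ l, e (l + 1) = Q ((T l).vertex (κ l + 2)) - Q v := fun l => by
    rw [he]; dsimp only; rw [(hadj l).vertex_left]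
  have hstep : ∀ l, e (l + 1) = m l * e l := by
    intro l
    have := hQ.modulus_mul hz (T l) (κ l)
    rw [hvert] at this
    rw [he2, this]
  have hne : ∀ l, e l ≠ 0 := by
    intro l
    have := hQ.sub_ne_zero hz (T l) (κ l)
    rwa [hvert] at this
  have hsum : ∑ i ∈ Finset.range L, (m i).arg = 2 * Real.pi := by
    rw [← sum_arg_eq_two_pi hp hz him hcard hQ (t₀.idx, k₀)]
    exact Finset.sum_congr rfl fun l _ => by rw [hmdef]; dsimp only; rw [hidx]
  have heL : e L = e 0 := by rw [he]; dsimp only; rw [hTL.1, hTL.2]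
  have hval : ∀ l x, D ((T l).map x) =
      Q v + (((x (κ l + 1) : ℝ) : ℂ) * e l + ((x (κ l + 2) : ℝ) : ℂ) * e (l + 1)) := by
    intro l x
    have h1 : ((x (κ l) : ℝ) : ℂ) + ((x (κ l + 1) : ℝ) : ℂ) + ((x (κ l + 2) : ℝ) : ℂ) = 1 := by
      exact_mod_cast stdSimplex.add_add_eq_one (κ l) x
    rw [hDQ, Fin3.sum_eq (κ l), he2, he, hvert]
    linear_combination Q v * h1
  choose f g hf hg hfg using fun l => Complex.exists_coords (hstep l) (hne l) (hm l)
  -- Points other than `v` are described in half-open triangles with positive coordinate along the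
  -- first side: a point on the second side is passed to the next triangle, and from the last one
  -- back to `T 0`.
  have hnormal : ∀ l < L, ∀ x, (T l).map x ≠ v → ∃ l' < L, ∃ x', (T l').map x' = (T l).map x ∧
      x' (κ l') = x (κ l) ∧ 0 < x' (κ l' + 1) := by
    intro l hl x hx
    have h1 := stdSimplex.zero_le x (κ l + 1)
    rcases h1.lt_or_eq with h1 | h1
    · exact ⟨l, hl, x, rfl, rfl, h1⟩
    · have h2 := stdSimplex.add_add_eq_one (κ l) x
      obtain ⟨x', hx'⟩ := Glued.exists_right (i := κ l + 2) (κ (l + 1)) (x := x)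
        (by rw [Fin3.add_two_add_two, ← h1])
      have h3 : 0 < x' (κ (l + 1) + 1) := by
        rw [← hx'.2.2.1]
        refine lt_of_le_of_ne (stdSimplex.zero_le x _) fun h4 => hx ?_
        rw [stdSimplex.eq_vertex (x := x) (k := κ l) (by linarith), ← hvert l]
        rfl
      have h4 : x' (κ (l + 1)) = x (κ l) := by
        rw [← hx'.2.2.2, Fin3.add_two_add_one]
      have h5 := ((hadj l).2 _ _ hx').symm
      rcases (Nat.succ_le_of_lt hl).lt_or_eq with h6 | h6
      · exact ⟨l + 1, h6, x', h5, h4, h3⟩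
      · rw [Nat.succ_eq_add_one] at h6
        rw [h6, hTL.2] at h3 h4
        rw [h6, hTL.1] at h5
        exact ⟨0, hLpos, x', h5, h4, h3⟩
  have hzero : ∀ l, f l 0 = 0 ∧ g l 0 = 0 := by
    intro l
    have := (hfg l 0 0 0).1 (by simp)
    exact ⟨this.1.symm, this.2.symm⟩
  have hcoord : ∀ l x, x (κ l + 1) = f l (D ((T l).map x) - Q v) ∧
      x (κ l + 2) = g l (D ((T l).map x) - Q v) := by
    intro l x
    refine (hfg l _ _ _).1 ?_
    rw [hval]
    ring
  have hDv : D v = Q v := by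
    rw [← hvert 0, LiftedTriangle.vertex, hval, stdSimplex.vertex_of_ne, stdSimplex.vertex_of_ne,
      ← LiftedTriangle.vertex, hvert]
    · simp
    · exact (Fin3.ne_add_two _).symm
    · exact (Fin3.ne_add_one _).symm
  let S : Set (ℝ × ℝ) := ⋃ l ∈ Finset.range L, range (T l).map
  have hSmem : ∀ {y}, y ∈ S ↔ ∃ l < L, ∃ x, (T l).map x = y := by
    intro y
    simp [S]
  -- Equal values lie in the same half-open sector by `sector_unique`, and within a sector the
  -- coordinates determine the point.
  have hinj : InjOn D S := by
    have key : ∀ l < L, ∀ x, ∀ l' < L, ∀ x', D ((T l).map x) = D ((T l').map x') →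
        (T l).map x ≠ v → (T l).map x = (T l').map x' := by
      intro l hl x l' hl' x' h hx
      obtain ⟨l, hl, x, h1, -, h2⟩ := hnormal l hl x hx
      rw [← h1] at h ⊢
      have hx' : (T l').map x' ≠ v := by
        intro hx'
        rw [hx', hDv] at h
        have := (hcoord l x).1
        rw [h, sub_self, (hzero l).1] at this
        exact h2.ne' this
      obtain ⟨l', hl', x', h1', -, h2'⟩ := hnormal l' hl' x' hx'
      rw [← h1'] at h ⊢
      have heq : l = l' := sector_unique (w := D ((T l).map x) - Q v) hstep (hne 0) hm hsum hl hl'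
        (s := x (κ l + 1)) (s' := x (κ l + 2)) (r := x' (κ l' + 1)) (r' := x' (κ l' + 2))
        h2 (stdSimplex.zero_le x _) h2' (stdSimplex.zero_le x' _) (by rw [hval]; ring)
        (by rw [h, hval]; ring)
      subst heq
      have h3 := hcoord l x
      have h4 := hcoord l x'
      rw [h] at h3
      congr 1
      refine stdSimplex.ext_of (κ l + 1) (h3.1.trans h4.1.symm) ?_
      rw [Fin3.add_one_add_one]
      exact h3.2.trans h4.2.symm
    intro y hy y' hy' h
    obtain ⟨l, hl, x, rfl⟩ := hSmem.1 hy
    obtain ⟨l', hl', x', rfl⟩ := hSmem.1 hy'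
    by_cases h1 : (T l).map x = v
    · by_cases h2 : (T l').map x' = v
      · rw [h1, h2]
      · exact (key _ hl' _ _ hl _ h.symm h2).symm
    · exact key _ hl _ _ hl' _ h h1
  have hsub : K.openStar p v ⊆ S := by
    rintro y ⟨t, k, x, h1, h2, -⟩
    obtain ⟨l, hl, rfl, -⟩ := hall t k h1
    exact hSmem.2 ⟨l, hl, x, h2⟩
  have hScomp : IsCompact S :=
    (Finset.range L).isCompact_biUnion fun l _ => isCompact_range (T l).map.continuous
  have hemb : IsEmbedding ((K.openStar p v).domRestrict D) := by
    have _ : CompactSpace S := isCompact_iff_compactSpace.1 hScomp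
    have h1 : IsClosedEmbedding (S.domRestrict D) :=
      (hD.comp continuous_subtype_val).isClosedEmbedding (injOn_iff_injective.1 hinj)
    exact h1.isEmbedding.comp (IsEmbedding.inclusion hsub)
  refine ⟨hemb, ?_⟩
  -- `C l` is the part of sector `l` on or beyond the side opposite `v`. The image of the open star
  -- is the complement of the finite union of these closed sets, which gives openness.
  let C : ℕ → Set ℂ := fun l =>
    {w | 0 ≤ f l (w - Q v) ∧ 0 ≤ g l (w - Q v) ∧ 1 ≤ f l (w - Q v) + g l (w - Q v)}
  have hC : IsClosed (⋃ l ∈ Finset.range L, C l) := by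
    refine isClosed_biUnion_finset fun l _ => ?_
    have h1 : Continuous fun w => f l (w - Q v) := (hf l).comp (by fun_prop)
    have h2 : Continuous fun w => g l (w - Q v) := (hg l).comp (by fun_prop)
    exact (isClosed_le continuous_const h1).inter ((isClosed_le continuous_const h2).inter
      (isClosed_le continuous_const (h1.add h2)))
  have hrange : range ((K.openStar p v).domRestrict D) = (⋃ l ∈ Finset.range L, C l)ᶜ := by
    ext w
    simp only [mem_range, mem_compl_iff, mem_iUnion, Finset.mem_range, not_exists]
    constructor
    · rintro ⟨⟨y, t, k, x, h1, h2, h3⟩, rfl⟩ l' hl' ⟨h4, h5, h6⟩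
      obtain ⟨l, hl, rfl, rfl⟩ := hall t k h1
      change 0 ≤ f l' (D y - Q v) at h4
      change 0 ≤ g l' (D y - Q v) at h5
      change 1 ≤ f l' (D y - Q v) + g l' (D y - Q v) at h6
      rw [← h2] at h4 h5 h6
      have hyv : (T l).map x ≠ v := by
        intro hy
        rw [hy, hDv, sub_self, (hzero l').1, (hzero l').2] at h6
        linarith
      obtain ⟨l, hl, x', h7, h8, h9⟩ := hnormal l hl x hyv
      rw [← h7] at h4 h5 h6
      rw [← h8] at h3
      have h10 := stdSimplex.add_add_eq_one (κ l) x'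
      have hw := (hfg l' (D ((T l).map x') - Q v) _ _).2 ⟨rfl, rfl⟩
      have hw' : D ((T l).map x') - Q v = x' (κ l + 1) * e l + x' (κ l + 2) * e (l + 1) := by
        rw [hval]; ring
      rcases h4.lt_or_eq with h4 | h4
      · have heq : l = l' := sector_unique hstep (hne 0) hm hsum hl hl' h9
          (stdSimplex.zero_le x' _) h4 h5 hw' hw
        subst heq
        rw [← (hcoord l x').1, ← (hcoord l x').2] at h6
        linarith
      -- Here the value lies on the second ray of sector `l'`, which the half-open convention gives
      -- to the following sector.
      · rw [← h4, Complex.ofReal_zero, zero_mul, zero_add] at hw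
        rw [← h4, zero_add] at h6
        have h11 : ∃ l'' < L, D ((T l).map x') - Q v =
            (g l' (D ((T l).map x') - Q v) : ℝ) * e l'' + (0 : ℝ) * e (l'' + 1) := by
          rcases (Nat.succ_le_of_lt hl').lt_or_eq with h | h
          · exact ⟨l' + 1, h, by rw [← hw]; simp⟩
          · refine ⟨0, hLpos, ?_⟩
            rw [← heL, ← h, Nat.succ_eq_add_one, ← hw]
            simp
        obtain ⟨l'', hl'', h11⟩ := h11
        have heq : l = l'' := sector_unique hstep (hne 0) hm hsum hl hl'' h9
          (stdSimplex.zero_le x' _) (by linarith) le_rfl hw' h11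
        subst heq
        have h12 := ((hfg l _ _ _).1 h11).1.trans (hcoord l x').1.symm
        have := stdSimplex.zero_le x' (κ l + 2)
        linarith
    · intro h
      by_cases hw : w = Q v
      · refine ⟨⟨v, T 0, κ 0, stdSimplex.vertex (κ 0), hvert 0, hvert 0, by simp⟩, ?_⟩
        change D v = w
        rw [hDv, hw]
      · obtain ⟨l, hl, s, s', hs, hs', h1⟩ :=
          sector_exists hstep (hne 0) hm hsum (sub_ne_zero.2 hw)
        have h2 := (hfg l _ _ _).1 h1
        have h3 : s + s' < 1 := by
          by_contra h3
          push Not at h3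
          exact h l hl ⟨h2.1 ▸ hs.le, h2.2 ▸ hs', by rw [← h2.1, ← h2.2]; exact h3⟩
        refine ⟨⟨(T l).map (triPoint (κ l) (1 - s - s') s s' (by linarith) hs.le hs' (by ring)),
          T l, κ l, _, hvert l, rfl, ?_⟩, ?_⟩
        · rw [triPoint_zero]
          linarith
        · change D ((T l).map _) = w
          rw [hval, triPoint_one, triPoint_two, ← h1]
          ring
  rw [hrange]
  exact hC.isOpen_compl

/-- A placement of fat triangles with angle sums `2 π` extends to a local homeomorphism which is
affine on the triangles. -/
theorem isLocalHomeomorph_of_fat (hp : K.IsTorusCovering p) {z : Fin n → ℂ} (hz : Nondegenerate z)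
    (him : ∀ j, 0 < (z j).im) (hcard : 2 * (range K.vtx).ncard = n) {Q D : ℝ × ℝ → ℂ}
    (hQ : K.IsPlacement p z Q) (hD : Continuous D)
    (hDQ : ∀ (t : K.LiftedTriangle p) x, D (t.map x) = ∑ i, (x i : ℂ) * Q (t.vertex i)) :
    IsLocalHomeomorph D := by
  refine isLocalHomeomorph_iff_isOpenEmbedding_restrict.2 fun y => ?_
  obtain ⟨t, k, h⟩ := exists_mem_openStar hp y
  exact ⟨_, (isOpen_openStar hp _).mem_nhds h,
    isOpenEmbedding_openStar hp hz him hcard hQ hD hDQ t k⟩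

end TriangulatedSurface

/-! ## Flipping a diagonal -/

theorem stdSimplex.min_nonneg (x : stdSimplex ℝ (Fin 3)) (i : Fin 3) : 0 ≤ min (x i) (x (i + 1)) :=
  le_min (stdSimplex.zero_le x _) (stdSimplex.zero_le x _)

/-- In the quadrilateral `A M B C` with diagonal `A B`, divided by the other diagonal: the point
with coordinates `x` in `A B C`, as a point of `A M C`. -/
def flipLeft (i l : Fin 3) (x : stdSimplex ℝ (Fin 3)) : stdSimplex ℝ (Fin 3) :=
  -- The coordinates are those of a parallelogram, `A + B = M + C`: for `x_B ≤ x_A`, the point `x_A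
  -- A + x_B B + x_C C` equals `(x_A - x_B) A + x_B M + (1 - x_A) C`. The minimum keeps the formula
  -- meaningful on the whole simplex.
  triPoint l (x i - min (x i) (x (i + 1))) (min (x i) (x (i + 1))) (1 - x i)
    (sub_nonneg.2 (min_le_left _ _)) (stdSimplex.min_nonneg x i) (sub_nonneg.2 (stdSimplex.le_one x i)) (by ring)

/-- In the quadrilateral `A M B C` with diagonal `A B`, divided by the other diagonal: the point
with coordinates `x` in `A B C`, as a point of `C M B`. -/
def flipRight (i l : Fin 3) (x : stdSimplex ℝ (Fin 3)) : stdSimplex ℝ (Fin 3) :=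
  triPoint l (1 - x (i + 1)) (min (x i) (x (i + 1))) (x (i + 1) - min (x i) (x (i + 1)))
    (sub_nonneg.2 (stdSimplex.le_one x _)) (stdSimplex.min_nonneg x i) (sub_nonneg.2 (min_le_right _ _)) (by ring)

theorem continuous_triPoint {X : Type*} [TopologicalSpace X] (l : Fin 3) {a b c : X → ℝ}
    (ha : Continuous a) (hb : Continuous b) (hc : Continuous c) (h1 : ∀ x, 0 ≤ a x)
    (h2 : ∀ x, 0 ≤ b x) (h3 : ∀ x, 0 ≤ c x) (h : ∀ x, a x + b x + c x = 1) :
    Continuous fun x => triPoint l (a x) (b x) (c x) (h1 x) (h2 x) (h3 x) (h x) := by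
  refine Continuous.subtype_mk (continuous_pi fun k => ?_) _
  split_ifs <;> assumption

theorem continuous_flipLeft (i l : Fin 3) : Continuous (flipLeft i l) := by
  have h0 := stdSimplex.continuous_coord i
  have h1 := stdSimplex.continuous_coord (i + 1)
  exact continuous_triPoint l (h0.sub (h0.min h1)) (h0.min h1) (continuous_const.sub h0) _ _ _ _

theorem continuous_flipRight (i l : Fin 3) : Continuous (flipRight i l) := by
  have h0 := stdSimplex.continuous_coord i
  have h1 := stdSimplex.continuous_coord (i + 1)
  exact continuous_triPoint l (continuous_const.sub h1) (h0.min h1) (h1.sub (h0.min h1)) _ _ _ _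

theorem sidePoint_self (i : Fin 3) (s : unitInterval) : sidePoint i s i = 1 - s := triPoint_zero
theorem sidePoint_add_one (i : Fin 3) (s : unitInterval) : sidePoint i s (i + 1) = s := triPoint_one
theorem sidePoint_add_two (i : Fin 3) (s : unitInterval) : sidePoint i s (i + 2) = 0 := triPoint_two

theorem sidePoint_zero (i : Fin 3) : sidePoint i 0 = stdSimplex.vertex i :=
  stdSimplex.eq_vertex (by rw [sidePoint_self]; simp)

theorem sidePoint_one (i : Fin 3) : sidePoint i 1 = stdSimplex.vertex (i + 1) :=
  stdSimplex.eq_vertex (by rw [sidePoint_add_one]; simp)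

section
variable {i l : Fin 3} {x : stdSimplex ℝ (Fin 3)}

theorem flipLeft_zero (h : x (i + 1) ≤ x i) : flipLeft i l x l = x i - x (i + 1) := by
  rw [flipLeft, triPoint_zero, min_eq_right h]
theorem flipLeft_one (h : x (i + 1) ≤ x i) : flipLeft i l x (l + 1) = x (i + 1) := by
  rw [flipLeft, triPoint_one, min_eq_right h]
theorem flipLeft_two : flipLeft i l x (l + 2) = 1 - x i := by
  rw [flipLeft, triPoint_two]
theorem flipRight_zero : flipRight i l x l = 1 - x (i + 1) := by
  rw [flipRight, triPoint_zero]
theorem flipRight_one (h : x i ≤ x (i + 1)) : flipRight i l x (l + 1) = x i := by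
  rw [flipRight, triPoint_one, min_eq_left h]
theorem flipRight_two (h : x i ≤ x (i + 1)) : flipRight i l x (l + 2) = x (i + 1) - x i := by
  rw [flipRight, triPoint_two, min_eq_left h]

end

namespace TriangulatedSurface

variable {n : ℕ} {K K' : TriangulatedSurface n}

/-- The map of the triangle `A B C` to the surface where the diagonal `A B` has been replaced by
`M C`. -/
def flipHalf (K' : TriangulatedSurface n) (i : Fin 3) (k : Fin n) (l : Fin 3) (k' : Fin n)
    (l' : Fin 3) (x : stdSimplex ℝ (Fin 3)) : K'.Space :=
  if x (i + 1) ≤ x i then K'.toSpace k (flipLeft i l x) else K'.toSpace k' (flipRight i l' x)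

section flipHalf
variable {i l l' : Fin 3} {k k' : Fin n} {x : stdSimplex ℝ (Fin 3)}

theorem flipHalf_of_le (h : x (i + 1) ≤ x i) :
    K'.flipHalf i k l k' l' x = K'.toSpace k (flipLeft i l x) := if_pos h

theorem toSpace_flipLeft_eq (hK : K'.pairing (k, l + 1) = (k', l')) (h : x (i + 1) = x i) :
    K'.toSpace k (flipLeft i l x) = K'.toSpace k' (flipRight i l' x) := by
  refine Quot.sound ⟨l + 1, l', hK, ?_, ?_, ?_, ?_⟩
  · rw [Fin3.add_one_add_two, flipLeft_zero h.le, h, sub_self]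
  · rw [flipRight_two h.ge, h, sub_self]
  · rw [flipLeft_one h.le, flipRight_one h.ge, h]
  · rw [Fin3.add_one_add_one, flipLeft_two, flipRight_zero, h]

theorem flipHalf_of_ge (hK : K'.pairing (k, l + 1) = (k', l')) (h : x i ≤ x (i + 1)) :
    K'.flipHalf i k l k' l' x = K'.toSpace k' (flipRight i l' x) := by
  rcases h.lt_or_eq with h | h
  · exact if_neg (not_le.2 h)
  · rw [flipHalf_of_le h.ge, toSpace_flipLeft_eq hK h.symm]

theorem continuous_flipHalf (hK : K'.pairing (k, l + 1) = (k', l')) :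
    Continuous (K'.flipHalf i k l k' l') :=
  Continuous.if_le ((continuous_toSpace k).comp (continuous_flipLeft i l))
    ((continuous_toSpace k').comp (continuous_flipRight i l')) (stdSimplex.continuous_coord _)
    (stdSimplex.continuous_coord _) fun _ h => toSpace_flipLeft_eq hK h

theorem flipHalf_side_one (hK : K'.pairing (k, l + 1) = (k', l')) (s : unitInterval) :
    K'.flipHalf i k l k' l' (sidePoint (i + 1) s) = K'.toSpace k' (sidePoint (l' + 2) s) := by
  have h0 : sidePoint (i + 1) s i = 0 := by
    have := sidePoint_add_two (i + 1) s
    rwa [Fin3.add_one_add_two] at this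
  have h1 := sidePoint_self (i + 1) s
  have hle : sidePoint (i + 1) s i ≤ sidePoint (i + 1) s (i + 1) := by
    rw [h0]; exact stdSimplex.zero_le _ _
  rw [flipHalf_of_ge hK hle]
  congr 1
  refine stdSimplex.ext_of l' ?_ ?_
  · rw [flipRight_zero, h1]
    have := sidePoint_add_one (l' + 2) s
    rw [Fin3.add_two_add_one] at this
    rw [this]
    ring
  · rw [flipRight_one hle, h0]
    have := sidePoint_add_two (l' + 2) s
    rw [Fin3.add_two_add_two] at this
    rw [this]

theorem flipHalf_side_two (s : unitInterval) :
    K'.flipHalf i k l k' l' (sidePoint (i + 2) s) = K'.toSpace k (sidePoint (l + 2) s) := by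
  have h0 := sidePoint_add_one (i + 2) s
  have h1 := sidePoint_add_two (i + 2) s
  rw [Fin3.add_two_add_one] at h0
  rw [Fin3.add_two_add_two] at h1
  have hle : sidePoint (i + 2) s (i + 1) ≤ sidePoint (i + 2) s i := by
    rw [h1]; exact stdSimplex.zero_le _ _
  rw [flipHalf_of_le hle]
  congr 1
  refine stdSimplex.ext_of l ?_ ?_
  · rw [flipLeft_zero hle, h0, h1]
    have := sidePoint_add_one (l + 2) s
    rw [Fin3.add_two_add_one] at this
    rw [this]
    ring
  · rw [flipLeft_one hle, h1]
    have := sidePoint_add_two (l + 2) s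
    rw [Fin3.add_two_add_two] at this
    rw [this]

theorem flipHalf_glue (i i' : Fin 3) (hK : K'.pairing (k, l + 1) = (k', l')) (s : unitInterval) :
    K'.flipHalf i k l k' l' (sidePoint i s) =
      K'.flipHalf i' k' (l' + 2) k (l + 1) (sidePoint i' (unitInterval.symm s)) := by
  have hK' : K'.pairing (k', l' + 2 + 1) = (k, l + 1) := by
    rw [Fin3.add_two_add_one, ← hK, K'.involutive]
  have h0 := sidePoint_self i s
  have h1 := sidePoint_add_one i s
  have h0' := sidePoint_self i' (unitInterval.symm s)
  have h1' := sidePoint_add_one i' (unitInterval.symm s)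
  rw [unitInterval.coe_symm_eq] at h0' h1'
  rw [sub_sub_cancel] at h0'
  rcases le_total (sidePoint i s (i + 1)) (sidePoint i s i) with h | h
  · have h' : sidePoint i' (unitInterval.symm s) i' ≤
        sidePoint i' (unitInterval.symm s) (i' + 1) := by rwa [h0', h1', ← h0, ← h1]
    rw [flipHalf_of_le h, flipHalf_of_ge hK' h']
    congr 1
    refine stdSimplex.ext_of (l + 1) ?_ ?_
    · rw [flipLeft_one h, flipRight_zero, h1, h1']
      ring
    · rw [flipRight_one h', Fin3.add_one_add_one, flipLeft_two, h0, h0']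
      ring
  · have h' : sidePoint i' (unitInterval.symm s) (i' + 1) ≤
        sidePoint i' (unitInterval.symm s) i' := by rwa [h0', h1', ← h0, ← h1]
    rw [flipHalf_of_ge hK h, flipHalf_of_le h']
    congr 1
    refine stdSimplex.ext_of (l' + 2) ?_ ?_
    · rw [flipRight_two h, flipLeft_zero h', h0, h1, h0', h1']
    · rw [flipLeft_one h', Fin3.add_two_add_one, flipRight_zero, h1, h1']

end flipHalf

/-- `K'` is obtained from `K` by flipping the common side `(j, i)`, `(j', i')` of two triangles.
The new triangles `k`, `k'` have their common side at `(k, l + 1)`, `(k', l')`, and the other sides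
are renamed by `τ`. -/
structure IsFlip (K K' : TriangulatedSurface n) (τ : Equiv.Perm (Fin n × Fin 3)) (j : Fin n)
    (i : Fin 3) (j' : Fin n) (i' : Fin 3) (k : Fin n) (l : Fin 3) (k' : Fin n) (l' : Fin 3) :
    Prop where
  ne : j ≠ j'
  target : (k = j ∧ k' = j') ∨ (k = j' ∧ k' = j)
  inner : K.pairing (j, i) = (j', i')
  inner' : K'.pairing (k, l + 1) = (k', l')
  compat : ∀ c, K'.pairing (τ c) = τ (K.pairing c)
  fix : ∀ c : Fin n × Fin 3, c.1 ≠ j → c.1 ≠ j' → τ c = c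
  side_one : τ (j, i + 1) = (k', l' + 2)
  side_two : τ (j, i + 2) = (k, l + 2)
  side_one' : τ (j', i' + 1) = (k, l)
  side_two' : τ (j', i' + 2) = (k', l' + 1)

namespace IsFlip

variable {τ : Equiv.Perm (Fin n × Fin 3)} {j j' k k' : Fin n} {i i' l l' : Fin 3}

/-- The two triangles of the quadrilateral play symmetric roles, so checks on one of them suffice.
-/
theorem rotate (F : IsFlip K K' τ j i j' i' k l k' l') :
    IsFlip K K' τ j' i' j i k' (l' + 2) k (l + 1) where
  ne := F.ne.symm
  target := F.target.imp And.symm And.symm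
  inner := by rw [← F.inner, K.involutive]
  inner' := by rw [Fin3.add_two_add_one, ← F.inner', K'.involutive]
  compat := F.compat
  fix c h h' := F.fix c h' h
  side_one := by rw [Fin3.add_one_add_two, F.side_one']
  side_two := by rw [Fin3.add_two_add_two, F.side_two']
  side_one' := F.side_one
  side_two' := by rw [Fin3.add_one_add_one, F.side_two]

theorem target_ne (F : IsFlip K K' τ j i j' i' k l k' l') : k ≠ k' := by
  rcases F.target with ⟨rfl, rfl⟩ | ⟨rfl, rfl⟩
  exacts [F.ne, F.ne.symm]

theorem other (F : IsFlip K K' τ j i j' i' k l k' l') (a : Fin n) :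
    (a ≠ k ∧ a ≠ k') ↔ (a ≠ j ∧ a ≠ j') := by
  rcases F.target with ⟨rfl, rfl⟩ | ⟨rfl, rfl⟩
  exacts [Iff.rfl, and_comm]

/-- Undoing a flip is again a flip, up to the names of the triangles; this is why the structure
allows free target labels. It supplies the inverse of the identification of the surfaces. -/
theorem inverse (F : IsFlip K K' τ j i j' i' k l k' l') :
    IsFlip K' K τ⁻¹ k (l + 1) k' l' j' (i' + 2) j i where
  ne := F.target_ne
  target := by
    rcases F.target with ⟨rfl, rfl⟩ | ⟨rfl, rfl⟩
    exacts [Or.inr ⟨rfl, rfl⟩, Or.inl ⟨rfl, rfl⟩]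
  inner := F.inner'
  inner' := by rw [Fin3.add_two_add_one, ← F.inner, K.involutive]
  compat c := by
    rw [Equiv.Perm.eq_inv_iff_eq, ← F.compat]
    exact congrArg K'.pairing (τ.apply_symm_apply c)
  fix c h h' := by
    obtain ⟨h1, h2⟩ := (F.other c.1).1 ⟨h, h'⟩
    rw [Equiv.Perm.inv_eq_iff_eq, F.fix c h1 h2]
  side_one := by rw [Equiv.Perm.inv_eq_iff_eq, F.side_two, Fin3.add_one_add_one]
  side_two := by rw [Equiv.Perm.inv_eq_iff_eq, Fin3.add_two_add_two, F.side_one',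
    Fin3.add_one_add_two]
  side_one' := by rw [Equiv.Perm.inv_eq_iff_eq, F.side_two']
  side_two' := by rw [Equiv.Perm.inv_eq_iff_eq, F.side_one]

open Classical in
/-- The identification of the surfaces, triangle by triangle. -/
def preMap (_ : IsFlip K K' τ j i j' i' k l k' l') (q : Fin n × stdSimplex ℝ (Fin 3)) : K'.Space :=
  if q.1 = j then K'.flipHalf i k l k' l' q.2
  else if q.1 = j' then K'.flipHalf i' k' (l' + 2) k (l + 1) q.2
  else K'.toSpace q.1 q.2

theorem preMap_left (F : IsFlip K K' τ j i j' i' k l k' l') (x : stdSimplex ℝ (Fin 3)) :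
    F.preMap (j, x) = K'.flipHalf i k l k' l' x := if_pos rfl

theorem preMap_right (F : IsFlip K K' τ j i j' i' k l k' l') (x : stdSimplex ℝ (Fin 3)) :
    F.preMap (j', x) = K'.flipHalf i' k' (l' + 2) k (l + 1) x :=
  (if_neg F.ne.symm).trans (if_pos rfl)

theorem preMap_other (F : IsFlip K K' τ j i j' i' k l k' l') {a : Fin n} (h : a ≠ j) (h' : a ≠ j')
    (x : stdSimplex ℝ (Fin 3)) : F.preMap (a, x) = K'.toSpace a x :=
  (if_neg h).trans (if_neg h')

theorem preMap_side (F : IsFlip K K' τ j i j' i' k l k' l') {c : Fin n × Fin 3} (h : c ≠ (j, i))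
    (h' : c ≠ (j', i')) (s : unitInterval) :
    F.preMap (c.1, sidePoint c.2 s) = K'.toSpace (τ c).1 (sidePoint (τ c).2 s) := by
  obtain ⟨a, b⟩ := c
  by_cases h1 : a = j
  · subst h1
    rw [preMap_left]
    rcases Fin3.eq_or i b with rfl | rfl | rfl
    · exact absurd rfl h
    · rw [F.side_one, flipHalf_side_one F.inner']
    · rw [F.side_two, flipHalf_side_two]
  · by_cases h2 : a = j'
    · subst h2
      rw [preMap_right]
      rcases Fin3.eq_or i' b with rfl | rfl | rfl
      · exact absurd rfl h'
      · rw [F.side_one', flipHalf_side_one F.rotate.inner', Fin3.add_one_add_two]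
      · rw [F.side_two', flipHalf_side_two, Fin3.add_two_add_two]
    · rw [preMap_other _ h1 h2, F.fix (a, b) h1 h2]

/-- Sides other than the diagonal are carried to sides by `τ` with their parametrisation, and `τ`
respects the pairings; the diagonal is treated by `flipHalf_glue`. -/
theorem preMap_glue (F : IsFlip K K' τ j i j' i' k l k' l') {a b : Fin n × stdSimplex ℝ (Fin 3)}
    (h : K.GlueRel a b) : F.preMap a = F.preMap b := by
  obtain ⟨a, x⟩ := a
  obtain ⟨b, y⟩ := b
  obtain ⟨u, v, h1, h2⟩ := h
  change Glued u v x y at h2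
  dsimp only at h1
  obtain ⟨s, rfl⟩ := exists_sidePoint h2.1
  obtain rfl := h2.unique (glued_sidePoint u v s)
  by_cases h3 : (a, u) = (j, i)
  · obtain ⟨rfl, rfl⟩ := Prod.mk.inj h3
    obtain ⟨rfl, rfl⟩ := Prod.mk.inj (h1.symm.trans F.inner)
    rw [preMap_left, preMap_right, flipHalf_glue u v F.inner']
  by_cases h4 : (a, u) = (j', i')
  · obtain ⟨rfl, rfl⟩ := Prod.mk.inj h4
    obtain ⟨rfl, rfl⟩ := Prod.mk.inj (h1.symm.trans F.rotate.inner)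
    rw [preMap_left, preMap_right, flipHalf_glue u v F.rotate.inner', Fin3.add_one_add_two,
      Fin3.add_two_add_one]
  have h5 : (b, v) ≠ (j, i) := by
    rw [← h1, ← F.rotate.inner]
    exact fun h => h4 (K.pairing.injective h)
  have h6 : (b, v) ≠ (j', i') := by
    rw [← h1, ← F.inner]
    exact fun h => h3 (K.pairing.injective h)
  rw [F.preMap_side (c := (a, u)) h3 h4, F.preMap_side (c := (b, v)) h5 h6]
  refine Quot.sound ⟨(τ (a, u)).2, (τ (b, v)).2, ?_, glued_sidePoint _ _ s⟩
  rw [← h1, ← F.compat]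

/-- The identification of the surfaces. -/
def map (F : IsFlip K K' τ j i j' i' k l k' l') : K.Space → K'.Space :=
  Quot.lift F.preMap fun _ _ h => F.preMap_glue h

theorem map_toSpace (F : IsFlip K K' τ j i j' i' k l k' l') (a : Fin n)
    (x : stdSimplex ℝ (Fin 3)) : F.map (K.toSpace a x) = F.preMap (a, x) := rfl

theorem continuous_map (F : IsFlip K K' τ j i j' i' k l k' l') : Continuous F.map := by
  refine continuous_quot_lift _ ?_
  rw [continuous_prod_of_discrete_left]
  intro a
  by_cases h1 : a = j
  · subst h1
    simp only [preMap_left]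
    exact continuous_flipHalf F.inner'
  · by_cases h2 : a = j'
    · subst h2
      simp only [preMap_right]
      exact continuous_flipHalf F.rotate.inner'
    · simp only [preMap_other _ h1 h2]
      exact continuous_toSpace a

theorem inverse_map_left (F : IsFlip K K' τ j i j' i' k l k' l') (x : stdSimplex ℝ (Fin 3)) :
    F.inverse.map (F.map (K.toSpace j x)) = K.toSpace j x := by
  have h3 := stdSimplex.add_add_eq_one i x
  have h4 := stdSimplex.zero_le x (i + 2)
  rw [map_toSpace, preMap_left]
  rcases le_total (x (i + 1)) (x i) with h | h
  · have h0 := flipLeft_zero (l := l) h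
    have h1 := flipLeft_one (l := l) h
    have h2 := flipLeft_two (i := i) (l := l) (x := x)
    have h' : flipLeft i l x (l + 1) ≤ flipLeft i l x (l + 1 + 1) := by
      rw [Fin3.add_one_add_one, h1, h2]
      linarith
    rw [flipHalf_of_le h, map_toSpace, preMap_left, flipHalf_of_ge F.inverse.inner' h']
    congr 1
    refine stdSimplex.ext_of i ?_ ?_
    · rw [flipRight_zero, Fin3.add_one_add_one, h2]
      ring
    · rw [flipRight_one h', h1]
  · have h0 := flipRight_zero (i := i) (l := l') (x := x)
    have h1 := flipRight_one (l := l') h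
    have h' : flipRight i l' x (l' + 1) ≤ flipRight i l' x l' := by
      rw [h0, h1]
      linarith
    rw [flipHalf_of_ge F.inner' h, map_toSpace, preMap_right, flipHalf_of_le h']
    congr 1
    refine stdSimplex.ext_of i ?_ ?_
    · have := flipLeft_one (l := i + 2) h'
      rw [Fin3.add_two_add_one] at this
      rw [this, h1]
    · have := flipLeft_two (i := l') (l := i + 2) (x := flipRight i l' x)
      rw [Fin3.add_two_add_two] at this
      rw [this, h0]
      ring

theorem map_rotate (F : IsFlip K K' τ j i j' i' k l k' l') : F.rotate.map = F.map := by
  funext y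
  obtain ⟨⟨a, x⟩, rfl⟩ := Quot.exists_rep y
  change F.rotate.preMap (a, x) = F.preMap (a, x)
  by_cases h1 : a = j
  · subst h1
    rw [preMap_left, preMap_right, Fin3.add_one_add_two, Fin3.add_two_add_one]
  · by_cases h2 : a = j'
    · subst h2
      rw [preMap_left, preMap_right]
    · rw [preMap_other _ h1 h2, preMap_other _ h2 h1]

theorem inverse_rotate_map (F : IsFlip K K' τ j i j' i' k l k' l') :
    F.rotate.inverse.map = F.inverse.map := by
  rw [← F.inverse.map_rotate]
  funext y
  obtain ⟨⟨a, x⟩, rfl⟩ := Quot.exists_rep y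
  change F.rotate.inverse.preMap (a, x) = F.inverse.rotate.preMap (a, x)
  simp only [preMap, Fin3.add_two_add_one]

theorem inverse_map (F : IsFlip K K' τ j i j' i' k l k' l') (y : K.Space) :
    F.inverse.map (F.map y) = y := by
  obtain ⟨⟨a, x⟩, rfl⟩ := Quot.exists_rep y
  change F.inverse.map (F.map (K.toSpace a x)) = K.toSpace a x
  by_cases h1 : a = j
  · subst h1
    exact F.inverse_map_left x
  · by_cases h2 : a = j'
    · subst h2
      have := F.rotate.inverse_map_left x
      rwa [map_rotate F, inverse_rotate_map F] at this
    · obtain ⟨h3, h4⟩ := (F.other a).2 ⟨h1, h2⟩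
      rw [map_toSpace, preMap_other _ h1 h2, map_toSpace, preMap_other _ h3 h4]

/-- The identification of the surfaces is a homeomorphism. -/
def homeomorph (F : IsFlip K K' τ j i j' i' k l k' l') : K.Space ≃ₜ K'.Space where
  toFun := F.map
  invFun := F.inverse.map
  left_inv := F.inverse_map
  right_inv y := by
    have h := (Function.LeftInverse.injective F.inverse.inverse_map)
    exact h (F.inverse_map _)
  continuous_toFun := F.continuous_map
  continuous_invFun := F.inverse.continuous_map

theorem homeomorph_side (F : IsFlip K K' τ j i j' i' k l k' l') {c : Fin n × Fin 3}
    (h : c ≠ (j, i)) (h' : c ≠ (j', i')) (s : unitInterval) :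
    F.homeomorph (K.toSpace c.1 (sidePoint c.2 s)) = K'.toSpace (τ c).1 (sidePoint (τ c).2 s) :=
  F.preMap_side h h' s

end IsFlip

theorem _root_.Equiv.Perm.exists_fourCycle {α : Type*} {a b c d : α} (hab : a ≠ b)
    (hac : a ≠ c) (had : a ≠ d) (hbc : b ≠ c) (hbd : b ≠ d) (hcd : c ≠ d) :
    ∃ τ : Equiv.Perm α, τ a = b ∧ τ b = c ∧ τ c = d ∧ τ d = a ∧
      ∀ x, x ≠ a → x ≠ b → x ≠ c → x ≠ d → τ x = x := by
  classical
  refine ⟨Equiv.swap a b * Equiv.swap b c * Equiv.swap c d, ?_, ?_, ?_, ?_, ?_⟩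
  · rw [Equiv.Perm.mul_apply, Equiv.Perm.mul_apply, Equiv.swap_apply_of_ne_of_ne hac had,
      Equiv.swap_apply_of_ne_of_ne hab hac, Equiv.swap_apply_left]
  · rw [Equiv.Perm.mul_apply, Equiv.Perm.mul_apply, Equiv.swap_apply_of_ne_of_ne hbc hbd,
      Equiv.swap_apply_left, Equiv.swap_apply_of_ne_of_ne hac.symm hbc.symm]
  · rw [Equiv.Perm.mul_apply, Equiv.Perm.mul_apply, Equiv.swap_apply_left,
      Equiv.swap_apply_of_ne_of_ne hbd.symm hcd.symm,
      Equiv.swap_apply_of_ne_of_ne had.symm hbd.symm]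
  · rw [Equiv.Perm.mul_apply, Equiv.Perm.mul_apply, Equiv.swap_apply_right,
      Equiv.swap_apply_right, Equiv.swap_apply_right]
  · intro x ha hb hc hd
    rw [Equiv.Perm.mul_apply, Equiv.Perm.mul_apply, Equiv.swap_apply_of_ne_of_ne hc hd,
      Equiv.swap_apply_of_ne_of_ne hb hc, Equiv.swap_apply_of_ne_of_ne ha hb]

/-- The surface whose sides are paired as in `K` after renaming. -/
def rename (K : TriangulatedSurface n) (τ : Equiv.Perm (Fin n × Fin 3)) : TriangulatedSurface n where
  pairing := τ.symm.trans (K.pairing.trans τ)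
  involutive c := by
    change τ (K.pairing (τ.symm (τ (K.pairing (τ.symm c))))) = c
    rw [τ.symm_apply_apply, K.involutive, τ.apply_symm_apply]
  ne_self c h := K.ne_self (τ.symm c) (τ.injective (h.trans (τ.apply_symm_apply c).symm))

/-- The side `(j, i)` between two different triangles can be flipped. -/
theorem exists_isFlip {j j' : Fin n} {i i' : Fin 3} (h : K.pairing (j, i) = (j', i'))
    (hne : j ≠ j') : ∃ K' τ, IsFlip K K' τ j i j' i' j i j' i' := by
  have e1 : ∀ a b : Fin 3, (j, a) ≠ (j', b) := fun a b h => hne (Prod.mk.inj h).1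
  have e2 : ∀ (k : Fin n) {a b : Fin 3}, a ≠ b → (k, a) ≠ (k, b) :=
    fun k a b hab h => hab (Prod.mk.inj h).2
  -- The old diagonal `(j, i)` takes the name `(j, i + 1)` of the new one, while `(j', i')` and `(j,
  -- i + 2)` keep theirs. Conjugating the pairing by this 4-cycle then glues the two halves along
  -- the new diagonal.
  obtain ⟨τ, ha, hb, hc, hd, hx⟩ := Equiv.Perm.exists_fourCycle (a := (j, i)) (b := (j, i + 1))
    (c := (j', i' + 2)) (d := (j', i' + 1)) (e2 j (Fin3.ne_add_one i)) (e1 _ _) (e1 _ _) (e1 _ _)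
    (e1 _ _) (e2 j' (Fin3.add_one_ne_add_two i').symm)
  have hi' : τ (j', i') = (j', i') := hx _ (e1 _ _).symm (e1 _ _).symm
    (e2 j' (Fin3.ne_add_two i')) (e2 j' (Fin3.ne_add_one i'))
  have hcompat : ∀ c, (K.rename τ).pairing (τ c) = τ (K.pairing c) := fun c => by
    exact congrArg (fun c => τ (K.pairing c)) (τ.symm_apply_apply c)
  refine ⟨K.rename τ, τ, hne, Or.inl ⟨rfl, rfl⟩, h, ?_, hcompat, ?_, hb, ?_, hd, hc⟩
  · rw [← ha, hcompat, h, hi']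
  · intro c h1 h2
    exact hx c (fun h => h1 (congrArg Prod.fst h)) (fun h => h1 (congrArg Prod.fst h))
      (fun h => h2 (congrArg Prod.fst h)) (fun h => h2 (congrArg Prod.fst h))
  · exact hx _ (e2 j (Fin3.ne_add_two i).symm) (e2 j (Fin3.add_one_ne_add_two i).symm) (e1 _ _)
      (e1 _ _)

end TriangulatedSurface

/-! ## Moduli -/

/-- The modulus of a triangle whose corner `l` has modulus `w`. -/
def fromCorner (l : Fin 3) (w : ℂ) : ℂ := ![w, 1 - 1 / w, 1 / (1 - w)] l

theorem continuousAt_fromCorner (l : Fin 3) {w : ℂ} (h0 : w ≠ 0) (h1 : w ≠ 1) :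
    ContinuousAt (fromCorner l) w := by
  have h1' := sub_ne_zero.2 h1.symm
  fin_cases l
  · exact continuousAt_id
  · exact continuousAt_const.sub (continuousAt_const.div continuousAt_id h0)
  · exact continuousAt_const.div (continuousAt_const.sub continuousAt_id) h1'

theorem fromCorner_im_pos (l : Fin 3) {w : ℂ} (h : 0 < w.im) : 0 < (fromCorner l w).im := by
  have hw : ∀ _ : Fin 1, w ≠ 0 ∧ w ≠ 1 := fun _ =>
    ⟨fun h0 => by simp [h0] at h, fun h0 => by simp [h0] at h⟩
  have h1 := TriangulatedSurface.cornerModulus_im_pos (z := fun _ : Fin 1 => w) hw (0, 1) h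
  have h2 := TriangulatedSurface.cornerModulus_im_pos (z := fun _ : Fin 1 => w) hw (0, 2) h
  fin_cases l
  exacts [h, h2, h1]

theorem fromCorner_eq {l : Fin 3} {w : ℂ} (h0 : w ≠ 0) (h1 : w ≠ 1) {P : Fin 3 → ℂ}
    (hP : P (l + 1) ≠ P l) (h : P (l + 2) - P l = w * (P (l + 1) - P l)) :
    P 1 ≠ P 0 ∧ P 2 - P 0 = fromCorner l w * (P 1 - P 0) := by
  have h1' := sub_ne_zero.2 h1.symm
  have hP' := sub_ne_zero.2 hP
  fin_cases l
  · exact ⟨hP, h⟩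
  · change P 0 - P 1 = w * (P 2 - P 1) at h
    have hP'' : P 2 - P 1 ≠ 0 := hP'
    refine ⟨fun h2 => ?_, ?_⟩
    · rw [h2, sub_self, zero_eq_mul] at h
      rcases h with h | h
      exacts [h0 h, hP'' (by rw [h2]; exact h)]
    · change _ = (1 - 1 / w) * _
      field_simp
      linear_combination -h
  · change P 1 - P 2 = w * (P 0 - P 2) at h
    have h3 : P 1 - P 0 = (1 - w) * (P 2 - P 0) := by linear_combination h
    have hP'' : P 0 - P 2 ≠ 0 := hP'
    refine ⟨fun h2 => ?_, ?_⟩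
    · rw [h2, sub_self, zero_eq_mul] at h3
      rcases h3 with h3 | h3
      exacts [h1' h3, hP'' (by linear_combination -h3)]
    · change _ = (1 / (1 - w)) * _
      rw [h3]
      field_simp

theorem continuousAt_cornerModulus {n : ℕ} {z : Fin n → ℂ} (hz : Nondegenerate z)
    (c : Fin n × Fin 3) : ContinuousAt (fun z => cornerModulus z c) z := by
  obtain ⟨j, i⟩ := c
  have h0 := (hz j).1
  have h1 := sub_ne_zero.2 (hz j).2.symm
  have hc : ContinuousAt (fun z : Fin n → ℂ => z j) z := (continuous_apply j).continuousAt
  fin_cases i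
  · exact hc
  · exact continuousAt_const.div (continuousAt_const.sub hc) h1
  · exact continuousAt_const.sub (continuousAt_const.div hc h0)

theorem eventually_nondegenerate {n : ℕ} {z₀ : Fin n → ℂ} (hz : Nondegenerate z₀) :
    ∀ᶠ z in 𝓝 z₀, Nondegenerate z := by
  refine eventually_all.2 fun j => ?_
  have hc : ContinuousAt (fun z : Fin n → ℂ => z j) z₀ := (continuous_apply j).continuousAt
  exact (hc.eventually_ne (hz j).1).and (hc.eventually_ne (hz j).2)

/-- For a real modulus `x` the long side is side `1`, `0` or `2` according to `x < 0`, `0 < x < 1`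
or `x > 1`. -/
theorem exists_isLongSide {n : ℕ} {z : Fin n → ℂ} (hz : Nondegenerate z) {j : Fin n}
    (h : IsFlat z j) : ∃ i, IsLongSide z (j, i) := by
  obtain ⟨x, hx⟩ : ∃ x : ℝ, z j = x := ⟨(z j).re, Complex.ext rfl (by simpa [IsFlat] using h)⟩
  have h0 : x ≠ 0 := fun h0 => (hz j).1 (by rw [hx, h0]; simp)
  have h1 : x ≠ 1 := fun h0 => (hz j).2 (by rw [hx, h0]; simp)
  have c0 : cornerModulus z (j, 0) = (x : ℝ) := hx
  have c1 : cornerModulus z (j, 1) = ((1 / (1 - x) : ℝ) : ℂ) := by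
    change 1 / (1 - z j) = _
    rw [hx]; push_cast; rfl
  have c2 : cornerModulus z (j, 2) = ((1 - 1 / x : ℝ) : ℂ) := by
    change 1 - 1 / z j = _
    rw [hx]; push_cast; rfl
  rcases lt_or_gt_of_ne h0 with h2 | h2
  · refine ⟨1, h, ?_, ?_⟩
    · rw [c1]
      exact Complex.arg_ofReal_of_nonneg (by have : 0 < 1 - x := by linarith
                                             positivity)
    · change (cornerModulus z (j, 2)).arg = 0
      rw [c2]
      exact Complex.arg_ofReal_of_nonneg (by have := one_div_neg.2 h2; linarith)
  · rcases lt_or_gt_of_ne h1 with h3 | h3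
    · refine ⟨0, h, ?_, ?_⟩
      · rw [c0]
        exact Complex.arg_ofReal_of_nonneg h2.le
      · change (cornerModulus z (j, 1)).arg = 0
        rw [c1]
        exact Complex.arg_ofReal_of_nonneg (by have : 0 < 1 - x := by linarith
                                               positivity)
    · refine ⟨2, h, ?_, ?_⟩
      · rw [c2]
        refine Complex.arg_ofReal_of_nonneg ?_
        have : 1 / x < 1 := (div_lt_one h2).2 h3
        linarith
      · change (cornerModulus z (j, 0)).arg = 0
        rw [c0]
        exact Complex.arg_ofReal_of_nonneg h2.le

theorem IsLongSide.exists_pos {n : ℕ} {z : Fin n → ℂ} (hz : Nondegenerate z) {c : Fin n × Fin 3}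
    (h : IsLongSide z c) : (∃ r : ℝ, 0 < r ∧ cornerModulus z c = r) ∧
      ∃ r : ℝ, 0 < r ∧ cornerModulus z (c.1, c.2 + 1) = r := by
  have key : ∀ c, (cornerModulus z c).arg = 0 → ∃ r : ℝ, 0 < r ∧ cornerModulus z c = r := by
    intro c hc
    obtain ⟨h1, h2⟩ := Complex.arg_eq_zero_iff.1 hc
    have h3 : cornerModulus z c = ((cornerModulus z c).re : ℝ) := Complex.ext rfl (by simpa using h2)
    refine ⟨_, lt_of_le_of_ne h1 fun h4 => cornerModulus_ne_zero hz c ?_, h3⟩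
    rw [h3, ← h4]
    simp
  exact ⟨key _ h.2.1, key _ h.2.2⟩

namespace TriangulatedSurface

variable {n : ℕ} {K K' : TriangulatedSurface n} {p p' : ℝ × ℝ → K.Space}

/-- The longest side is the longest. -/
theorem IsPlacement.norm_lt_of_isLongSide {p : ℝ × ℝ → K.Space} {z : Fin n → ℂ} {Q : ℝ × ℝ → ℂ}
    (hQ : K.IsPlacement p z Q) (hz : Nondegenerate z) (t : K.LiftedTriangle p) {i b : Fin 3}
    (h : IsLongSide z (t.idx, i)) (hb : b ≠ i) :
    ‖Q (t.vertex (b + 1)) - Q (t.vertex b)‖ < ‖Q (t.vertex (i + 1)) - Q (t.vertex i)‖ := by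
  obtain ⟨⟨r, hr, h1⟩, ⟨r', hr', h2⟩⟩ := h.exists_pos hz
  have e1 := hQ.modulus_mul hz t i
  have e2 := hQ.modulus_mul hz t (i + 1)
  dsimp only at h2
  rw [h1] at e1
  rw [h2, Fin3.add_one_add_two, Fin3.add_one_add_one] at e2
  have hv := hQ.sub_ne_zero hz t i
  set v := Q (t.vertex (i + 1)) - Q (t.vertex i) with hvdef
  have hvn := norm_pos_iff.2 hv
  have e3 : Q (t.vertex (i + 2)) - Q (t.vertex (i + 1)) = ((r - 1 : ℝ) : ℂ) * v := by
    push_cast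
    linear_combination e1
  -- The positive moduli `r`, `r'` at the ends of the long side satisfy this relation, so `0 < r <
  -- 1`: the third vertex lies between the ends, and the other sides are shorter by the factors `r`
  -- and `1 - r`.
  have e4 : r' * (1 - r) = 1 := by
    rw [e3] at e2
    have : ((r' * (1 - r) : ℝ) : ℂ) = 1 := by
      refine mul_right_cancel₀ hv ?_
      push_cast at e2 ⊢
      linear_combination e2
    exact_mod_cast this
  have hr1 : 0 < 1 - r := by
    by_contra hn
    push Not at hn
    nlinarith
  rcases Fin3.eq_or i b with rfl | rfl | rfl
  · exact absurd rfl hb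
  · rw [Fin3.add_one_add_one, e3, norm_mul, Complex.norm_real, Real.norm_eq_abs, abs_of_neg
      (by linarith)]
    nlinarith
  · rw [Fin3.add_two_add_one, norm_sub_rev, e1, norm_mul, Complex.norm_real, Real.norm_eq_abs,
      abs_of_pos hr]
    nlinarith

/-! ## Lifted triangles after a flip -/

theorem IsTorusCovering.comp_homeomorph {p : ℝ × ℝ → K.Space} (hp : K.IsTorusCovering p)
    (Θ : K.Space ≃ₜ K'.Space) : K'.IsTorusCovering (Θ ∘ p) where
  isCoveringMap := hp.isCoveringMap.homeomorph_comp Θ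
  surjective := Θ.surjective.comp hp.surjective
  fibers x y := by
    rw [← hp.fibers, Function.comp_apply, Function.comp_apply, Θ.injective.eq_iff]

/-- Both sides lift one path of the second surface. This carries lifted sides from one triangulation
to the other without lifting the homeomorphism on whole triangles, which it does not preserve. -/
theorem eq_side_of_eq {p : ℝ × ℝ → K.Space} {p' : ℝ × ℝ → K'.Space} (hp' : K'.IsTorusCovering p')
    (Θ : K.Space → K'.Space) (hΘ : ∀ y, Θ (p y) = p' y) {c c' : Fin n × Fin 3}
    (h : ∀ s, Θ (K.toSpace c.1 (sidePoint c.2 s)) = K'.toSpace c'.1 (sidePoint c'.2 s))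
    {t : K.LiftedTriangle p} {t' : K'.LiftedTriangle p'} (ht : t.idx = c.1) (ht' : t'.idx = c'.1)
    {s₀ : unitInterval} (h₀ : t'.map (sidePoint c'.2 s₀) = t.map (sidePoint c.2 s₀))
    (s : unitInterval) : t'.map (sidePoint c'.2 s) = t.map (sidePoint c.2 s) := by
  refine congrFun (hp'.isCoveringMap.eq_of_comp_eq
    (g₁ := fun s => t'.map (sidePoint c'.2 s)) (g₂ := fun s => t.map (sidePoint c.2 s))
    (t'.map.continuous.comp (continuous_sidePoint _))
    (t.map.continuous.comp (continuous_sidePoint _)) ?_ s₀ h₀) s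
  funext u
  change p' _ = p' _
  rw [t'.lifts, ← hΘ, t.lifts, ht, ht', h]

theorem exists_side_lift {p : ℝ × ℝ → K.Space} {p' : ℝ × ℝ → K'.Space}
    (hp' : K'.IsTorusCovering p')
    (Θ : K.Space → K'.Space) (hΘ : ∀ y, Θ (p y) = p' y) {c c' : Fin n × Fin 3}
    (h : ∀ s, Θ (K.toSpace c.1 (sidePoint c.2 s)) = K'.toSpace c'.1 (sidePoint c'.2 s))
    {t : K.LiftedTriangle p} (ht : t.idx = c.1) :
    ∃ t' : K'.LiftedTriangle p', t'.idx = c'.1 ∧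
      ∀ s, t'.map (sidePoint c'.2 s) = t.map (sidePoint c.2 s) := by
  obtain ⟨t', h1, h2⟩ := LiftedTriangle.exists_map_eq hp' (j := c'.1) (x := sidePoint c'.2 0)
    (y := t.map (sidePoint c.2 0)) (by rw [← hΘ, t.lifts, ht, h])
  exact ⟨t', h1, eq_side_of_eq hp' Θ hΘ h ht h1 h2⟩

theorem vertex_eq_of_side {p : ℝ × ℝ → K.Space} {p' : ℝ × ℝ → K'.Space}
    {t : K.LiftedTriangle p} {t' : K'.LiftedTriangle p'} {i i' : Fin 3}
    (h : ∀ s, t'.map (sidePoint i' s) = t.map (sidePoint i s)) :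
    t'.vertex i' = t.vertex i ∧ t'.vertex (i' + 1) = t.vertex (i + 1) := by
  have h0 := h 0
  have h1 := h 1
  rw [sidePoint_zero, sidePoint_zero] at h0
  rw [sidePoint_one, sidePoint_one] at h1
  exact ⟨h0, h1⟩

namespace IsFlip

variable {τ : Equiv.Perm (Fin n × Fin 3)} {j j' k k' : Fin n} {i i' l l' : Fin 3}
  {p : ℝ × ℝ → K.Space} {p' : ℝ × ℝ → K'.Space}

theorem inverse_map_side (F : IsFlip K K' τ j i j' i' k l k' l') {c : Fin n × Fin 3}
    (h : c ≠ (j, i)) (h' : c ≠ (j', i')) (s : unitInterval) :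
    F.homeomorph.symm (K'.toSpace (τ c).1 (sidePoint (τ c).2 s)) =
      K.toSpace c.1 (sidePoint c.2 s) := by
  rw [← F.homeomorph_side h h', Homeomorph.symm_apply_apply]

theorem ne_inner (F : IsFlip K K' τ j i j' i' k l k' l') (a : Fin n) {b b' : Fin 3} (hb : b' ≠ b)
    (h : (a, b) = (j, i) ∨ (a, b) = (j', i')) : (a, b') ≠ (j, i) ∧ (a, b') ≠ (j', i') := by
  rcases h with h | h <;> obtain ⟨rfl, rfl⟩ := Prod.mk.inj h
  · exact ⟨fun h => hb (Prod.mk.inj h).2, fun h => F.ne (Prod.mk.inj h).1⟩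
  · exact ⟨fun h => F.ne (Prod.mk.inj h).1.symm, fun h => hb (Prod.mk.inj h).2⟩

/-- The vertices of the triangulations are the same. -/
theorem exists_vertex (F : IsFlip K K' τ j i j' i' k l k' l') (hp' : K'.IsTorusCovering p')
    (hΘ : ∀ y, F.homeomorph (p y) = p' y) (t : K.LiftedTriangle p) (b : Fin 3) :
    ∃ (t' : K'.LiftedTriangle p') (b' : Fin 3), t'.vertex b' = t.vertex b := by
  by_cases h : (t.idx, b) = (j, i) ∨ (t.idx, b) = (j', i')
  · obtain ⟨h1, h2⟩ := F.ne_inner t.idx (b' := b + 2) (Fin3.ne_add_two b).symm h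
    obtain ⟨t', -, h3⟩ := exists_side_lift hp' F.homeomorph hΘ (F.homeomorph_side h1 h2) rfl
    refine ⟨t', _, (vertex_eq_of_side h3).2.trans ?_⟩
    rw [Fin3.add_two_add_one]
  · push Not at h
    obtain ⟨t', -, h3⟩ := exists_side_lift hp' F.homeomorph hΘ (F.homeomorph_side h.1 h.2) rfl
    exact ⟨t', _, (vertex_eq_of_side h3).1⟩

theorem map_vtx_mem (F : IsFlip K K' τ j i j' i' k l k' l') (c : Fin n × Fin 3) :
    F.map (K.vtx c) ∈ range K'.vtx := by
  obtain ⟨a, b⟩ := c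
  by_cases h : (a, b) = (j, i) ∨ (a, b) = (j', i')
  · obtain ⟨h1, h2⟩ := F.ne_inner a (b' := b + 2) (Fin3.ne_add_two b).symm h
    have := F.homeomorph_side h1 h2 1
    rw [sidePoint_one, sidePoint_one, Fin3.add_two_add_one] at this
    exact ⟨((τ (a, b + 2)).1, (τ (a, b + 2)).2 + 1), this.symm⟩
  · push Not at h
    have := F.homeomorph_side h.1 h.2 0
    rw [sidePoint_zero, sidePoint_zero] at this
    exact ⟨_, this.symm⟩

/-- The identification matches vertices in both directions, so the count `2 V = n` persists under
flips. -/
theorem ncard_vtx (F : IsFlip K K' τ j i j' i' k l k' l') :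
    (range K'.vtx).ncard = (range K.vtx).ncard := by
  rw [← ncard_image_of_injective _ F.homeomorph.injective]
  congr 1
  ext y
  constructor
  · rintro ⟨c, rfl⟩
    obtain ⟨c', h⟩ := F.inverse.map_vtx_mem c
    exact ⟨_, ⟨c', rfl⟩, by rw [h]; exact F.homeomorph.apply_symm_apply (K'.vtx c)⟩
  · rintro ⟨_, ⟨c, rfl⟩, rfl⟩
    exact F.map_vtx_mem c

/-- The modulus of one of the corners of the new triangle `A M C`. -/
theorem corner_eq (F : IsFlip K K' τ j i j' i' k l k' l') (hp : K.IsTorusCovering p)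
    (hp' : K'.IsTorusCovering p') (hΘ : ∀ y, F.homeomorph (p y) = p' y) {z : Fin n → ℂ}
    (hz : Nondegenerate z) {Q : ℝ × ℝ → ℂ} (hQ : K.IsPlacement p z Q) (t' : K'.LiftedTriangle p')
    (ht' : t'.idx = k) : Q (t'.vertex (l + 1)) ≠ Q (t'.vertex l) ∧
      Q (t'.vertex (l + 2)) - Q (t'.vertex l) =
        (cornerModulus z (j, i) * cornerModulus z (j', i' + 1)) *
          (Q (t'.vertex (l + 1)) - Q (t'.vertex l)) := by
  have hΘ' : ∀ y, F.homeomorph.symm (p' y) = p y := fun y => by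
    rw [← hΘ, Homeomorph.symm_apply_apply]
  have n1 := F.ne_inner j (b' := i + 2) (Fin3.ne_add_two i).symm (Or.inl rfl)
  have n2 := F.ne_inner j' (b' := i' + 1) (Fin3.ne_add_one i').symm (Or.inr rfl)
  have s1 := F.inverse_map_side n1.1 n1.2
  have s2 := F.homeomorph_side n2.1 n2.2
  rw [F.side_two] at s1
  rw [F.side_one'] at s2
  obtain ⟨t, ht, h1⟩ := exists_side_lift (c := (k, l + 2)) (c' := (j, i + 2)) hp F.homeomorph.symm
    hΘ' s1 ht'
  obtain ⟨h2, h3⟩ := vertex_eq_of_side h1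
  rw [Fin3.add_two_add_one, Fin3.add_two_add_one] at h3
  dsimp only at h2 h3
  obtain ⟨u, i'', hu⟩ := exists_adj hp t i
  obtain ⟨hu', rfl⟩ := Prod.mk.inj (hu.1.symm.trans ((congrArg (fun a => K.pairing (a, i)) ht).trans
    F.inner))
  have h4 := eq_side_of_eq (c := (j', i'' + 1)) (c' := (k, l)) (t := u) (t' := t') hp' F.homeomorph
    hΘ s2 hu' ht' (s₀ := 0) (by
      rw [sidePoint_zero, sidePoint_zero]
      exact h3.symm.trans hu.vertex_left)
  obtain ⟨h5, h6⟩ := vertex_eq_of_side h4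
  -- The corner of the new triangle at `A` is the union of the corners of `t` and of its neighbour
  -- `u` there, so their moduli multiply.
  have e1 := hQ.modulus_mul hz t i
  have e2 := hQ.modulus_mul hz u (i'' + 1)
  have e3 := hQ.sub_ne_zero hz u (i'' + 1)
  rw [Fin3.add_one_add_two] at e2
  dsimp only at h5 h6
  rw [← h5, ← h6, hu'] at e2
  rw [← h5, ← h6] at e3
  rw [h2, h3, ht, hu.vertex_right] at e1
  refine ⟨sub_ne_zero.1 e3, ?_⟩
  rw [e1, e2]
  ring

/-- The moduli after the flip. -/
def moduli (_ : IsFlip K K' τ j i j' i' k l k' l') (z : Fin n → ℂ) (a : Fin n) : ℂ :=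
  open Classical in
  if a = k then fromCorner l (cornerModulus z (j, i) * cornerModulus z (j', i' + 1))
  else if a = k' then
    fromCorner (l' + 2) (cornerModulus z (j', i') * cornerModulus z (j, i + 1))
  else z a

/-- The same function on the vertices serves for both triangulations. Positive imaginary parts keep
the new corner moduli away from `0` and `1`. -/
theorem isPlacement (F : IsFlip K K' τ j i j' i' k l k' l') (hp : K.IsTorusCovering p)
    (hp' : K'.IsTorusCovering p') (hΘ : ∀ y, F.homeomorph (p y) = p' y) {z : Fin n → ℂ}
    (hz : Nondegenerate z)
    (h1 : 0 < (cornerModulus z (j, i) * cornerModulus z (j', i' + 1)).im)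
    (h2 : 0 < (cornerModulus z (j', i') * cornerModulus z (j, i + 1)).im)
    {Q : ℝ × ℝ → ℂ} (hQ : K.IsPlacement p z Q) : K'.IsPlacement p' (F.moduli z) Q := by
  have key : ∀ {w : ℂ}, 0 < w.im → w ≠ 0 ∧ w ≠ 1 := fun {w} h =>
    ⟨fun h0 => by simp [h0] at h, fun h0 => by simp [h0] at h⟩
  intro t'
  by_cases hk : t'.idx = k
  · obtain ⟨e1, e2⟩ := F.corner_eq hp hp' hΘ hz hQ t' hk
    rw [moduli, if_pos hk]
    exact fromCorner_eq (P := fun b => Q (t'.vertex b)) (key h1).1 (key h1).2 e1 e2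
  · by_cases hk' : t'.idx = k'
    · have hΘr : ∀ y, F.rotate.homeomorph (p y) = p' y := fun y => by
        rw [← hΘ]
        exact congrFun F.map_rotate _
      obtain ⟨e1, e2⟩ := F.rotate.corner_eq hp hp' hΘr hz hQ t' hk'
      rw [moduli, if_neg hk, if_pos hk']
      exact fromCorner_eq (P := fun b => Q (t'.vertex b)) (key h2).1 (key h2).2 e1 e2
    · rw [moduli, if_neg hk, if_neg hk']
      obtain ⟨h3, h4⟩ := (F.other _).1 ⟨hk, hk'⟩
      have hΘ' : ∀ y, F.homeomorph.symm (p' y) = p y := fun y => by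
        rw [← hΘ, Homeomorph.symm_apply_apply]
      have s : ∀ b s, F.homeomorph.symm (K'.toSpace t'.idx (sidePoint b s)) =
          K.toSpace t'.idx (sidePoint b s) := by
        intro b s
        have := F.inverse_map_side (c := (t'.idx, b)) (fun h => h3 (congrArg Prod.fst h))
          (fun h => h4 (congrArg Prod.fst h)) s
        rwa [F.fix _ h3 h4] at this
      obtain ⟨t, ht, h5⟩ := exists_side_lift (c := (t'.idx, 0)) (c' := (t'.idx, 0)) hp
        F.homeomorph.symm hΘ' (s 0) rfl
      obtain ⟨h6, h7⟩ := vertex_eq_of_side h5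
      have h8 := eq_side_of_eq (c := (t'.idx, 1)) (c' := (t'.idx, 1)) hp
        F.homeomorph.symm hΘ' (s 1) rfl ht (s₀ := 0) (by
          rw [sidePoint_zero]
          exact h7)
      obtain ⟨-, h9⟩ := vertex_eq_of_side h8
      have := hQ t
      rw [ht] at this
      change t.vertex 0 = t'.vertex 0 at h6
      change t.vertex 1 = t'.vertex 1 at h7
      change t.vertex 2 = t'.vertex 2 at h9
      rwa [h6, h7, h9] at this

theorem continuousAt_moduli (F : IsFlip K K' τ j i j' i' k l k' l') {z : Fin n → ℂ}
    (hz : Nondegenerate z)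
    (h1 : 0 < (cornerModulus z (j, i) * cornerModulus z (j', i' + 1)).im)
    (h2 : 0 < (cornerModulus z (j', i') * cornerModulus z (j, i + 1)).im) :
    ContinuousAt F.moduli z := by
  have key : ∀ {w : ℂ}, 0 < w.im → w ≠ 0 ∧ w ≠ 1 := fun {w} h =>
    ⟨fun h0 => by simp [h0] at h, fun h0 => by simp [h0] at h⟩
  refine continuousAt_pi.2 fun a => ?_
  unfold moduli
  split_ifs
  · exact ContinuousAt.comp (g := fromCorner l) (continuousAt_fromCorner l (key h1).1 (key h1).2)
      ((continuousAt_cornerModulus hz _).mul (continuousAt_cornerModulus hz _))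
  · exact ContinuousAt.comp (g := fromCorner (l' + 2))
      (continuousAt_fromCorner (l' + 2) (key h2).1 (key h2).2)
      ((continuousAt_cornerModulus hz _).mul (continuousAt_cornerModulus hz _))
  · exact (continuous_apply a).continuousAt

end IsFlip

end TriangulatedSurface

/-! ### Extending placements to local homeomorphisms, by induction on the number of flat triangles.
-/

namespace TriangulatedSurface

variable {n : ℕ}

/-- `D` is a local homeomorphism extending the function `Q` on the vertices, affine on the sides of
the polygons and as equivariant as `Q`. -/
structure ExtendsPlacement (K : TriangulatedSurface n) (p : ℝ × ℝ → K.Space) (z₀ : Fin n → ℂ)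
    (Q D : ℝ × ℝ → ℂ) : Prop where
  isLocalHomeomorph : IsLocalHomeomorph D
  apply_vertex : ∀ (t : K.LiftedTriangle p) i, D (t.vertex i) = Q (t.vertex i)
  apply_side : ∀ (t : K.LiftedTriangle p) i, K.IsPolygonSide z₀ (t.idx, i) → ∀ s : unitInterval,
    D (t.map (sidePoint i s)) =
      ((1 - s : ℝ) : ℂ) * Q (t.vertex i) + ((s : ℝ) : ℂ) * Q (t.vertex (i + 1))
  equivariant : ∀ (a b : ℂ) (m k : ℤ),
    (∀ (t : K.LiftedTriangle p) i, Q (t.vertex i + intVec m k) = a * Q (t.vertex i) + b) →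
      ∀ x, D (x + intVec m k) = a * D x + b

/-- The piecewise affine map is affine on all sides, so any `z₀` may be used to single out the
polygon sides. -/
theorem exists_extendsPlacement_of_fat {K : TriangulatedSurface n} {p : ℝ × ℝ → K.Space}
    (hp : K.IsTorusCovering p) (hcard : 2 * (range K.vtx).ncard = n) {z : Fin n → ℂ}
    (hz : Nondegenerate z) (him : ∀ j, 0 < (z j).im) (z₀ : Fin n → ℂ) {Q : ℝ × ℝ → ℂ}
    (hQ : K.IsPlacement p z Q) : ∃ D, K.ExtendsPlacement p z₀ Q D := by
  obtain ⟨D, hD, hDQ⟩ := exists_plMap hp Q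
  refine ⟨D, isLocalHomeomorph_of_fat hp hz him hcard hQ hD hDQ, ?_, ?_, ?_⟩
  · intro t i
    rw [LiftedTriangle.vertex, hDQ, Fin3.sum_eq i, stdSimplex.vertex_self,
      stdSimplex.vertex_of_ne (Fin3.ne_add_one i).symm,
      stdSimplex.vertex_of_ne (Fin3.ne_add_two i).symm]
    simp [LiftedTriangle.vertex]
  · intro t i _ s
    rw [hDQ, Fin3.sum_eq i, sidePoint_self, sidePoint_add_one, sidePoint_add_two]
    simp
  · intro a b m k h x
    obtain ⟨t, x, rfl⟩ := LiftedTriangle.exists_eq_map hp x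
    rw [← LiftedTriangle.translate_map hp, hDQ, hDQ]
    simp only [LiftedTriangle.translate_vertex, h]
    have h1 : ((x 0 : ℝ) : ℂ) + ((x 1 : ℝ) : ℂ) + ((x 2 : ℝ) : ℂ) = 1 := by
      exact_mod_cast stdSimplex.add_add_eq_one 0 x
    rw [Fin.sum_univ_three, Fin.sum_univ_three]
    linear_combination b * h1

theorem isLongSide_congr {z z' : Fin n → ℂ} {c : Fin n × Fin 3} (h : z c.1 = z' c.1) :
    IsLongSide z c ↔ IsLongSide z' c := by
  simp only [IsLongSide, IsFlat, cornerModulus, h]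

/-- The lengths of the sides of the triangles, for a placement with translational holonomy. -/
theorem exists_sideLength {K : TriangulatedSurface n} {p : ℝ × ℝ → K.Space}
    (hp : K.IsTorusCovering p) (Q : ℝ × ℝ → ℂ)
    {per : ℤ → ℤ → ℂ}
    (hper : ∀ x m k, Q (x + intVec m k) = Q x + per m k) :
    ∃ len : Fin n × Fin 3 → ℝ, (∀ (t : K.LiftedTriangle p) b,
      ‖Q (t.vertex (b + 1)) - Q (t.vertex b)‖ = len (t.idx, b)) ∧
      ∀ c, len (K.pairing c) = len c := by
  choose T hT using LiftedTriangle.exists_idx (K := K) (p := p) hp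
  let len : Fin n × Fin 3 → ℝ := fun c =>
    ‖Q ((T c.1).vertex (c.2 + 1)) - Q ((T c.1).vertex c.2)‖
  have hlen : ∀ (t : K.LiftedTriangle p) b,
      ‖Q (t.vertex (b + 1)) - Q (t.vertex b)‖ = len (t.idx, b) := by
    intro t b
    obtain ⟨m, k, h⟩ := LiftedTriangle.exists_translate hp (hT t.idx)
    rw [h, LiftedTriangle.translate_vertex, LiftedTriangle.translate_vertex, hper, hper,
      add_sub_add_right_eq_sub, LiftedTriangle.translate_idx, hT]
  refine ⟨len, hlen, fun c => ?_⟩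
  obtain ⟨t', i', h⟩ := exists_adj hp (T c.1) c.2
  have h1 : (t'.idx, i') = K.pairing c := by rw [← h.1, hT]
  rw [← h1, ← hlen, ← h.vertex_left, ← h.vertex_right, norm_sub_rev]

/-- Placements with moduli close to `z₀` extend to local homeomorphisms. -/
theorem exists_extendsPlacement {K : TriangulatedSurface n} {p : ℝ × ℝ → K.Space}
    (hp : K.IsTorusCovering p) (hcard : 2 * (range K.vtx).ncard = n) {z₀ : Fin n → ℂ}
    (hz₀ : Nondegenerate z₀) (him : ∀ j, 0 ≤ (z₀ j).im) {Q₀ : ℝ × ℝ → ℂ}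
    (hQ₀ : K.IsPlacement p z₀ Q₀) {per : ℤ → ℤ → ℂ}
    (hper : ∀ x m k, Q₀ (x + intVec m k) = Q₀ x + per m k)
    (hlong : ∀ c, IsLongSide z₀ c → ¬ IsLongSide z₀ (K.pairing c)) :
    ∀ᶠ z in 𝓝 z₀, ∀ Q, K.IsPlacement p z Q → ∃ D, K.ExtendsPlacement p z₀ Q D := by
  induction hN : {j | IsFlat z₀ j}.ncard using Nat.strong_induction_on generalizing K z₀ with
  | _ N ih =>
  by_cases hfl : ∃ j, IsFlat z₀ j
  swap
  · push Not at hfl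
    have hpos : ∀ j, 0 < (z₀ j).im := fun j => lt_of_le_of_ne (him j) (Ne.symm (hfl j))
    have hev : ∀ᶠ z in 𝓝 z₀, ∀ j, 0 < (z j).im := eventually_all.2 fun j =>
      (Complex.continuous_im.comp (continuous_apply j)).continuousAt.eventually (lt_mem_nhds (hpos j))
    filter_upwards [hev, eventually_nondegenerate hz₀] with z h1 h2 Q hQ
    exact exists_extendsPlacement_of_fat hp hcard h2 h1 z₀ hQ
  choose T hT using LiftedTriangle.exists_idx (K := K) (p := p) hp
  obtain ⟨len, hlen, hlenp⟩ := exists_sideLength hp Q₀ hper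
  classical
  obtain ⟨j₁, hj₁⟩ := hfl
  obtain ⟨i₁, hi₁⟩ := exists_isLongSide hz₀ hj₁
  -- Maximal length forces the other neighbour `j` to be fat: were it flat, the common side would
  -- not be its long side by `hlong`, and its own long side would be longer still.
  obtain ⟨⟨j', i'⟩, hc, hmax⟩ := (Finset.univ.filter (IsLongSide z₀)).exists_max_image len
    ⟨(j₁, i₁), by simpa using hi₁⟩
  rw [Finset.mem_filter] at hc
  replace hc := hc.2
  obtain ⟨⟨j, i⟩, hji⟩ : ∃ c, K.pairing (j', i') = c := ⟨_, rfl⟩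
  have hij : K.pairing (j, i) = (j', i') := by rw [← hji, K.involutive]
  have hj' : IsFlat z₀ j' := hc.1
  have hj : ¬ IsFlat z₀ j := by
    intro hj
    obtain ⟨b, hb⟩ := exists_isLongSide hz₀ hj
    have hbi : i ≠ b := by
      rintro rfl
      exact hlong _ hc (hji ▸ hb)
    have h1 := hQ₀.norm_lt_of_isLongSide hz₀ (T j) (i := b) (by rw [hT]; exact hb) hbi
    rw [hlen, hlen, hT] at h1
    have h2 := hmax (j, b) (by simpa using hb)
    rw [← hlenp (j', i'), hji] at h2
    linarith
  have hne : j ≠ j' := fun h => hj (h ▸ hj')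
  obtain ⟨K', τ, F⟩ := exists_isFlip hij hne
  have hjpos : 0 < (z₀ j).im := lt_of_le_of_ne (him j) (Ne.symm hj)
  obtain ⟨⟨r, hr, hr'⟩, ⟨r₁, hr₁, hr₁'⟩⟩ := hc.exists_pos hz₀
  -- At both ends of the diagonal, a fat corner is joined to a flat one of angle zero, whose modulus
  -- is a positive real; so both new triangles are fat.
  have h1 : 0 < (cornerModulus z₀ (j, i) * cornerModulus z₀ (j', i' + 1)).im := by
    dsimp only at hr₁'
    rw [hr₁', Complex.im_mul_ofReal]
    exact mul_pos (cornerModulus_im_pos hz₀ _ hjpos) hr₁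
  have h2 : 0 < (cornerModulus z₀ (j', i') * cornerModulus z₀ (j, i + 1)).im := by
    rw [hr', Complex.im_ofReal_mul]
    exact mul_pos hr (cornerModulus_im_pos hz₀ _ hjpos)
  have hΘ : ∀ y, F.homeomorph (p y) = (F.homeomorph ∘ p) y := fun _ => rfl
  have hΘ' : ∀ y, F.inverse.homeomorph ((F.homeomorph ∘ p) y) = p y := fun y => F.inverse_map (p y)
  have hp' := hp.comp_homeomorph F.homeomorph
  have hfat : ∀ a, (a = j ∨ a = j') → 0 < (F.moduli z₀ a).im := by
    rintro a (rfl | rfl)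
    · rw [IsFlip.moduli, if_pos rfl]
      exact fromCorner_im_pos _ h1
    · rw [IsFlip.moduli, if_neg hne.symm, if_pos rfl]
      exact fromCorner_im_pos _ h2
  have hother : ∀ a, a ≠ j → a ≠ j' → F.moduli z₀ a = z₀ a := by
    intro a ha ha'
    rw [IsFlip.moduli, if_neg ha, if_neg ha']
  have hz₀' : Nondegenerate (F.moduli z₀) := by
    intro a
    by_cases ha : a = j ∨ a = j'
    · have := hfat a ha
      exact ⟨fun h0 => by simp [h0] at this, fun h0 => by simp [h0] at this⟩
    · push Not at ha
      rw [hother a ha.1 ha.2]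
      exact hz₀ a
  have him' : ∀ a, 0 ≤ (F.moduli z₀ a).im := by
    intro a
    by_cases ha : a = j ∨ a = j'
    · exact (hfat a ha).le
    · push Not at ha
      rw [hother a ha.1 ha.2]
      exact him a
  -- The flat triangles left are not touched by the flip, so every long side after it was one
  -- before.
  have hlongτ : ∀ c, IsLongSide (F.moduli z₀) (τ c) → IsLongSide z₀ c := by
    intro c h
    have ha : (τ c).1 ≠ j := fun ha => (hfat _ (Or.inl ha)).ne' h.1
    have ha' : (τ c).1 ≠ j' := fun ha => (hfat _ (Or.inr ha)).ne' h.1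
    have hcc : τ c = c := τ.injective (F.fix _ ha ha')
    rw [hcc] at h ha ha'
    exact (isLongSide_congr (hother _ ha ha')).1 h
  have hlong' : ∀ c, IsLongSide (F.moduli z₀) c → ¬ IsLongSide (F.moduli z₀) (K'.pairing c) := by
    intro c h h'
    obtain ⟨c, rfl⟩ := τ.surjective c
    rw [F.compat] at h'
    exact hlong c (hlongτ _ h) (hlongτ _ h')
  have hcount : {a | IsFlat (F.moduli z₀) a}.ncard < N := by
    rw [← hN]
    refine ncard_lt_ncard ?_ (toFinite _)
    refine ⟨fun a ha => ?_, fun hsub => (hfat j' (Or.inr rfl)).ne' (hsub hj')⟩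
    have h3 : a ≠ j := fun h => (hfat a (Or.inl h)).ne' ha
    have h4 : a ≠ j' := fun h => (hfat a (Or.inr h)).ne' ha
    change (F.moduli z₀ a).im = 0 at ha
    rwa [hother a h3 h4] at ha
  -- The flipped triangulation has fewer flat triangles, and the same `Q₀`, with the same periods,
  -- is a placement for it.
  have key := ih _ hcount hp' (by rw [F.ncard_vtx, hcard]) hz₀' him'
    (F.isPlacement hp hp' hΘ hz₀ h1 h2 hQ₀) hlong' rfl
  have hc1 := Complex.continuous_im.continuousAt.comp
    ((continuousAt_cornerModulus hz₀ (j, i)).mul (continuousAt_cornerModulus hz₀ (j', i' + 1)))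
  have hc2 := Complex.continuous_im.continuousAt.comp
    ((continuousAt_cornerModulus hz₀ (j', i')).mul (continuousAt_cornerModulus hz₀ (j, i + 1)))
  filter_upwards [eventually_nondegenerate hz₀, hc1.eventually (lt_mem_nhds h1),
    hc2.eventually (lt_mem_nhds h2), (F.continuousAt_moduli hz₀ h1 h2).eventually key]
    with z hz h1z h2z hkey Q hQ
  obtain ⟨D, hD⟩ := hkey Q (F.isPlacement hp hp' hΘ hz h1z h2z hQ)
  refine ⟨D, hD.isLocalHomeomorph, ?_, ?_, ?_⟩
  · intro t b
    obtain ⟨t', b', h⟩ := F.exists_vertex hp' hΘ t b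
    rw [← h, hD.apply_vertex]
  · intro t b hb s
    -- The flipped diagonal is a long side, hence not a polygon side; polygon sides are still sides
    -- after the flip.
    have n1 : (t.idx, b) ≠ (j, i) := fun h => hb.2 (by rw [h, hij]; exact hc)
    have n2 : (t.idx, b) ≠ (j', i') := fun h => hb.1 (by rw [h]; exact hc)
    obtain ⟨t', ht', h3⟩ := exists_side_lift hp' F.homeomorph hΘ (F.homeomorph_side n1 n2) rfl
    obtain ⟨h4, h5⟩ := vertex_eq_of_side h3
    rw [← h3, hD.apply_side, h4, h5]
    rw [ht']
    refine ⟨fun h => hb.1 (hlongτ _ h), fun h => hb.2 (hlongτ _ ?_)⟩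
    rw [← F.compat]
    exact h
  · intro a b m k h
    refine hD.equivariant a b m k fun t' b' => ?_
    obtain ⟨t, c, h3⟩ := F.inverse.exists_vertex hp hΘ' t' b'
    rw [← h3, h]

end TriangulatedSurface

/-! ## Developing maps -/

section DevelopingMap

variable {X T : Type*} [TopologicalSpace X] [TopologicalSpace T] {S : Submonoid ℂ} {p : X → T}
  {D D' : X → ℂ}

/-- `D` is open, so its values near `x` fill a neighbourhood of `D x`, and two points of it
determine an affine map. -/
theorem IsLocalHomeomorph.affine_unique (hD : IsLocalHomeomorph D) {x : X} {a a' b b' : ℂ}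
    (h : ∀ᶠ y in 𝓝 x, a * D y + b = a' * D y + b') : a = a' ∧ b = b' := by
  have h1 : ∀ᶠ w in 𝓝 (D x), a * w + b = a' * w + b' := by
    rw [← hD.map_nhds_eq x]
    exact h
  have h2 : a * D x + b = a' * D x + b' := h1.self_of_nhds
  obtain ⟨w, hw, hne⟩ := ((h1.filter_mono nhdsWithin_le_nhds).and
    (self_mem_nhdsWithin : {D x}ᶜ ∈ 𝓝[≠] (D x))).exists
  have h3 : a = a' := by
    refine mul_right_cancel₀ (sub_ne_zero.2 hne) ?_
    linear_combination hw - h2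
  subst h3
  exact ⟨rfl, add_left_cancel h2⟩

/-- The chart `e` is, locally, the composition of a branch of `D` with an affine map. -/
def IsAffineChart (S : Submonoid ℂ) (p : X → T) (D : X → ℂ) (e : OpenPartialHomeomorph T ℂ) : Prop :=
  ∀ x, p x ∈ e.source → ∃ a ∈ S, ∃ b : ℂ, ∀ᶠ y in 𝓝 x, e (p y) = a * D y + b

/-- `D` is a developing map. -/
def GeometricStructure.Develops {G : StructureGroupoid ℂ} (s : GeometricStructure G T) (p : X → T)
    (D : X → ℂ) : Prop :=
  ∀ x, ∃ e ∈ s.charts, p x ∈ e.source ∧ ∀ᶠ y in 𝓝 x, D y = e (p y)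

theorem IsAffineChart.symm_trans_mem (hp : IsLocalHomeomorph p) (hsurj : Function.Surjective p)
    (hS : ∀ a ∈ S, a ≠ 0 ∧ a⁻¹ ∈ S) {e e' : OpenPartialHomeomorph T ℂ} (he : IsAffineChart S p D e)
    (he' : IsAffineChart S p D e') : e.symm.trans e' ∈ (affinePregroupoid S).groupoid := by
  have key : ∀ {e e' : OpenPartialHomeomorph T ℂ}, IsAffineChart S p D e → IsAffineChart S p D e' →
      ∀ w ∈ (e.symm.trans e').source, ∃ a ∈ S, ∃ b : ℂ, ∀ᶠ y in 𝓝 w, (e.symm.trans e') y = a * y + b := by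
    intro e e' he he' w hw
    rw [OpenPartialHomeomorph.trans_source, OpenPartialHomeomorph.symm_source] at hw
    obtain ⟨x, hx⟩ := hsurj (e.symm w)
    have hs : p x ∈ e.source := hx ▸ e.map_target hw.1
    have hs' : p x ∈ e'.source := hx ▸ hw.2
    obtain ⟨a, ha, b, h⟩ := he x hs
    obtain ⟨a', ha', b', h'⟩ := he' x hs'
    obtain ⟨ha0, hai⟩ := hS a ha
    refine ⟨a' * a⁻¹, S.mul_mem ha' hai, b' - a' * a⁻¹ * b, ?_⟩
    have hw' : w = e (p x) := by rw [hx, e.right_inv hw.1]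
    rw [hw', ← e.map_nhds_eq hs, ← hp.map_nhds_eq x, eventually_map, eventually_map]
    filter_upwards [h, h', hp.continuous.continuousAt.eventually (e.open_source.mem_nhds hs)]
      with y hy hy' hys
    rw [OpenPartialHomeomorph.coe_trans, Function.comp_apply, e.left_inv hys, hy, hy']
    field_simp
    ring
  rw [mem_groupoid_of_pregroupoid]
  refine ⟨key he he', ?_⟩
  have h := key he' he
  rw [← OpenPartialHomeomorph.symm_source, OpenPartialHomeomorph.trans_symm_eq_symm_trans_symm,
    OpenPartialHomeomorph.symm_symm]
  exact h

theorem GeometricStructure.Develops.isAffineChart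
    {s : GeometricStructure (affinePregroupoid S).groupoid T} (hp : Continuous p)
    (h : s.Develops p D) {e : OpenPartialHomeomorph T ℂ} (he : e ∈ s.charts) :
    IsAffineChart S p D e := by
  intro x hx
  obtain ⟨e', he', hx', hD⟩ := h x
  let _ := s.chartedSpace
  have _ := s.hasGroupoid
  have hmem : e'.symm.trans e ∈ (affinePregroupoid S).groupoid :=
    StructureGroupoid.compatible_of_mem_maximalAtlas he' he
  rw [mem_groupoid_of_pregroupoid] at hmem
  obtain ⟨a, ha, b, hab⟩ := hmem.1 (e' (p x)) (by
    rw [OpenPartialHomeomorph.trans_source, OpenPartialHomeomorph.symm_source]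
    exact ⟨e'.map_source hx', by rw [mem_preimage, e'.left_inv hx']; exact hx⟩)
  refine ⟨a, ha, b, ?_⟩
  rw [← e'.map_nhds_eq hx', eventually_map] at hab
  filter_upwards [hp.continuousAt.eventually hab, hD,
    hp.continuousAt.eventually (e'.open_source.mem_nhds hx')] with y h1 h2 h3
  rw [OpenPartialHomeomorph.coe_trans, Function.comp_apply, e'.left_inv h3] at h1
  rw [h1, h2]

/-- The charts are exactly the maps that are affine in terms of `D`: a structure is determined by
any one of its developing maps. -/
theorem GeometricStructure.Develops.mem_charts_iff
    {s : GeometricStructure (affinePregroupoid S).groupoid T} (hp : IsLocalHomeomorph p)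
    (hsurj : Function.Surjective p) (hS : ∀ a ∈ S, a ≠ 0 ∧ a⁻¹ ∈ S)
    (h : s.Develops p D) {e : OpenPartialHomeomorph T ℂ} :
    e ∈ s.charts ↔ IsAffineChart S p D e := by
  refine ⟨h.isAffineChart hp.continuous, fun he => ?_⟩
  let _ := s.chartedSpace
  have _ := s.hasGroupoid
  change e ∈ (affinePregroupoid S).groupoid.maximalAtlas T
  rw [mem_maximalAtlas_iff]
  intro e' he'
  have h' : IsAffineChart S p D e' :=
    h.isAffineChart hp.continuous (StructureGroupoid.subset_maximalAtlas _ he')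
  exact ⟨he.symm_trans_mem hp hsurj hS h', h'.symm_trans_mem hp hsurj hS he⟩

theorem GeometricStructure.Develops.isLocalHomeomorph {G : StructureGroupoid ℂ}
    {s : GeometricStructure G T} (hp : IsLocalHomeomorph p) (h : s.Develops p D) :
    IsLocalHomeomorph D := by
  refine IsLocalHomeomorph.mk _ fun x => ?_
  obtain ⟨e, -, hx, hD⟩ := h x
  obtain ⟨P, hP, hPp⟩ := hp x
  obtain ⟨V, hV, hVo, hxV⟩ := eventually_nhds_iff.1 hD
  refine ⟨(P.trans e).restrOpen V hVo, ⟨⟨hP, ?_⟩, hxV⟩, fun y hy => ?_⟩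
  · change P x ∈ e.source
    rwa [← hPp]
  · rw [hV y hy.2, hPp]
    rfl

/-- An equivariant local homeomorphism is a developing map. -/
theorem exists_develops (hp : IsLocalHomeomorph p) (hsurj : Function.Surjective p)
    (hS : ∀ a ∈ S, a ≠ 0 ∧ a⁻¹ ∈ S) (hD : IsLocalHomeomorph D)
    (hdeck : ∀ x x', p x = p x' → ∃ f : X → X, Continuous f ∧ f x = x' ∧ (∀ y, p (f y) = p y) ∧
      ∃ a ∈ S, ∃ b, ∀ y, D (f y) = a * D y + b) :
    ∃ s : GeometricStructure (affinePregroupoid S).groupoid T, s.Develops p D := by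
  have hex : ∀ x : X, ∃ e : OpenPartialHomeomorph T ℂ, IsAffineChart S p D e ∧ p x ∈ e.source ∧
      ∀ᶠ y in 𝓝 x, D y = e (p y) := by
    intro x
    obtain ⟨P, hP, hPp⟩ := hp x
    obtain ⟨E, hE, hED⟩ := hD x
    refine ⟨P.symm.trans E, ?_, ?_, ?_⟩
    · intro x' hx'
      rw [OpenPartialHomeomorph.trans_source, OpenPartialHomeomorph.symm_source] at hx'
      set u := P.symm (p x') with hu
      have hus : u ∈ P.source := P.map_target hx'.1
      have hpu : p u = p x' := (congrFun hPp u).trans (P.right_inv hx'.1)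
      -- A deck transformation moves `x'` into the domain of the chosen branch of `p⁻¹`, at the cost
      -- of an affine change of `D`.
      obtain ⟨f, hf, hfx, hpf, a, ha, b, hab⟩ := hdeck x' u hpu.symm
      refine ⟨a, ha, b, ?_⟩
      have : ∀ᶠ y in 𝓝 x', f y ∈ P.source :=
        hf.continuousAt.eventually (P.open_source.mem_nhds (hfx ▸ hus))
      filter_upwards [this] with y hy
      rw [OpenPartialHomeomorph.coe_trans, Function.comp_apply, ← hpf, hPp, P.left_inv hy, ← hED, hab]
    · rw [OpenPartialHomeomorph.trans_source, OpenPartialHomeomorph.symm_source, hPp]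
      exact ⟨P.map_source hP, by rw [mem_preimage, P.left_inv hP]; exact hE⟩
    · filter_upwards [P.open_source.mem_nhds hP] with y hy
      rw [OpenPartialHomeomorph.coe_trans, Function.comp_apply, hPp, P.left_inv hy, hED]
  have hex' : ∀ q : T, ∃ e : OpenPartialHomeomorph T ℂ, IsAffineChart S p D e ∧ q ∈ e.source := by
    intro q
    obtain ⟨x, rfl⟩ := hsurj q
    obtain ⟨e, h1, h2, -⟩ := hex x
    exact ⟨e, h1, h2⟩
  choose c hc1 hc2 using hex'
  let cs : ChartedSpace ℂ T :=
    { atlas := {e | IsAffineChart S p D e}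
      chartAt := c
      mem_chart_source := hc2
      chart_mem_atlas := hc1 }
  have hg : HasGroupoid T (affinePregroupoid S).groupoid :=
    ⟨fun he he' => IsAffineChart.symm_trans_mem hp hsurj hS he he'⟩
  refine ⟨⟨cs, hg⟩, fun x => ?_⟩
  obtain ⟨e, h1, h2, h3⟩ := hex x
  exact ⟨e, StructureGroupoid.subset_maximalAtlas _ h1, h2, h3⟩

/-- Developing maps are unique up to affine maps. -/
theorem GeometricStructure.Develops.exists_affine [PreconnectedSpace X] [Nonempty X]
    {s : GeometricStructure (affinePregroupoid S).groupoid T} (hp : IsLocalHomeomorph p)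
    (h : s.Develops p D) (h' : s.Develops p D') : ∃ a ∈ S, ∃ b, ∀ x, D' x = a * D x + b := by
  have hloc : ∀ x, ∃ q : ℂ × ℂ, q.1 ∈ S ∧ ∀ᶠ y in 𝓝 x, D' y = q.1 * D y + q.2 := by
    intro x
    obtain ⟨e, he, hx, hD'⟩ := h' x
    obtain ⟨a, ha, b, hab⟩ := h.isAffineChart hp.continuous he x hx
    refine ⟨(a, b), ha, ?_⟩
    filter_upwards [hD', hab] with y h1 h2
    rw [h1, h2]
  choose q hqS hq using hloc
  have hconst : ∀ x x', q x = q x' := by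
    have : IsLocallyConstant q := by
      refine (IsLocallyConstant.iff_eventually_eq q).2 fun x => ?_
      filter_upwards [(hq x).eventually_nhds] with y hy
      have := (h.isLocalHomeomorph hp).affine_unique (x := y) (a := (q y).1) (b := (q y).2)
        (a' := (q x).1) (b' := (q x).2) (by
          filter_upwards [hq y, hy] with w h1 h2
          rw [← h1, ← h2])
      exact Prod.ext this.1 this.2
    exact this.apply_eq_of_preconnectedSpace
  obtain ⟨x₀⟩ := ‹Nonempty X›
  refine ⟨(q x₀).1, hqS x₀, (q x₀).2, fun x => ?_⟩
  rw [hconst x₀ x]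
  exact (hq x).self_of_nhds

/-- If a structure is compatible with a Euclidean structure, then its holonomy is unitary. -/
theorem norm_eq_one_of_compatible [PreconnectedSpace X] [Nonempty X]
    {s : SimilarityStructure T} (hp : IsLocalHomeomorph p) (h : s.Develops p D) (hc : s.CompatibleWithEuclidean)
    {f : X → X} (hf : Continuous f) (hpf : ∀ y, p (f y) = p y) {a b : ℂ}
    (hab : ∀ y, D (f y) = a * D y + b) : ‖a‖ = 1 := by
  obtain ⟨ε, hε⟩ := hc
  have hD := h.isLocalHomeomorph hp
  have hloc : ∀ x, ∃ e ∈ ε.charts, p x ∈ e.source ∧ ∃ q : ℂ × ℂ, q.1 ≠ 0 ∧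
      ∀ᶠ y in 𝓝 x, e (p y) = q.1 * D y + q.2 := by
    intro x
    let _ := ε.chartedSpace
    have _ := ε.hasGroupoid
    have he : chartAt ℂ (p x) ∈ ε.charts := StructureGroupoid.chart_mem_maximalAtlas _ _
    obtain ⟨a, ha, b, h1⟩ := h.isAffineChart hp.continuous (hε he) x (mem_chart_source ℂ (p x))
    exact ⟨_, he, mem_chart_source ℂ (p x), (a, b), nonZeroDivisors.ne_zero ha, h1⟩
  choose e he hx q hq0 hq using hloc
  -- Changes of Euclidean charts have linear part of modulus `1`, so the scale of a Euclidean chart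
  -- relative to `D` is the same for all charts, and by connectedness at all points.
  have key : ∀ {e₁ e₂ : OpenPartialHomeomorph T ℂ}, e₁ ∈ ε.charts → e₂ ∈ ε.charts →
      ∀ {x : X}, p x ∈ e₁.source → p x ∈ e₂.source → ∀ {c d c' d' : ℂ},
      (∀ᶠ y in 𝓝 x, e₁ (p y) = c * D y + d) → (∀ᶠ y in 𝓝 x, e₂ (p y) = c' * D y + d') →
      ‖c'‖ = ‖c‖ := by
    intro e₁ e₂ he₁ he₂ x hx₁ hx₂ c d c' d' h₁ h₂
    let _ := ε.chartedSpace
    have _ := ε.hasGroupoid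
    have hmem : e₁.symm.trans e₂ ∈ euclideanGroupoid :=
      StructureGroupoid.compatible_of_mem_maximalAtlas he₁ he₂
    rw [euclideanGroupoid, mem_groupoid_of_pregroupoid] at hmem
    obtain ⟨u, hu, v, huv⟩ := hmem.1 (e₁ (p x)) (by
      rw [OpenPartialHomeomorph.trans_source, OpenPartialHomeomorph.symm_source]
      exact ⟨e₁.map_source hx₁, by rw [mem_preimage, e₁.left_inv hx₁]; exact hx₂⟩)
    rw [← e₁.map_nhds_eq hx₁, eventually_map] at huv
    have := hD.affine_unique (x := x) (a := c') (b := d') (a' := u * c) (b' := u * d + v) (by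
      filter_upwards [hp.continuous.continuousAt.eventually huv, h₁, h₂,
        hp.continuous.continuousAt.eventually (e₁.open_source.mem_nhds hx₁)] with y g1 g2 g3 g4
      rw [OpenPartialHomeomorph.coe_trans, Function.comp_apply, e₁.left_inv g4, g2, g3] at g1
      rw [g1]
      ring)
    have hu1 : ‖u‖ = 1 := by simpa [Submonoid.unitSphere] using hu
    rw [this.1, norm_mul, hu1, one_mul]
  have hconst : ∀ x x', ‖(q x).1‖ = ‖(q x').1‖ := by
    have : IsLocallyConstant fun x => ‖(q x).1‖ := by
      refine (IsLocallyConstant.iff_eventually_eq _).2 fun x => ?_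
      filter_upwards [(hq x).eventually_nhds,
        hp.continuous.continuousAt.eventually ((e x).open_source.mem_nhds (hx x))] with y h1 h2
      exact key (he x) (he y) h2 (hx y) h1 (hq y)
    exact this.apply_eq_of_preconnectedSpace
  obtain ⟨x⟩ := ‹Nonempty X›
  -- At `x` and `f x`, which have the same image in `T`, the scales relative to `D` differ by the
  -- factor `‖a‖`.
  have h1 := key (he x) (he (f x)) (hx x) (hpf x ▸ hx (f x)) (hq x)
    (c' := (q (f x)).1 * a) (d' := (q (f x)).1 * b + (q (f x)).2) (by
      filter_upwards [hf.continuousAt.eventually (hq (f x))] with y hy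
      rw [hpf, hab] at hy
      rw [hy]
      ring)
  rw [norm_mul, hconst (f x) x] at h1
  exact mul_left_cancel₀ (norm_ne_zero_iff.2 (hq0 x)) (h1.trans (mul_one _).symm)

/-- If the holonomy is unitary, then a structure is compatible with a Euclidean structure. -/
theorem compatible_of_unitary {s : SimilarityStructure T} (hp : IsLocalHomeomorph p)
    (hsurj : Function.Surjective p) (h : s.Develops p D)
    (hdeck : ∀ x x', p x = p x' → ∃ f : X → X, Continuous f ∧ f x = x' ∧ (∀ y, p (f y) = p y) ∧
      ∃ a ∈ Submonoid.unitSphere ℂ, ∃ b, ∀ y, D (f y) = a * D y + b) :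
    s.CompatibleWithEuclidean := by
  have hS : ∀ a ∈ Submonoid.unitSphere ℂ, a ≠ 0 ∧ a⁻¹ ∈ Submonoid.unitSphere ℂ := by
    intro a ha
    have ha1 : ‖a‖ = 1 := by simpa [Submonoid.unitSphere] using ha
    exact ⟨fun h0 => by simp [h0] at ha1, by simp [Submonoid.unitSphere, ha1]⟩
  -- The same `D` develops a Euclidean structure, whose charts are affine in `D` and so belong to
  -- `s`.
  obtain ⟨ε, hε⟩ := exists_develops hp hsurj hS (h.isLocalHomeomorph hp) hdeck
  refine ⟨ε, fun e he => ?_⟩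
  refine (h.mem_charts_iff hp hsurj fun a ha => ?_).2 fun x hx => ?_
  · have := nonZeroDivisors.ne_zero ha
    exact ⟨this, mem_nonZeroDivisors_of_ne_zero (inv_ne_zero this)⟩
  · obtain ⟨a, ha, b, hab⟩ := hε.isAffineChart hp.continuous he x hx
    exact ⟨a, mem_nonZeroDivisors_of_ne_zero (hS a ha).1, b, hab⟩

theorem nonZeroDivisors_complex (a : ℂ) (ha : a ∈ nonZeroDivisors ℂ) :
    a ≠ 0 ∧ a⁻¹ ∈ nonZeroDivisors ℂ := by
  have := nonZeroDivisors.ne_zero ha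
  exact ⟨this, mem_nonZeroDivisors_of_ne_zero (inv_ne_zero this)⟩

/-- An affine map composed with a developing map is a developing map. -/
theorem GeometricStructure.Develops.affine {s : SimilarityStructure T} (hp : IsLocalHomeomorph p)
    (hsurj : Function.Surjective p) (h : s.Develops p D) {a : ℂ} (ha : a ≠ 0) (b : ℂ) :
    s.Develops p fun x => a * D x + b := by
  intro x
  obtain ⟨e, he, hx, hD⟩ := h x
  let A : ℂ ≃ₜ ℂ := (Homeomorph.mulLeft₀ a ha).trans (Homeomorph.addRight b)
  refine ⟨e.transHomeomorph A, ?_, hx, ?_⟩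
  · refine (h.mem_charts_iff hp hsurj nonZeroDivisors_complex).2 fun y hy => ?_
    obtain ⟨c, hc, d, hcd⟩ := h.isAffineChart hp.continuous he y hy
    refine ⟨a * c, mul_mem (mem_nonZeroDivisors_of_ne_zero ha) hc, a * d + b, ?_⟩
    filter_upwards [hcd] with w hw
    change a * e (p w) + b = _
    rw [hw]
    ring
  · filter_upwards [hD] with y hy
    rw [hy]
    rfl

theorem GeometricStructure.Develops.comp {Y : Type*} [TopologicalSpace Y] {G : StructureGroupoid ℂ}
    {s : GeometricStructure G T} (h : s.Develops p D) {φ : Y → X} (hφ : Continuous φ) :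
    s.Develops (p ∘ φ) (D ∘ φ) := by
  intro y
  obtain ⟨e, he, hx, hD⟩ := h (φ y)
  exact ⟨e, he, hx, hφ.continuousAt.eventually hD⟩

end DevelopingMap

/-- Two structures are isotopic if their developing maps correspond to each other. -/
theorem isotopic_of_comp_eq {T : Type*} [TopologicalSpace T] {p : ℝ × ℝ → T}
    {D D' : ℝ × ℝ → ℂ} (hp : IsCoveringMap p) (hsurj : Function.Surjective p)
    (hfib : ∀ x y, p x = p y ↔ ∃ m k : ℤ, y = x + intVec m k)
    {s s' : SimilarityStructure T} (h : s.Develops p D) (h' : s'.Develops p D')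
    (φ : (ℝ × ℝ) ≃ₜ (ℝ × ℝ)) (hφ : CommutesWithIntTranslations φ) (hD : ∀ x, D' (φ x) = D x) :
    s.Isotopic p s' := by
  have hiff : ∀ x y, p (φ x) = p (φ y) ↔ p x = p y := by
    intro x y
    rw [hfib, hfib]
    refine exists_congr fun m => exists_congr fun k => ?_
    rw [← hφ, φ.injective.eq_iff]
  let pc : C(ℝ × ℝ, T) := ⟨p, hp.continuous⟩
  let pc' : C(ℝ × ℝ, T) := ⟨p ∘ φ, hp.continuous.comp φ.continuous⟩
  have hq : IsQuotientMap pc := hp.isQuotientMap hsurj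
  have hq' : IsQuotientMap pc' := (hp.isQuotientMap hsurj).comp φ.isQuotientMap
  have l1 : Function.FactorsThrough pc' pc := fun x y hxy => (hiff x y).2 hxy
  have l2 : Function.FactorsThrough pc pc' := fun x y hxy => (hiff x y).1 hxy
  have hF : ∀ x, hq.lift pc' l1 (p x) = p (φ x) :=
    fun x => DFunLike.congr_fun (hq.lift_comp pc' l1) x
  have hG : ∀ x, hq'.lift pc l2 (p (φ x)) = p x :=
    fun x => DFunLike.congr_fun (hq'.lift_comp pc l2) x
  let F : T ≃ₜ T :=
    { toFun := hq.lift pc' l1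
      invFun := hq'.lift pc l2
      left_inv := fun q => by
        obtain ⟨x, rfl⟩ := hsurj q
        rw [hF, hG]
      right_inv := fun q => by
        obtain ⟨x, rfl⟩ := hsurj q
        obtain ⟨x, rfl⟩ := φ.surjective x
        rw [hG, hF]
      continuous_toFun := ContinuousMap.continuous _
      continuous_invFun := ContinuousMap.continuous _ }
  replace hF : ∀ x, F (p x) = p (φ x) := hF
  refine ⟨F, φ, hφ, hF, fun e he => ?_⟩
  refine (h.mem_charts_iff hp.isLocalHomeomorph hsurj nonZeroDivisors_complex).2 fun x hx => ?_
  obtain ⟨a, ha, b, hab⟩ := h'.isAffineChart hp.continuous he (φ x) (by rw [← hF]; exact hx)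
  refine ⟨a, ha, b, ?_⟩
  filter_upwards [φ.continuous.continuousAt.eventually hab] with y hy
  change e (F (p y)) = _
  rw [hF, hy, hD]

/-! ## Quasiperiodic local homeomorphisms of the plane -/

theorem periodic_of_generators {Y : Type*} {E : ℝ × ℝ → Y} (h1 : ∀ x, E (x + intVec 1 0) = E x)
    (h2 : ∀ x, E (x + intVec 0 1) = E x) (x : ℝ × ℝ) (m k : ℤ) : E (x + intVec m k) = E x := by
  have e1 : ∀ (m : ℤ) x, E (x + intVec m 0) = E x := by
    intro m
    induction m with
    | zero => intro x; congr 1; simp [intVec]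
    | succ m ih =>
      intro x
      rw [← ih x, ← h1 (x + intVec m 0)]
      congr 1
      simp [intVec, add_assoc]
    | pred m ih =>
      intro x
      rw [← h1 (x + intVec (-m - 1) 0), ← ih x]
      congr 1
      simp [intVec, add_assoc]
  have e2 : ∀ (k : ℤ) x, E (x + intVec 0 k) = E x := by
    intro k
    induction k with
    | zero => intro x; congr 1; simp [intVec]
    | succ k ih =>
      intro x
      rw [← ih x, ← h2 (x + intVec 0 k)]
      congr 1
      simp [intVec, add_assoc]
    | pred k ih =>
      intro x
      rw [← h2 (x + intVec 0 (-k - 1)), ← ih x]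
      congr 1
      simp [intVec, add_assoc]
  rw [← e1 m x, ← e2 k (x + intVec m 0)]
  congr 1
  simp [intVec, add_assoc]

/-- The unit square. -/
def unitSquare : Set (ℝ × ℝ) := Icc 0 1 ×ˢ Icc 0 1

theorem isCompact_unitSquare : IsCompact unitSquare := isCompact_Icc.prod isCompact_Icc

theorem exists_add_mem_unitSquare (x : ℝ × ℝ) : ∃ m k : ℤ, x + intVec m k ∈ unitSquare := by
  refine ⟨-⌊x.1⌋, -⌊x.2⌋, ⟨?_, ?_⟩, ?_, ?_⟩
  · have := Int.floor_le x.1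
    simpa [intVec] using this
  · have := (Int.lt_floor_add_one x.1).le
    simp only [intVec, Prod.fst_add]
    push_cast
    linarith
  · have := Int.floor_le x.2
    simpa [intVec] using this
  · have := (Int.lt_floor_add_one x.2).le
    simp only [intVec, Prod.snd_add]
    push_cast
    linarith

theorem exists_norm_le_of_periodic {E : ℝ × ℝ → ℂ} (hE : Continuous E)
    (h : ∀ x m k, E (x + intVec m k) = E x) : ∃ C, ∀ x, ‖E x‖ ≤ C := by
  obtain ⟨C, hC⟩ := (isCompact_unitSquare.image hE).isBounded.exists_norm_le
  refine ⟨C, fun x => ?_⟩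
  obtain ⟨m, k, hx⟩ := exists_add_mem_unitSquare x
  rw [← h x m k]
  exact hC _ (mem_image_of_mem E hx)

/-- The linear isomorphism with given values at the basis vectors. -/
theorem exists_linear {u v : ℂ} (h : LinearIndependent ℝ ![u, v]) :
    ∃ A : (ℝ × ℝ) ≃L[ℝ] ℂ, ∀ x, A x = x.1 * u + x.2 * v := by
  let f : (ℝ × ℝ) →ₗ[ℝ] ℂ := (LinearMap.toSpanSingleton ℝ ℂ u).coprod (LinearMap.toSpanSingleton ℝ ℂ v)
  have hf : ∀ x, f x = x.1 * u + x.2 * v := fun x => by simp [f]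
  have hinj : Function.Injective f := by
    rw [injective_iff_map_eq_zero]
    intro x hx
    rw [LinearIndependent.pair_iff] at h
    have := h x.1 x.2 (by rw [← hx, hf]; simp)
    exact Prod.ext this.1 this.2
  refine ⟨(LinearEquiv.ofInjectiveOfFinrankEq f hinj (by simp)).toContinuousLinearEquiv, fun x => ?_⟩
  exact hf x

theorem linearIndependent_of_im_div_ne {u v : ℂ} (h : (v / u).im ≠ 0) :
    LinearIndependent ℝ ![u, v] := by
  rw [LinearIndependent.pair_iff]
  intro s t hst
  have hu : u ≠ 0 := fun hu => h (by simp [hu])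
  have h1 : (s : ℂ) + t * (v / u) = 0 := by
    have : (s : ℂ) * u + t * v = 0 := by simpa using hst
    field_simp
    linear_combination this
  have h2 := congrArg Complex.im h1
  simp only [Complex.add_im, Complex.ofReal_im, Complex.im_ofReal_mul, zero_add,
    Complex.zero_im, mul_eq_zero, h, or_false] at h2
  subst h2
  simpa using h1

theorem im_div_ne_of_linearIndependent {u v : ℂ} (h : LinearIndependent ℝ ![u, v]) :
    (v / u).im ≠ 0 := by
  intro h0
  have hu : u ≠ 0 := h.ne_zero 0
  rw [LinearIndependent.pair_iff] at h
  have h1 : v / u = ((v / u).re : ℝ) := Complex.ext rfl (by simpa using h0)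
  have h2 : v = (v / u).re * u := by rw [← h1]; field_simp
  have := h (v / u).re (-1) (by
    simp only [Complex.real_smul]
    push_cast
    rw [← h2]
    ring)
  norm_num at this

/-- Subtracting the linear isomorphism with the same periods leaves a periodic, hence bounded,
function; so `L` is proper. A proper local homeomorphism has finite fibres and is a covering, and a
covering of the simply connected `ℂ` by a connected space is a homeomorphism. -/
theorem exists_homeomorph_of_quasiperiodic {u v : ℂ} (huv : LinearIndependent ℝ ![u, v])
    {L : ℝ × ℝ → ℂ} (hL : IsLocalHomeomorph L)
    (h : ∀ x m k, L (x + intVec m k) = L x + m * u + k * v) :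
    ∃ Φ : (ℝ × ℝ) ≃ₜ ℂ, ∀ x, Φ x = L x := by
  obtain ⟨A, hA⟩ := exists_linear huv
  obtain ⟨C, hC⟩ := exists_norm_le_of_periodic (E := fun x => L x - A x)
    (hL.continuous.sub A.continuous) fun x m k => by
      rw [h, hA, hA]
      simp only [intVec, Prod.fst_add, Prod.snd_add]
      push_cast
      ring
  have hproper : Tendsto L (cocompact _) (cocompact _) := by
    rw [← Metric.cobounded_eq_cocompact (α := ℂ), ← tendsto_norm_atTop_iff_cobounded]
    have hA' : Tendsto (fun x => ‖A x‖ - C) (cocompact (ℝ × ℝ)) atTop :=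
      tendsto_atTop_add_const_right _ _
        ((tendsto_norm_cocompact_atTop (E := ℂ)).comp A.toHomeomorph.isClosedEmbedding.tendsto_cocompact)
    refine tendsto_atTop_mono (fun x => ?_) hA'
    have h1 := hC x
    have h2 := norm_sub_norm_le (A x) (L x)
    rw [norm_sub_rev] at h2
    linarith
  have hP : IsProperMap L := isProperMap_iff_tendsto_cocompact.2 ⟨hL.continuous, hproper⟩
  have hfin : ∀ w, (L ⁻¹' {w}).Finite := by
    intro w
    have hc : IsCompact (L ⁻¹' {w}) := hP.isCompact_preimage isCompact_singleton
    have _ : Subsingleton (L '' (L ⁻¹' {w})) :=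
      (subsingleton_singleton.anti (image_preimage_subset L {w})).coe_sort
    have hon : IsLocalHomeomorphOn L (L ⁻¹' {w}) := fun x _ => hL x
    have _ : DiscreteTopology (L ⁻¹' {w}) :=
      IsLocalHomeomorphOn.discreteTopology_of_image (f := L) (s := L ⁻¹' {w}) hon
    exact hc.finite ⟨inferInstance⟩
  have hcov : IsCoveringMap L := by
    rw [isCoveringMap_iff_isCoveringMapOn_univ]
    exact hP.isClosedMap.isCoveringMapOn_of_isLocalHomeomorphOn (fun w _ => hfin w)
      (fun x _ => hL x)
  obtain ⟨s, ⟨hs0, hs⟩, -⟩ := hcov.existsUnique_continuousMap_lifts (ContinuousMap.id ℂ) (L 0)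
    (0 : ℝ × ℝ) rfl
  have hs' : ∀ w, L (s w) = w := fun w => congrFun hs w
  have hs'' : (s ∘ L : ℝ × ℝ → ℝ × ℝ) = id := by
    refine hcov.eq_of_comp_eq (s.continuous.comp hL.continuous) continuous_id ?_ 0 hs0
    funext x
    exact hs' (L x)
  exact ⟨⟨⟨L, s, fun x => congrFun hs'' x, hs'⟩, hL.continuous, s.continuous⟩, fun x => rfl⟩

/-! ### The polygons are finite, and a maximum principle holds on unions of them. -/

namespace TriangulatedSurface

variable {n : ℕ} {K : TriangulatedSurface n} {p : ℝ × ℝ → K.Space}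

/-- The neighbour of the flat triangle `j` along its longest side is `j'`. -/
def LongStep (K : TriangulatedSurface n) (z₀ : Fin n → ℂ) (j j' : Fin n) : Prop :=
  ∃ i i', K.pairing (j, i) = (j', i') ∧ IsLongSide z₀ (j, i)

variable {z₀ : Fin n → ℂ}

theorem LongNeighbour.adj (hp : K.IsTorusCovering p) {t t' : K.LiftedTriangle p}
    (h : K.LongNeighbour p z₀ t t') : ∃ i i', Adj t t' i i' ∧ IsLongSide z₀ (t.idx, i) := by
  obtain ⟨i, i', h1, h2, h3, -⟩ := h
  exact ⟨i, i', adj_of_glued hp h1 (Glued.vertex_left _ _) h3, h2⟩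

theorem Adj.longNeighbour {t t' : K.LiftedTriangle p} {i i' : Fin 3} (h : Adj t t' i i')
    (hl : IsLongSide z₀ (t.idx, i)) : K.LongNeighbour p z₀ t t' :=
  ⟨i, i', h.1, hl, h.vertex_left, h.vertex_right⟩

theorem LongNeighbour.longStep {t t' : K.LiftedTriangle p} (h : K.LongNeighbour p z₀ t t') :
    K.LongStep z₀ t.idx t'.idx := by
  obtain ⟨i, i', h1, h2, -⟩ := h
  exact ⟨i, i', h1, h2⟩

theorem LongNeighbour.isFlat {t t' : K.LiftedTriangle p} (h : K.LongNeighbour p z₀ t t') :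
    IsFlat z₀ t.idx := by
  obtain ⟨i, i', h1, h2, -⟩ := h
  exact h2.1

theorem isLongSide_unique (hp : K.IsTorusCovering p) (hz₀ : Nondegenerate z₀) {Q : ℝ × ℝ → ℂ}
    (hQ : K.IsPlacement p z₀ Q) {j : Fin n} {i i' : Fin 3} (h : IsLongSide z₀ (j, i))
    (h' : IsLongSide z₀ (j, i')) : i = i' := by
  obtain ⟨t, rfl⟩ := LiftedTriangle.exists_idx hp j
  by_contra hne
  exact lt_asymm (hQ.norm_lt_of_isLongSide hz₀ t h (Ne.symm hne))
    (hQ.norm_lt_of_isLongSide hz₀ t h' hne)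

theorem LongNeighbour.rightUnique (hp : K.IsTorusCovering p) (hz₀ : Nondegenerate z₀)
    {Q : ℝ × ℝ → ℂ} (hQ : K.IsPlacement p z₀ Q) : Relator.RightUnique (K.LongNeighbour p z₀) := by
  intro t t' t'' h h'
  obtain ⟨i, i', h1, h2⟩ := h.adj hp
  obtain ⟨b, b', h3, h4⟩ := h'.adj hp
  obtain rfl := isLongSide_unique hp hz₀ hQ h2 h4
  exact (h1.unique hp h3).1

/-- A step between flat triangles crosses a side that is not the longest one of the second triangle,
so the length of the longest side strictly increases. -/
theorem longStep_transGen_irrefl (hp : K.IsTorusCovering p) (hz₀ : Nondegenerate z₀)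
    {Q : ℝ × ℝ → ℂ} (hQ : K.IsPlacement p z₀ Q) {per : ℤ → ℤ → ℂ}
    (hper : ∀ x m k, Q (x + intVec m k) = Q x + per m k)
    (hlong : ∀ c, IsLongSide z₀ c → ¬ IsLongSide z₀ (K.pairing c)) (j : Fin n) :
    ¬ Relation.TransGen (K.LongStep z₀) j j := by
  obtain ⟨len, hlen, hlenp⟩ := exists_sideLength hp Q hper
  have step : ∀ j j', K.LongStep z₀ j j' → ∀ i i', IsLongSide z₀ (j, i) → IsLongSide z₀ (j', i') →
      len (j, i) < len (j', i') := by
    rintro j j' ⟨a, a', h1, h2⟩ i i' hi hi'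
    obtain rfl := isLongSide_unique hp hz₀ hQ h2 hi
    obtain ⟨t, rfl⟩ := LiftedTriangle.exists_idx hp j'
    have hne : a' ≠ i' := by
      rintro rfl
      exact hlong _ h2 (h1 ▸ hi')
    have := hQ.norm_lt_of_isLongSide hz₀ t hi' hne
    rwa [hlen, hlen, ← h1, hlenp] at this
  have key : ∀ j j', Relation.TransGen (K.LongStep z₀) j j' → IsFlat z₀ j' → IsFlat z₀ j ∧
      ∀ i i', IsLongSide z₀ (j, i) → IsLongSide z₀ (j', i') → len (j, i) < len (j', i') := by
    intro j j' h
    induction h with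
    | single h =>
      obtain ⟨i, i', h1, h2⟩ := id h
      exact fun _ => ⟨h2.1, step _ _ h⟩
    | tail _ h ih =>
      obtain ⟨a, a', h1, h2⟩ := id h
      intro hf
      refine ⟨(ih h2.1).1, fun i i' hi hi' => ?_⟩
      exact ((ih h2.1).2 i a hi h2).trans (step _ _ h _ _ h2 hi')
  intro h
  obtain ⟨j', ⟨i, i', -, h2⟩, -⟩ := Relation.TransGen.head'_iff.1 h
  have := (key j j h h2.1).2 i i h2 h2
  exact lt_irrefl _ this

/-- Both directions are needed: one to reach the fat triangle of a polygon from any of its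
triangles, the other to exhaust the polygon from its fat triangle. -/
theorem longStep_wf (hp : K.IsTorusCovering p) (hz₀ : Nondegenerate z₀)
    {Q : ℝ × ℝ → ℂ} (hQ : K.IsPlacement p z₀ Q) {per : ℤ → ℤ → ℂ}
    (hper : ∀ x m k, Q (x + intVec m k) = Q x + per m k)
    (hlong : ∀ c, IsLongSide z₀ c → ¬ IsLongSide z₀ (K.pairing c)) :
    WellFounded (K.LongStep z₀) ∧ WellFounded (Function.swap (K.LongStep z₀)) := by
  have hir := longStep_transGen_irrefl hp hz₀ hQ hper hlong
  have _ : Std.Irrefl (Relation.TransGen (K.LongStep z₀)) := ⟨hir⟩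
  have _ : Std.Irrefl (Function.swap (Relation.TransGen (K.LongStep z₀))) := ⟨hir⟩
  have _ : IsTrans _ (Function.swap (Relation.TransGen (K.LongStep z₀))) :=
    ⟨fun _ _ _ h h' => Relation.TransGen.trans h' h⟩
  exact ⟨Subrelation.wf (fun h => Relation.TransGen.single h)
      (Finite.wellFounded_of_trans_of_irrefl (Relation.TransGen (K.LongStep z₀))),
    Subrelation.wf (r := Function.swap (Relation.TransGen (K.LongStep z₀)))
      (fun {a b} h => Relation.TransGen.single (r := K.LongStep z₀) (a := b) (b := a) h)
      (Finite.wellFounded_of_trans_of_irrefl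
        (Function.swap (Relation.TransGen (K.LongStep z₀))))⟩

/-- A lifted triangle has at most one neighbour along its long side, and following these neighbours
ends at a fat triangle. The polygon is the tree of triangles leading there; it branches finitely and
has bounded depth, because steps between indices are well founded. -/
theorem finite_samePolygon (hp : K.IsTorusCovering p) (hz₀ : Nondegenerate z₀)
    {Q : ℝ × ℝ → ℂ} (hQ : K.IsPlacement p z₀ Q) {per : ℤ → ℤ → ℂ}
    (hper : ∀ x m k, Q (x + intVec m k) = Q x + per m k)
    (hlong : ∀ c, IsLongSide z₀ c → ¬ IsLongSide z₀ (K.pairing c)) (t : K.LiftedTriangle p) :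
    {t' | K.SamePolygon p z₀ t' t}.Finite := by
  obtain ⟨wf, wf'⟩ := longStep_wf hp hz₀ hQ hper hlong
  have huniq := LongNeighbour.rightUnique hp hz₀ hQ
  have hfin : ∀ (j : Fin n) (r : K.LiftedTriangle p), r.idx = j →
      {t | Relation.ReflTransGen (K.LongNeighbour p z₀) t r}.Finite := by
    intro j
    induction j using wf.induction with
    | _ j ih =>
    rintro r rfl
    have hA : {a | K.LongNeighbour p z₀ a r}.Finite := by
      choose T I hTI using exists_adj hp r
      refine (finite_range T).subset fun a ha => ?_
      obtain ⟨i, i', h1, -⟩ := LongNeighbour.adj hp ha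
      exact ⟨i', ((hTI i').unique hp h1.symm).1⟩
    refine ((finite_singleton r).union (hA.biUnion fun a ha => ih a.idx ha.longStep a rfl)).subset ?_
    intro t ht
    rcases Relation.ReflTransGen.cases_tail ht with h | ⟨a, h1, h2⟩
    · exact Or.inl h.symm
    · exact Or.inr (mem_biUnion (x := a) h2 h1)
  have hroot : ∀ (j : Fin n) (t : K.LiftedTriangle p), t.idx = j →
      ∃ r, ¬ IsFlat z₀ r.idx ∧ Relation.ReflTransGen (K.LongNeighbour p z₀) t r := by
    intro j
    induction j using wf'.induction with
    | _ j ih =>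
    rintro t rfl
    by_cases hf : IsFlat z₀ t.idx
    · obtain ⟨i, hi⟩ := exists_isLongSide hz₀ hf
      obtain ⟨t', i', h⟩ := exists_adj hp t i
      have hl := h.longNeighbour hi
      obtain ⟨r, h1, h2⟩ := ih t'.idx hl.longStep t' rfl
      exact ⟨r, h1, h2.head hl⟩
    · exact ⟨t, hf, Relation.ReflTransGen.refl⟩
  have hsame : ∀ a b, K.SamePolygon p z₀ a b → ∀ r, ¬ IsFlat z₀ r.idx →
      (Relation.ReflTransGen (K.LongNeighbour p z₀) a r ↔
        Relation.ReflTransGen (K.LongNeighbour p z₀) b r) := by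
    intro a b h r hr
    induction h with
    | rel a b h =>
      refine ⟨fun h' => ?_, fun h' => h'.head h⟩
      rcases Relation.ReflTransGen.cases_head h' with rfl | ⟨c, h1, h2⟩
      · exact absurd h.isFlat hr
      · rwa [huniq h h1]
    | refl => rfl
    | symm a b _ ih => exact ih.symm
    | trans a b c _ _ ih ih' => exact ih.trans ih'
  obtain ⟨r, hr, htr⟩ := hroot _ t rfl
  exact (hfin _ r rfl).subset fun t' ht' => (hsame t' t ht' r hr).2 htr

/-- A finite union of polygons covering a given bounded set. -/
theorem exists_finite_saturated (hp : K.IsTorusCovering p) (hz₀ : Nondegenerate z₀)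
    {Q : ℝ × ℝ → ℂ} (hQ : K.IsPlacement p z₀ Q) {per : ℤ → ℤ → ℂ}
    (hper : ∀ x m k, Q (x + intVec m k) = Q x + per m k)
    (hlong : ∀ c, IsLongSide z₀ c → ¬ IsLongSide z₀ (K.pairing c)) {B : Set (ℝ × ℝ)}
    (hB : Bornology.IsBounded B) :
    ∃ F : Set (K.LiftedTriangle p), F.Finite ∧ (∀ t t', K.SamePolygon p z₀ t t' → t' ∈ F → t ∈ F) ∧
      ∀ t : K.LiftedTriangle p, (range t.map ∩ B).Nonempty → t ∈ F := by
  refine ⟨⋃ t ∈ {t : K.LiftedTriangle p | (range t.map ∩ B).Nonempty},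
    {t' | K.SamePolygon p z₀ t' t}, (LiftedTriangle.finite_meet hp hB).biUnion fun t _ =>
      finite_samePolygon hp hz₀ hQ hper hlong t, ?_, ?_⟩
  · intro t t' h ht'
    obtain ⟨a, ha, h'⟩ := mem_iUnion₂.1 ht'
    exact mem_iUnion₂.2 ⟨a, ha, Relation.EqvGen.trans _ _ _ h h'⟩
  · intro t ht
    exact mem_iUnion₂.2 ⟨t, ht, Relation.EqvGen.refl _⟩

theorem Adj.map_eq {t t' : K.LiftedTriangle p} {i i' : Fin 3} (h : Adj t t' i i')
    {x x' : stdSimplex ℝ (Fin 3)} (hg : Glued i i' x x') : t.map x = t'.map x' := h.2 _ _ hg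

/-- A frontier point of a union of polygons lies on a side of one of them. -/
theorem exists_polygonSide_of_notMem_nhds (hp : K.IsTorusCovering p)
    {F : Set (K.LiftedTriangle p)} (hF : ∀ t t', K.SamePolygon p z₀ t t' → t' ∈ F → t ∈ F)
    {y : ℝ × ℝ} (hy : y ∈ ⋃ t ∈ F, range t.map) (hy' : (⋃ t ∈ F, range t.map) ∉ 𝓝 y) :
    ∃ t ∈ F, ∃ i, K.IsPolygonSide z₀ (t.idx, i) ∧ ∃ x, x (i + 2) = 0 ∧ t.map x = y := by
  obtain ⟨t, ht, x, rfl⟩ := mem_iUnion₂.1 hy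
  obtain ⟨t', ht', x', hx'⟩ : ∃ t' ∉ F, t.map x ∈ range t'.map := by
    by_contra! h
    refine hy' ?_
    filter_upwards [LiftedTriangle.eventually_mem hp (t.map x)] with y' hy''
    obtain ⟨a, b, rfl⟩ := LiftedTriangle.exists_eq_map hp y'
    refine mem_iUnion₂.2 ⟨a, ?_, b, rfl⟩
    by_contra ha
    exact h a ha (hy'' a ⟨b, rfl⟩)
  have hch := chain_of_map_eq hp hx'.symm
  -- On the chain from `t` in `F` to `t'` outside `F`, the side by which it first leaves `F` is a
  -- polygon side, since `F` is a union of polygons.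
  have key : ∀ b : K.LiftedTriangle p × stdSimplex ℝ (Fin 3), Relation.ReflTransGen
      (fun a b : K.LiftedTriangle p × stdSimplex ℝ (Fin 3) =>
        ∃ i i', Adj a.1 b.1 i i' ∧ Glued i i' a.2 b.2) (t, x) b → b.1.map b.2 = t.map x ∧
      (b.1 ∈ F ∨ ∃ t ∈ F, ∃ i, K.IsPolygonSide z₀ (t.idx, i) ∧ ∃ x', x' (i + 2) = 0 ∧
        t.map x' = b.1.map b.2) := by
    intro b hb
    induction hb with
    | refl => exact ⟨rfl, Or.inl ht⟩
    | @tail b c _ hbc ih =>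
      obtain ⟨i, i', h1, h2⟩ := hbc
      have h3 := h1.map_eq h2
      refine ⟨h3 ▸ ih.1, ?_⟩
      rcases ih.2 with hb | h
      · by_cases hc : c.1 ∈ F
        · exact Or.inl hc
        · refine Or.inr ⟨b.1, hb, i, ⟨fun hl => hc ?_, fun hl => hc ?_⟩, b.2, h2.1, h3⟩
          · exact hF _ _ (Relation.EqvGen.symm _ _ (Relation.EqvGen.rel _ _ (h1.longNeighbour hl))) hb
          · rw [h1.1] at hl
            exact hF _ _ (Relation.EqvGen.rel _ _ (h1.symm.longNeighbour hl)) hb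
      · exact Or.inr (h3 ▸ h)
  obtain ⟨h1, h2⟩ := key _ hch
  rcases h2 with h2 | h2
  · exact absurd h2 ht'
  · rwa [h1] at h2

/-- An open map has no interior maximum of `‖D - w‖`. A frontier point lies on a polygon side, which
`D` sends into a segment with ends in the ball of radius `C`. So the vertices control any
development, although it is arbitrary inside the polygons. -/
theorem norm_sub_le_of_isOpenMap (hp : K.IsTorusCovering p) {F : Set (K.LiftedTriangle p)}
    (hfin : F.Finite) (hF : ∀ t t', K.SamePolygon p z₀ t t' → t' ∈ F → t ∈ F) {D : ℝ × ℝ → ℂ}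
    (hD : Continuous D) (hD' : IsOpenMap D)
    (hside : ∀ (t : K.LiftedTriangle p) i, K.IsPolygonSide z₀ (t.idx, i) → ∀ x, x (i + 2) = 0 →
      D (t.map x) ∈ segment ℝ (D (t.vertex i)) (D (t.vertex (i + 1)))) {w : ℂ} {C : ℝ}
    (hC : ∀ t ∈ F, ∀ i, ‖D (t.vertex i) - w‖ ≤ C) :
    ∀ t ∈ F, ∀ x, ‖D (t.map x) - w‖ ≤ C := by
  intro t ht x
  have hcomp : IsCompact (⋃ t ∈ F, range t.map) :=
    hfin.isCompact_biUnion fun t _ => isCompact_range t.map.continuous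
  have hx : t.map x ∈ ⋃ t ∈ F, range t.map := mem_iUnion₂.2 ⟨t, ht, x, rfl⟩
  obtain ⟨y, hy, hmax⟩ := hcomp.exists_isMaxOn ⟨_, hx⟩
    (f := fun y => ‖D y - w‖) (by fun_prop)
  refine (hmax hx).trans ?_
  have hC0 : 0 ≤ C := (norm_nonneg _).trans (hC t ht 0)
  by_cases hint : (⋃ t ∈ F, range t.map) ∈ 𝓝 y
  · by_contra! hlt
    have hpos : 0 < ‖D y - w‖ := hC0.trans_lt hlt
    have h1 : D '' (⋃ t ∈ F, range t.map) ∈ 𝓝 (D y) := hD'.image_mem_nhds hint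
    have h2 : Metric.closedBall w ‖D y - w‖ ∈ 𝓝 (D y) := by
      refine mem_of_superset h1 ?_
      rintro _ ⟨y', hy', rfl⟩
      rw [Metric.mem_closedBall, dist_eq_norm]
      exact hmax hy'
    rw [← mem_interior_iff_mem_nhds] at h2
    rw [interior_closedBall _ hpos.ne', Metric.mem_ball, dist_eq_norm] at h2
    exact lt_irrefl _ h2
  · obtain ⟨a, ha, i, h1, x', h2, rfl⟩ := exists_polygonSide_of_notMem_nhds hp hF hy hint
    have h3 := hside a i h1 x' h2
    have h4 : segment ℝ (D (a.vertex i)) (D (a.vertex (i + 1))) ⊆ Metric.closedBall w C := by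
      refine (convex_closedBall w C).segment_subset ?_ ?_ <;>
        rw [Metric.mem_closedBall, dist_eq_norm] <;> exact hC a ha _
    have := h4 h3
    rwa [Metric.mem_closedBall, dist_eq_norm] at this

end TriangulatedSurface

/-! ### Developing maps with small holonomy and their logarithms. -/

theorem Complex.isLocalHomeomorph_exp : IsLocalHomeomorph Complex.exp :=
  isLocalHomeomorph_iff_isLocalHomeomorphOn_univ.2 <|
    Complex.isCoveringMapOn_exp.isLocalHomeomorphOn.mono fun z _ => Complex.exp_ne_zero z

theorem IsLocalHomeomorph.add_const {X : Type*} [TopologicalSpace X] {D : X → ℂ}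
    (hD : IsLocalHomeomorph D) (c : ℂ) : IsLocalHomeomorph fun x => D x + c :=
  (Homeomorph.addRight c).isLocalHomeomorph.comp hD

/-- A map which is quasiperiodic under the generators of `ℤ²` is quasiperiodic. -/
theorem quasiperiodic_of_generators {L : ℝ × ℝ → ℂ} {u v : ℂ}
    (h1 : ∀ x, L (x + intVec 1 0) = L x + u) (h2 : ∀ x, L (x + intVec 0 1) = L x + v)
    (x : ℝ × ℝ) (m k : ℤ) : L (x + intVec m k) = L x + m * u + k * v := by
  have := periodic_of_generators (E := fun x => L x - (x.1 * u + x.2 * v))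
    (fun x => by
      rw [h1]
      simp only [intVec, Prod.fst_add, Prod.snd_add]
      push_cast
      ring)
    (fun x => by
      rw [h2]
      simp only [intVec, Prod.fst_add, Prod.snd_add]
      push_cast
      ring) x m k
  simp only [intVec, Prod.fst_add, Prod.snd_add] at this
  push_cast at this
  simp only [intVec]
  linear_combination this

theorem holonomy_commute {D : ℝ × ℝ → ℂ} {a b a' b' : ℂ}
    (h1 : ∀ x, D (x + intVec 1 0) = a * D x + b) (h2 : ∀ x, D (x + intVec 0 1) = a' * D x + b') :
    (a' - 1) * b = (a - 1) * b' := by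
  have e : (0 : ℝ × ℝ) + intVec 1 0 + intVec 0 1 = 0 + intVec 0 1 + intVec 1 0 := add_right_comm _ _ _
  have := congrArg D e
  rw [h2, h1, h1, h2] at this
  linear_combination this

/-- The bound obtained is `5/4 * 1/2 + 1/4 = 7/8`. -/
theorem norm_mul_exp_sub_one_lt {a ε : ℂ} (ha : ‖a‖ ≤ 1 / 4) (hε : ‖ε‖ ≤ 1 / 4) :
    ‖(1 + a) * Complex.exp (-ε) - 1‖ < 1 := by
  have h1 := Complex.norm_exp_sub_one_le (x := -ε) (by rw [norm_neg]; linarith)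
  rw [norm_neg] at h1
  have e : (1 + a) * Complex.exp (-ε) - 1 = (1 + a) * (Complex.exp (-ε) - 1) + a := by ring
  have h2 : ‖1 + a‖ ≤ 5 / 4 := (norm_add_le _ _).trans (by rw [norm_one]; linarith)
  rw [e]
  calc _ ≤ ‖1 + a‖ * ‖Complex.exp (-ε) - 1‖ + ‖a‖ := (norm_add_le _ _).trans (by rw [norm_mul])
    _ ≤ 5 / 4 * (2 * (1 / 4)) + 1 / 4 := by gcongr; linarith
    _ < 1 := by norm_num

/-- The logarithm of a developing map with holonomy close to a group of translations. -/
theorem exists_log_developing {D : ℝ × ℝ → ℂ} (hD : IsLocalHomeomorph D) {a b a' b' : ℂ}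
    (h1 : ∀ x, D (x + intVec 1 0) = a * D x + b) (h2 : ∀ x, D (x + intVec 0 1) = a' * D x + b')
    (ha : a ≠ 1) (ha0 : a ≠ 0) (ha0' : a' ≠ 0)
    (hlin : LinearIndependent ℝ ![Complex.log a, Complex.log a'])
    (hsmall : ‖Complex.log a‖ + ‖Complex.log a'‖ ≤ 1 / 4) {w w₀ : ℂ} (hw₀ : w₀ = b / (1 - a))
    (hw : w ≠ w₀) (hsq : ∀ x ∈ unitSquare, ‖D x - w‖ ≤ ‖w - w₀‖ / 4) :
    ∃ L : (ℝ × ℝ) ≃ₜ ℂ, (∀ x, Complex.exp (L x) = D x - w₀) ∧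
      (∀ x m k, L (x + intVec m k) = L x + m * Complex.log a + k * Complex.log a') ∧
      ∀ x, |(L x - (x.1 * Complex.log a + x.2 * Complex.log a') - Complex.log (w - w₀)).im| ≤
        Real.pi / 2 := by
  set u := Complex.log a with hu
  set v := Complex.log a' with hv
  have hexpu : Complex.exp u = a := Complex.exp_log ha0
  have hexpv : Complex.exp v = a' := Complex.exp_log ha0'
  have ha' : 1 - a ≠ 0 := sub_ne_zero.2 ha.symm
  have hb : b = w₀ * (1 - a) := by rw [hw₀]; field_simp
  -- Since the two affine maps commute, the fixed point `w₀` of the first is fixed by the second.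
  have hb' : b' = w₀ * (1 - a') := by
    have := holonomy_commute h1 h2
    rw [hb] at this
    refine mul_left_cancel₀ ha' ?_
    linear_combination this
  have hww : w - w₀ ≠ 0 := sub_ne_zero.2 hw
  -- Dividing `D - w₀` by the exponential of the linear map with periods `u`, `v` makes it periodic.
  -- It is close to `1` on the unit square, hence everywhere, so its principal logarithm is
  -- continuous.
  let E : ℝ × ℝ → ℂ := fun x => (D x - w₀) * Complex.exp (-(x.1 * u + x.2 * v)) / (w - w₀)
  have hEc : Continuous E := by
    have := hD.continuous
    fun_prop
  have hEp := periodic_of_generators (E := E)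
    (fun x => by
      have e : -(((x.1 + 1 : ℝ) : ℂ) * u + ((x.2 + 0 : ℝ) : ℂ) * v) =
        -(x.1 * u + x.2 * v) - u := by push_cast; ring
      simp only [E]
      rw [h1]
      simp only [intVec, Prod.fst_add, Prod.snd_add, Int.cast_one, Int.cast_zero]
      rw [e, Complex.exp_sub, hexpu, hb]
      field_simp
      ring)
    (fun x => by
      have e : -(((x.1 + 0 : ℝ) : ℂ) * u + ((x.2 + 1 : ℝ) : ℂ) * v) =
        -(x.1 * u + x.2 * v) - v := by push_cast; ring
      simp only [E]
      rw [h2]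
      simp only [intVec, Prod.fst_add, Prod.snd_add, Int.cast_one, Int.cast_zero]
      rw [e, Complex.exp_sub, hexpv, hb']
      field_simp
      ring)
  have hE1 : ∀ x, ‖E x - 1‖ < 1 := by
    intro x
    obtain ⟨m, k, hx⟩ := exists_add_mem_unitSquare x
    rw [← hEp x m k]
    generalize x + intVec m k = y at hx
    have e : E y = (1 + (D y - w) / (w - w₀)) * Complex.exp (-(y.1 * u + y.2 * v)) := by
      simp only [E]
      field_simp
      ring
    rw [e]
    refine norm_mul_exp_sub_one_lt ?_ ?_
    · rw [norm_div, div_le_iff₀ (norm_pos_iff.2 hww)]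
      linarith [hsq y hx]
    · obtain ⟨⟨h3, h4⟩, h5, h6⟩ := hx
      calc _ ≤ ‖(y.1 : ℂ) * u‖ + ‖(y.2 : ℂ) * v‖ := norm_add_le _ _
        _ = y.1 * ‖u‖ + y.2 * ‖v‖ := by
          rw [norm_mul, norm_mul, Complex.norm_real, Complex.norm_real, Real.norm_of_nonneg h3,
            Real.norm_of_nonneg h5]
        _ ≤ 1 * ‖u‖ + 1 * ‖v‖ := by gcongr
        _ ≤ 1 / 4 := by linarith
  have hre : ∀ x, 0 < (E x).re := by
    intro x
    have h3 := (abs_lt.1 ((Complex.abs_re_le_norm _).trans_lt (hE1 x))).1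
    rw [Complex.sub_re, Complex.one_re] at h3
    linarith
  let L₀ : ℝ × ℝ → ℂ := fun x => x.1 * u + x.2 * v + Complex.log (w - w₀) + Complex.log (E x)
  have hL₀c : Continuous L₀ := by
    have : Continuous fun x => Complex.log (E x) :=
      hEc.clog fun x => Or.inl (hre x)
    fun_prop
  have hexp : ∀ x, Complex.exp (L₀ x) = D x - w₀ := by
    intro x
    have hne : E x ≠ 0 := fun h => by simpa [h] using hre x
    simp only [L₀]
    rw [Complex.exp_add, Complex.exp_add, Complex.exp_log hww, Complex.exp_log hne]
    simp only [E]
    rw [Complex.exp_neg]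
    field_simp
  have hL₀ : IsLocalHomeomorph L₀ := by
    refine IsLocalHomeomorph.of_comp (g := Complex.exp) ?_ Complex.isLocalHomeomorph_exp hL₀c
    have : Complex.exp ∘ L₀ = fun x => D x + -w₀ := funext fun x => by
      rw [Function.comp_apply, hexp, sub_eq_add_neg]
    rw [this]
    exact hD.add_const _
  have hper : ∀ x m k, L₀ (x + intVec m k) = L₀ x + m * u + k * v := by
    intro x m k
    simp only [L₀, hEp]
    simp only [intVec, Prod.fst_add, Prod.snd_add]
    push_cast
    ring
  obtain ⟨L, hL⟩ := exists_homeomorph_of_quasiperiodic hlin hL₀ hper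
  refine ⟨L, fun x => by rw [hL, hexp], fun x m k => by rw [hL, hL, hper], fun x => ?_⟩
  have e : L x - (x.1 * u + x.2 * v) - Complex.log (w - w₀) = Complex.log (E x) := by
    rw [hL]
    simp only [L₀]
    ring
  rw [e, Complex.log_im]
  exact Complex.abs_arg_le_pi_div_two_iff.2 (hre x).le

/-- Two points close to each other for which the developing map takes the same value agree. -/
theorem eq_of_exp_eq {L : (ℝ × ℝ) ≃ₜ ℂ} {u v c : ℂ}
    (hL : ∀ x, |(L x - (x.1 * u + x.2 * v) - c).im| ≤ Real.pi / 2) {x y : ℝ × ℝ}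
    (hxy : ‖(x.1 - y.1) * u + (x.2 - y.2) * v‖ < Real.pi)
    (h : Complex.exp (L x) = Complex.exp (L y)) : x = y := by
  obtain ⟨N, hN⟩ := Complex.exp_eq_exp_iff_exists_int.1 h
  have h1 := hL x
  have h2 := hL y
  have h3 := (Complex.abs_im_le_norm _).trans_lt hxy
  -- The imaginary part of the left-hand side is smaller in absolute value than `π / 2 + π / 2 + π =
  -- 2π`, so `N = 0`.
  have e : (L x - (x.1 * u + x.2 * v) - c) - (L y - (y.1 * u + y.2 * v) - c) +
      ((x.1 - y.1) * u + (x.2 - y.2) * v) = N * (2 * Real.pi * Complex.I) := by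
    rw [hN]
    ring
  have e' := congrArg Complex.im e
  rw [Complex.add_im, Complex.sub_im] at e'
  have e'' : ((N : ℂ) * (2 * Real.pi * Complex.I)).im = N * (2 * Real.pi) := by simp
  rw [e''] at e'
  rw [abs_le] at h1 h2
  rw [abs_lt] at h3
  have hpi := Real.pi_pos
  have hN0 : N = 0 := by
    by_contra hne
    rcases lt_or_gt_of_ne hne with h | h
    · have : (N : ℝ) ≤ -1 := by exact_mod_cast Int.le_sub_one_of_lt h
      nlinarith
    · have : (1 : ℝ) ≤ N := by exact_mod_cast h
      nlinarith
  rw [hN0] at hN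
  exact L.injective (by simpa using hN)

/-- The affine maps `ζ ↦ a ζ + b` and `ζ ↦ a' ζ + b'` are close to two independent translations:
either they are independent translations, or they have a common fixed point far from `w` (at the
scale `C`), and `a`, `a'` have small independent logarithms (at the scale `R`). -/
structure SmallHolonomy (a b a' b' w : ℂ) (C R : ℝ) : Prop where
  ne_zero : a ≠ 0
  ne_zero' : a' ≠ 0
  small : ‖Complex.log a‖ + ‖Complex.log a'‖ ≤ 1 / 4
  small' : R * (‖Complex.log a‖ + ‖Complex.log a'‖) < Real.pi
  of_eq : a = 1 → a' = 1 ∧ LinearIndependent ℝ ![b, b']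
  of_ne : a ≠ 1 → (Complex.log a' / Complex.log a).im ≠ 0 ∧ w ≠ b / (1 - a) ∧
    C ≤ ‖w - b / (1 - a)‖ / 4

theorem SmallHolonomy.eq_one_iff {a b a' b' w : ℂ} {C R : ℝ} (h : SmallHolonomy a b a' b' w C R) :
    a = 1 ↔ a' = 1 := by
  refine ⟨fun h1 => (h.of_eq h1).1, fun h1 => ?_⟩
  by_contra hne
  have := (h.of_ne hne).1
  rw [h1] at this
  simp at this

/-- `e`, `U`, `V` come before `D`, as they depend on the holonomy alone: the homeomorphisms `L` of
two developments with the same holonomy can therefore be compared. Injectivity at scale `R` will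
show that polygons are embedded. -/
theorem SmallHolonomy.exists_homeomorph {a b a' b' w : ℂ} {C R : ℝ}
    (h : SmallHolonomy a b a' b' w C R) :
    ∃ (e : ℂ → ℂ) (U V : ℂ), (a ≠ 1 → (e = fun ζ => Complex.exp ζ + b / (1 - a)) ∧
      U = Complex.log a ∧ V = Complex.log a') ∧
      ∀ D : ℝ × ℝ → ℂ, IsLocalHomeomorph D → (∀ x, D (x + intVec 1 0) = a * D x + b) →
        (∀ x, D (x + intVec 0 1) = a' * D x + b') → (∀ x ∈ unitSquare, ‖D x - w‖ ≤ C) →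
        ∃ L : (ℝ × ℝ) ≃ₜ ℂ, (∀ x, e (L x) = D x) ∧
          (∀ x m k, L (x + intVec m k) = L x + m * U + k * V) ∧
          ∀ x y, ‖x - y‖ ≤ R → D x = D y → x = y := by
  by_cases ha : a = 1
  · obtain ⟨ha', hlin⟩ := h.of_eq ha
    refine ⟨id, b, b', fun hne => absurd ha hne, fun D hD h1 h2 _ => ?_⟩
    have hper := quasiperiodic_of_generators (L := D) (u := b) (v := b')
      (fun x => by rw [h1, ha, one_mul]) (fun x => by rw [h2, ha', one_mul])
    obtain ⟨L, hL⟩ := exists_homeomorph_of_quasiperiodic hlin hD hper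
    refine ⟨L, fun x => hL x, fun x m k => by rw [hL, hL, hper], fun x y _ hxy => ?_⟩
    rw [← hL, ← hL] at hxy
    exact L.injective hxy
  · obtain ⟨him, hw, hC⟩ := h.of_ne ha
    refine ⟨_, _, _, fun _ => ⟨rfl, rfl, rfl⟩, fun D hD h1 h2 hsq => ?_⟩
    obtain ⟨L, hL1, hL2, hL3⟩ := exists_log_developing hD h1 h2 ha h.ne_zero h.ne_zero'
      (linearIndependent_of_im_div_ne him) h.small rfl hw fun x hx => (hsq x hx).trans hC
    refine ⟨L, fun x => by rw [hL1]; ring, hL2, fun x y hxy hD => ?_⟩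
    refine eq_of_exp_eq hL3 ?_ (by rw [hL1, hL1, hD])
    have e1 : ‖((x.1 : ℂ) - y.1)‖ ≤ R := by
      rw [← Complex.ofReal_sub, Complex.norm_real]
      exact (norm_fst_le (x - y)).trans hxy
    have e2 : ‖((x.2 : ℂ) - y.2)‖ ≤ R := by
      rw [← Complex.ofReal_sub, Complex.norm_real]
      exact (norm_snd_le (x - y)).trans hxy
    calc _ ≤ ‖((x.1 : ℂ) - y.1)‖ * ‖Complex.log a‖ + ‖((x.2 : ℂ) - y.2)‖ * ‖Complex.log a'‖ :=
        (norm_add_le _ _).trans (by rw [norm_mul, norm_mul])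
      _ ≤ R * ‖Complex.log a‖ + R * ‖Complex.log a'‖ := by gcongr
      _ < Real.pi := by rw [← mul_add]; exact h.small'

/-- `log a = (a - 1) g(a)` with `g` continuous at `1` and `g(1) = 1`. This extends the quotient of
logarithms continuously where both vanish. -/
theorem continuousAt_log_dslope : ContinuousAt (dslope Complex.log 1) 1 :=
  continuousAt_dslope_same.2 (Complex.hasDerivAt_log Complex.one_mem_slitPlane).differentiableAt

theorem dslope_log_one : dslope Complex.log 1 1 = 1 := by
  rw [dslope_same, (Complex.hasDerivAt_log Complex.one_mem_slitPlane).deriv, inv_one]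

theorem sub_one_mul_dslope_log (a : ℂ) : (a - 1) * dslope Complex.log 1 a = Complex.log a := by
  have := sub_smul_dslope Complex.log 1 a
  rwa [smul_eq_mul, Complex.log_one, sub_zero] at this

section
variable {Z : Type*} [TopologicalSpace Z] {z₀ : Z} {a b a' b' : Z → ℂ} {ω₁ ω₂ : ℂ}

theorem log_div_log_eq {a b a' b' : ℂ} (hcomm : (a' - 1) * b = (a - 1) * b') (ha : a ≠ 1)
    (hb : b ≠ 0) : Complex.log a' / Complex.log a =
      b' / b * (dslope Complex.log 1 a' / dslope Complex.log 1 a) := by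
  have ha' : a - 1 ≠ 0 := sub_ne_zero.2 ha
  rw [← sub_one_mul_dslope_log a, ← sub_one_mul_dslope_log a']
  have e : a' - 1 = (a - 1) * (b' / b) := by
    field_simp
    exact hcomm
  rw [e, mul_assoc, mul_div_mul_left _ _ ha', mul_div_assoc]

theorem tendsto_ratio (ha : Tendsto a (𝓝 z₀) (𝓝 1)) (hb : Tendsto b (𝓝 z₀) (𝓝 ω₁))
    (ha' : Tendsto a' (𝓝 z₀) (𝓝 1)) (hb' : Tendsto b' (𝓝 z₀) (𝓝 ω₂)) (hω : ω₁ ≠ 0) :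
    Tendsto (fun z => b' z / b z * (dslope Complex.log 1 (a' z) / dslope Complex.log 1 (a z)))
      (𝓝 z₀) (𝓝 (ω₂ / ω₁)) := by
  have h : Tendsto (dslope Complex.log 1) (𝓝 1) (𝓝 1) := by
    have := continuousAt_log_dslope.tendsto
    rwa [dslope_log_one] at this
  have := (hb'.div hb hω).mul ((h.comp ha').div (h.comp ha) one_ne_zero)
  rwa [div_one, mul_one] at this

/-- The logarithms tend to `0`. The fixed point `b / (1 - a)` goes to infinity, as `b` tends to `ω₁
≠ 0`. The ratio of the logarithms and `b' / b` both tend to the nonreal `ω₂ / ω₁`. -/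
theorem eventually_smallHolonomy (hlin : LinearIndependent ℝ ![ω₁, ω₂])
    (ha : Tendsto a (𝓝 z₀) (𝓝 1)) (hb : Tendsto b (𝓝 z₀) (𝓝 ω₁))
    (ha' : Tendsto a' (𝓝 z₀) (𝓝 1)) (hb' : Tendsto b' (𝓝 z₀) (𝓝 ω₂)) (w : ℂ) (C R : ℝ) :
    ∀ᶠ z in 𝓝 z₀, b z ≠ 0 ∧ ‖a z - 1‖ < 1 ∧ ‖a' z - 1‖ < 1 ∧
      ((a' z - 1) * b z = (a z - 1) * b' z → SmallHolonomy (a z) (b z) (a' z) (b' z) w C R) := by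
  have hω : ω₁ ≠ 0 := hlin.ne_zero 0
  have him := im_div_ne_of_linearIndependent hlin
  have hlog : Tendsto Complex.log (𝓝 1) (𝓝 0) := by
    have := (continuousAt_clog Complex.one_mem_slitPlane).tendsto
    rwa [Complex.log_one] at this
  have hsum : Tendsto (fun z => ‖Complex.log (a z)‖ + ‖Complex.log (a' z)‖) (𝓝 z₀) (𝓝 0) := by
    simpa using (hlog.comp ha).norm.add (hlog.comp ha').norm
  have hsum' := hsum.const_mul R
  rw [mul_zero] at hsum'
  have hn : Tendsto (fun z => ‖a z - 1‖) (𝓝 z₀) (𝓝 0) := by simpa using (ha.sub_const 1).norm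
  have hn' : Tendsto (fun z => ‖a' z - 1‖) (𝓝 z₀) (𝓝 0) := by simpa using (ha'.sub_const 1).norm
  -- Once this quantity is negative, the fixed point has norm at least `4 |C| + ‖w‖ + 1`, hence
  -- distance at least `4 |C| + 1` from `w`.
  have hscale : Tendsto (fun z => ‖a z - 1‖ * (4 * |C| + ‖w‖ + 1) - ‖b z‖) (𝓝 z₀) (𝓝 (-‖ω₁‖)) := by
    simpa using (hn.mul_const _).sub hb.norm
  have hρ := (Complex.continuous_im.tendsto _).comp (tendsto_ratio ha hb ha' hb' hω)
  have hq := (Complex.continuous_im.tendsto _).comp (hb'.div hb hω)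
  filter_upwards [hb.eventually_ne hω, hn.eventually (gt_mem_nhds one_pos),
    hn'.eventually (gt_mem_nhds one_pos), hsum.eventually (gt_mem_nhds (by norm_num : (0 : ℝ) < 1 / 4)),
    hsum'.eventually (gt_mem_nhds Real.pi_pos),
    hscale.eventually (gt_mem_nhds (neg_lt_zero.2 (norm_pos_iff.2 hω))),
    hρ.eventually_ne him, hq.eventually_ne him] with z h1 h2 h3 h4 h5 h6 h7 h8
  refine ⟨h1, h2, h3, fun hcomm => ⟨?_, ?_, h4.le, h5, ?_, ?_⟩⟩
  · rintro h
    simp [h] at h2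
  · rintro h
    simp [h] at h3
  · intro h
    refine ⟨?_, linearIndependent_of_im_div_ne h8⟩
    rw [h, sub_self, zero_mul, mul_eq_zero, or_iff_left h1, sub_eq_zero] at hcomm
    exact hcomm
  · intro h
    have hpos : 0 < ‖a z - 1‖ := norm_pos_iff.2 (sub_ne_zero.2 h)
    have h9 : 4 * |C| + ‖w‖ + 1 ≤ ‖b z / (1 - a z)‖ := by
      rw [norm_div, norm_sub_rev 1, le_div_iff₀ hpos]
      linarith
    have h10 : 4 * |C| + 1 ≤ ‖w - b z / (1 - a z)‖ := by
      have := norm_sub_norm_le (b z / (1 - a z)) w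
      rw [norm_sub_rev] at this
      linarith
    refine ⟨?_, fun he => ?_, ?_⟩
    · rw [log_div_log_eq hcomm h h1]
      exact h7
    · rw [he, sub_self, norm_zero] at h10
      linarith [abs_nonneg C]
    · linarith [le_abs_self C]

end

/-! ## The arguments in the consistency equations -/

/-- The sum is a multiple of `2π` of absolute value less than `2π`. -/
theorem sum_arg_eq_zero_of_prod_eq_one {ι : Type*} (s : Finset ι) (r : ι → ℂ)
    (h : ∏ i ∈ s, r i = 1) (hlt : |∑ i ∈ s, (r i).arg| < 2 * Real.pi) :
    ∑ i ∈ s, (r i).arg = 0 := by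
  have h1 : ((∏ i ∈ s, ‖r i‖ : ℝ) : ℂ) * Complex.exp ((∑ i ∈ s, (r i).arg : ℝ) * Complex.I) = 1 := by
    rw [← h]
    push_cast
    rw [Finset.sum_mul, Complex.exp_sum, ← Finset.prod_mul_distrib]
    exact Finset.prod_congr rfl fun i _ => Complex.norm_mul_exp_arg_mul_I _
  have h2 : ∏ i ∈ s, ‖r i‖ = 1 := by rw [← norm_prod, h, norm_one]
  rw [h2, Complex.ofReal_one, one_mul, Complex.exp_eq_one_iff] at h1
  obtain ⟨N, hN⟩ := h1
  have h3 : ∑ i ∈ s, (r i).arg = N * (2 * Real.pi) := by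
    have := congrArg Complex.im hN
    simpa using this
  rw [h3] at hlt ⊢
  have hN0 : N = 0 := by
    rw [abs_mul, abs_of_pos Real.two_pi_pos] at hlt
    have h4 : |(N : ℝ)| < 1 := by
      by_contra! h5
      nlinarith [Real.two_pi_pos]
    exact Int.abs_lt_one_iff.1 (by exact_mod_cast h4)
  rw [hN0, Int.cast_zero, zero_mul]

namespace TriangulatedSurface

variable {n : ℕ} {K : TriangulatedSurface n} {z₀ : Fin n → ℂ}

theorem cornerArg_self (hz₀ : Nondegenerate z₀) (c : Fin n × Fin 3) :
    cornerArg z₀ z₀ c = (cornerModulus z₀ c).arg := by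
  rw [cornerArg, div_self (cornerModulus_ne_zero hz₀ c), Complex.arg_one, add_zero]

theorem continuousAt_cornerArg {z : Fin n → ℂ} (hz : Nondegenerate z) {c : Fin n × Fin 3}
    (h : cornerModulus z c / cornerModulus z₀ c ∈ Complex.slitPlane) :
    ContinuousAt (fun z => cornerArg z₀ z c) z := by
  refine continuousAt_const.add ?_
  exact ContinuousAt.comp (f := fun z => cornerModulus z c / cornerModulus z₀ c)
    (Complex.continuousAt_arg h) ((continuousAt_cornerModulus hz c).div_const _)

theorem tendsto_cornerModulus_div (hz₀ : Nondegenerate z₀) (c : Fin n × Fin 3) :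
    Tendsto (fun z => cornerModulus z c / cornerModulus z₀ c) (𝓝 z₀) (𝓝 1) := by
  have := ((continuousAt_cornerModulus hz₀ c).div_const (cornerModulus z₀ c)).tendsto
  rwa [div_self (cornerModulus_ne_zero hz₀ c)] at this

theorem eventually_mem_slitPlane (hz₀ : Nondegenerate z₀) : ∀ᶠ z in 𝓝 z₀, ∀ c,
    cornerModulus z c / cornerModulus z₀ c ∈ Complex.slitPlane :=
  eventually_all.2 fun c => (tendsto_cornerModulus_div hz₀ c).eventually
    (Complex.isOpen_slitPlane.mem_nhds Complex.one_mem_slitPlane)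

/-- The sum of the arguments differs from `2π` by the arguments of the quotients of the moduli by
those at `z₀`. These have product `1` and tend to `1`. -/
theorem eventually_consistent_iff (hz₀ : Nondegenerate z₀) (hcons : K.ConsistentArg z₀ z₀) :
    ∀ᶠ z in 𝓝 z₀, K.Consistent z ↔ K.ConsistentArg z₀ z := by
  have hev : ∀ᶠ z in 𝓝 z₀, ∀ c, |∑ c' ∈ K.corners c,
      (cornerModulus z c' / cornerModulus z₀ c').arg| < 2 * Real.pi := by
    refine eventually_all.2 fun c => ?_
    have h : ∀ c', Tendsto (fun z => (cornerModulus z c' / cornerModulus z₀ c').arg) (𝓝 z₀) (𝓝 0) := by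
      intro c'
      have := (Complex.continuousAt_arg Complex.one_mem_slitPlane).tendsto.comp
        (tendsto_cornerModulus_div hz₀ c')
      rwa [Complex.arg_one] at this
    have hs := (tendsto_finsetSum (K.corners c) fun c' _ => h c').abs
    rw [Finset.sum_const_zero, abs_zero] at hs
    exact hs.eventually (gt_mem_nhds Real.two_pi_pos)
  filter_upwards [hev] with z hz
  refine ⟨fun h => ⟨h, fun c => ?_⟩, fun h => h.1⟩
  have h1 : ∏ c' ∈ K.corners c, cornerModulus z c' / cornerModulus z₀ c' = 1 := by
    rw [Finset.prod_div_distrib, h c, hcons.1 c, div_one]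
  have h2 := sum_arg_eq_zero_of_prod_eq_one _ _ h1 (hz c)
  have h3 := hcons.2 c
  simp only [cornerArg_self hz₀] at h3
  simp only [cornerArg, Finset.sum_add_distrib, h2, h3, add_zero]

end TriangulatedSurface

theorem affine_eq_of_ne {a b a' b' x y : ℂ} (hxy : x ≠ y) (hx : a * x + b = a' * x + b')
    (hy : a * y + b = a' * y + b') : a = a' ∧ b = b' := by
  have h : (a - a') * (x - y) = 0 := by linear_combination hx - hy
  have ha : a = a' := by
    rcases mul_eq_zero.1 h with h | h
    · exact sub_eq_zero.1 h
    · exact absurd (sub_eq_zero.1 h) hxy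
  subst ha
  exact ⟨rfl, by linear_combination hx⟩

/-! ### Holonomy of placements, and developments. -/

namespace TriangulatedSurface

variable {n : ℕ} {K : TriangulatedSurface n} {p : ℝ × ℝ → K.Space} {z₀ z : Fin n → ℂ}

theorem IsPlacement.exists_period (hp : K.IsTorusCovering p) (hz : Nondegenerate z)
    {Q : ℝ × ℝ → ℂ} (hQ : K.IsPlacement p z Q) (m k : ℤ) :
    ∃ a b : ℂ, a ≠ 0 ∧ ∀ (t : K.LiftedTriangle p) i,
      Q (t.vertex i + intVec m k) = a * Q (t.vertex i) + b :=
  IsPlacement.exists_affine hp hQ (hQ.comp_add hp m k) hz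

/-- The placements with given values at two vertices of a triangle have holonomy depending
continuously on the moduli. -/
theorem exists_period_functions (hp : K.IsTorusCovering p) (hz₀ : Nondegenerate z₀)
    {Q₀ : ℝ × ℝ → ℂ} (hQ₀ : K.IsPlacement p z₀ Q₀) {m k : ℤ} {ω : ℂ}
    (hω : ∀ x, Q₀ (x + intVec m k) = Q₀ x + ω) (t₀ : K.LiftedTriangle p) :
    ∃ a b : (Fin n → ℂ) → ℂ, Tendsto a (𝓝 z₀) (𝓝 1) ∧ Tendsto b (𝓝 z₀) (𝓝 ω) ∧
      ∀ z Q, Nondegenerate z → K.IsPlacement p z Q → Q (t₀.vertex 0) = Q₀ (t₀.vertex 0) →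
        Q (t₀.vertex 1) = Q₀ (t₀.vertex 1) → ∀ (t : K.LiftedTriangle p) i,
          Q (t.vertex i + intVec m k) = a z * Q (t.vertex i) + b z := by
  obtain ⟨P, hPc, hP⟩ := exists_continuousAt_position hp hz₀ t₀ (Q₀ (t₀.vertex 1))
    (Q₀ (t₀.vertex 0)) (t₀.translate hp m k)
  have hne : Q₀ (t₀.vertex 1) - Q₀ (t₀.vertex 0) ≠ 0 := sub_ne_zero.2 (hQ₀ t₀).1
  have h0 : ∀ i, P i z₀ = Q₀ (t₀.vertex i) + ω := fun i => by
    rw [← hP z₀ Q₀ hz₀ hQ₀ rfl rfl i, LiftedTriangle.translate_vertex, hω]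
  -- The linear part is the ratio of the translated edge of `t₀` to the edge itself, whose ends are
  -- fixed by the normalisation.
  let a : (Fin n → ℂ) → ℂ := fun z => (P 1 z - P 0 z) / (Q₀ (t₀.vertex 1) - Q₀ (t₀.vertex 0))
  have ha : Tendsto a (𝓝 z₀) (𝓝 1) := by
    have : ContinuousAt a z₀ := ((hPc 1).sub (hPc 0)).div_const _
    have h1 := this.tendsto
    have h2 : a z₀ = 1 := by
      simp only [a]
      rw [h0, h0, add_sub_add_right_eq_sub, div_self hne]
    rwa [h2] at h1
  refine ⟨a, fun z => P 0 z - a z * Q₀ (t₀.vertex 0), ha, ?_, ?_⟩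
  · have := (hPc 0).tendsto.sub (ha.mul_const (Q₀ (t₀.vertex 0)))
    rwa [h0, one_mul, add_sub_cancel_left] at this
  · intro z Q hz hQ e0 e1 t i
    obtain ⟨α, β, -, h⟩ := hQ.exists_period hp hz m k
    have h3 := h t₀ 0
    have h4 := h t₀ 1
    rw [← LiftedTriangle.translate_vertex hp, hP z Q hz hQ e0 e1] at h3 h4
    rw [e0] at h3
    rw [e1] at h4
    have h5 : a z = α := by
      simp only [a]
      rw [div_eq_iff hne, h3, h4]
      ring
    simp only [h, h5, h3]
    ring

theorem IsPlacement.exists_normalize {Q : ℝ × ℝ → ℂ} (hQ : K.IsPlacement p z Q)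
    (t₀ : K.LiftedTriangle p) {w₀ w₁ : ℂ} (hw : w₁ ≠ w₀) :
    ∃ a b : ℂ, a ≠ 0 ∧ a * Q (t₀.vertex 0) + b = w₀ ∧ a * Q (t₀.vertex 1) + b = w₁ := by
  have h := _root_.sub_ne_zero.2 (hQ t₀).1
  refine ⟨(w₁ - w₀) / (Q (t₀.vertex 1) - Q (t₀.vertex 0)),
    w₀ - (w₁ - w₀) / (Q (t₀.vertex 1) - Q (t₀.vertex 0)) * Q (t₀.vertex 0),
    div_ne_zero (_root_.sub_ne_zero.2 hw) h, by ring, ?_⟩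
  field_simp
  ring

/-- An equivariant local homeomorphism with prescribed shapes of triangles and with straight
polygon sides. -/
structure IsDevelopment (K : TriangulatedSurface n) (p : ℝ × ℝ → K.Space) (z₀ z : Fin n → ℂ)
    (D : ℝ × ℝ → ℂ) : Prop where
  isLocalHomeomorph : IsLocalHomeomorph D
  isPlacement : K.IsPlacement p z D
  mem_segment : ∀ (t : K.LiftedTriangle p) i, K.IsPolygonSide z₀ (t.idx, i) → ∀ x, x (i + 2) = 0 →
    D (t.map x) ∈ segment ℝ (D (t.vertex i)) (D (t.vertex (i + 1)))
  equivariant : ∀ m k : ℤ, ∃ a b : ℂ, a ≠ 0 ∧ ∀ x, D (x + intVec m k) = a * D x + b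

theorem ExtendsPlacement.isDevelopment (hp : K.IsTorusCovering p) (hz : Nondegenerate z)
    {Q D : ℝ × ℝ → ℂ} (hQ : K.IsPlacement p z Q) (h : K.ExtendsPlacement p z₀ Q D) :
    K.IsDevelopment p z₀ z D where
  isLocalHomeomorph := h.isLocalHomeomorph
  isPlacement t := by
    rw [h.apply_vertex, h.apply_vertex, h.apply_vertex]
    exact hQ t
  mem_segment t i hi x hx := by
    obtain ⟨s, rfl⟩ := exists_sidePoint hx
    rw [h.apply_side t i hi, h.apply_vertex, h.apply_vertex]
    exact ⟨1 - s, s, sub_nonneg.2 s.2.2, s.2.1, sub_add_cancel _ _, by simp⟩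
  equivariant m k := by
    obtain ⟨a, b, ha, hab⟩ := hQ.exists_period hp hz m k
    exact ⟨a, b, ha, h.equivariant a b m k hab⟩

theorem IsTorusCovering.isLocalHomeomorph (hp : K.IsTorusCovering p) : IsLocalHomeomorph p :=
  hp.isCoveringMap.isLocalHomeomorph

theorem IsTorusCovering.map_add (hp : K.IsTorusCovering p) (x : ℝ × ℝ) (m k : ℤ) :
    p (x + intVec m k) = p x :=
  ((hp.fibers _ _).2 ⟨m, k, rfl⟩).symm

theorem continuous_add_intVec (m k : ℤ) : Continuous fun x : ℝ × ℝ => x + intVec m k := by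
  fun_prop

/-- Equivariance is not required by `Defines`: it holds because `D` composed with a deck
transformation is another developing map of the same structure. -/
theorem Defines.exists_isDevelopment (hp : K.IsTorusCovering p) {s : SimilarityStructure K.Space}
    (h : K.Defines p z₀ z s) :
    ∃ D, GeometricStructure.Develops s p D ∧ K.IsDevelopment p z₀ z D := by
  obtain ⟨D, h1, h2, h3, -⟩ := h
  have h1' : GeometricStructure.Develops s p D := h1
  refine ⟨D, h1', h1'.isLocalHomeomorph hp.isLocalHomeomorph, h2, fun t i hi x hx => ?_,
    fun m k => ?_⟩
  · rw [← (h3 t i hi).2]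
    exact mem_image_of_mem _ hx
  · have h4 := h1'.comp (continuous_add_intVec m k)
    have h5 : p ∘ (fun x : ℝ × ℝ => x + intVec m k) = p := funext fun x => hp.map_add x m k
    rw [h5] at h4
    obtain ⟨a, ha, b, hab⟩ := h1'.exists_affine hp.isLocalHomeomorph h4
    exact ⟨a, b, (nonZeroDivisors_complex a ha).1, hab⟩

theorem IsDevelopment.affine {D : ℝ × ℝ → ℂ} (h : K.IsDevelopment p z₀ z D) {a : ℂ} (ha : a ≠ 0)
    (b : ℂ) : K.IsDevelopment p z₀ z fun x => a * D x + b where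
  isLocalHomeomorph :=
    ((Homeomorph.mulLeft₀ a ha).isLocalHomeomorph.comp h.isLocalHomeomorph).add_const b
  isPlacement := h.isPlacement.comp_affine ha
  mem_segment t i hi x hx := by
    obtain ⟨r, s, hr, hs, hrs, e⟩ := h.mem_segment t i hi x hx
    refine ⟨r, s, hr, hs, hrs, ?_⟩
    have hrs' : (r : ℂ) + s = 1 := by exact_mod_cast hrs
    rw [← e]
    simp only [Complex.real_smul]
    linear_combination b * hrs'
  equivariant m k := by
    obtain ⟨α, β, hα, hαβ⟩ := h.equivariant m k
    exact ⟨α, a * β + b - α * b, hα, fun x => by rw [hαβ]; ring⟩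

/-- An affine map is known from its values at two distinct points, so the holonomy seen on the
vertices is valid at all points. -/
theorem IsDevelopment.apply_add {D : ℝ × ℝ → ℂ} (h : K.IsDevelopment p z₀ z D)
    (t₀ : K.LiftedTriangle p) {a b : ℂ} {m k : ℤ} (hab : ∀ (t : K.LiftedTriangle p) i,
      D (t.vertex i + intVec m k) = a * D (t.vertex i) + b) (x : ℝ × ℝ) :
    D (x + intVec m k) = a * D x + b := by
  obtain ⟨α, β, -, hαβ⟩ := h.equivariant m k
  obtain ⟨rfl, rfl⟩ := affine_eq_of_ne (h.isPlacement t₀).1 ((hαβ _).symm.trans (hab t₀ 1))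
    ((hαβ _).symm.trans (hab t₀ 0))
  exact hαβ x

theorem LongNeighbour.translate (hp : K.IsTorusCovering p) {t t' : K.LiftedTriangle p}
    (h : K.LongNeighbour p z₀ t t') (m k : ℤ) :
    K.LongNeighbour p z₀ (t.translate hp m k) (t'.translate hp m k) := by
  obtain ⟨i, i', h1, h2, h3, h4⟩ := h
  refine ⟨i, i', h1, h2, ?_, ?_⟩ <;>
    simp only [LiftedTriangle.translate_vertex, h3, h4]

theorem SamePolygon.translate (hp : K.IsTorusCovering p) {t t' : K.LiftedTriangle p}
    (h : K.SamePolygon p z₀ t t') (m k : ℤ) :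
    K.SamePolygon p z₀ (t.translate hp m k) (t'.translate hp m k) := by
  induction h with
  | rel a b h => exact Relation.EqvGen.rel _ _ (h.translate hp m k)
  | refl => exact Relation.EqvGen.refl _
  | symm a b _ ih => exact Relation.EqvGen.symm _ _ ih
  | trans a b c _ _ ih ih' => exact Relation.EqvGen.trans _ _ _ ih ih'

theorem IsDevelopment.norm_sub_le_of_mem_unitSquare (hp : K.IsTorusCovering p)
    {F : Set (K.LiftedTriangle p)} (hfin : F.Finite)
    (hF : ∀ t t', K.SamePolygon p z₀ t t' → t' ∈ F → t ∈ F)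
    (hF' : ∀ t : K.LiftedTriangle p, (range t.map ∩ unitSquare).Nonempty → t ∈ F)
    {D : ℝ × ℝ → ℂ} (h : K.IsDevelopment p z₀ z D) {w : ℂ} {C : ℝ}
    (hC : ∀ t ∈ F, ∀ i, ‖D (t.vertex i) - w‖ ≤ C) (x : ℝ × ℝ) (hx : x ∈ unitSquare) :
    ‖D x - w‖ ≤ C := by
  obtain ⟨t, y, rfl⟩ := LiftedTriangle.exists_eq_map hp x
  exact norm_sub_le_of_isOpenMap hp hfin hF h.isLocalHomeomorph.continuous
    h.isLocalHomeomorph.isOpenMap h.mem_segment hC t (hF' t ⟨_, ⟨y, rfl⟩, hx⟩) y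

/-- A development which is injective at small scale embeds the polygons. -/
theorem IsDevelopment.eq_of_samePolygon (hp : K.IsTorusCovering p)
    {F : Set (K.LiftedTriangle p)} (hF : ∀ t t', K.SamePolygon p z₀ t t' → t' ∈ F → t ∈ F)
    (hF' : ∀ t : K.LiftedTriangle p, (range t.map ∩ unitSquare).Nonempty → t ∈ F)
    {D : ℝ × ℝ → ℂ} (h : K.IsDevelopment p z₀ z D) {R : ℝ}
    (hR : ∀ t ∈ F, ∀ t' ∈ F, ∀ x x', ‖t.map x - t'.map x'‖ ≤ R)
    (hinj : ∀ x y, ‖x - y‖ ≤ R → D x = D y → x = y) {t t' : K.LiftedTriangle p}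
    (htt' : K.SamePolygon p z₀ t t') (x x' : stdSimplex ℝ (Fin 3))
    (hD : D (t.map x) = D (t'.map x')) : t.map x = t'.map x' := by
  -- A deck transformation brings the polygon to the finite family `F`, in which distances are at
  -- most `R`; by equivariance the two values remain equal.
  obtain ⟨m, k, hmk⟩ := exists_add_mem_unitSquare (t'.map x')
  rw [← LiftedTriangle.translate_map hp] at hmk
  have h1 : t'.translate hp m k ∈ F := hF' _ ⟨_, ⟨x', rfl⟩, hmk⟩
  have h2 : t.translate hp m k ∈ F := hF _ _ (htt'.translate hp m k) h1
  obtain ⟨a, b, -, hab⟩ := h.equivariant m k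
  have h3 := hinj _ _ (hR _ h2 _ h1 x x') (by
    rw [LiftedTriangle.translate_map, LiftedTriangle.translate_map, hab, hab, hD])
  rw [LiftedTriangle.translate_map, LiftedTriangle.translate_map] at h3
  exact add_right_cancel h3

theorem ExtendsPlacement.side (hz : Nondegenerate z) {Q D : ℝ × ℝ → ℂ} (hQ : K.IsPlacement p z Q)
    (h : K.ExtendsPlacement p z₀ Q D) (t : K.LiftedTriangle p) (i : Fin 3)
    (hi : K.IsPolygonSide z₀ (t.idx, i)) :
    InjOn (fun x => D (t.map x)) {x | x (i + 2) = 0} ∧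
      (fun x => D (t.map x)) '' {x | x (i + 2) = 0} =
        segment ℝ (D (t.vertex i)) (D (t.vertex (i + 1))) := by
  have hne : Q (t.vertex (i + 1)) - Q (t.vertex i) ≠ 0 := hQ.sub_ne_zero hz t i
  constructor
  · intro x hx y hy hxy
    obtain ⟨s, rfl⟩ := exists_sidePoint hx
    obtain ⟨r, rfl⟩ := exists_sidePoint hy
    simp only [h.apply_side t i hi] at hxy
    push_cast at hxy
    have h1 : ((s : ℝ) - (r : ℝ) : ℂ) * (Q (t.vertex (i + 1)) - Q (t.vertex i)) = 0 := by
      linear_combination hxy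
    have h2 : ((s : ℝ) : ℂ) = (r : ℝ) := sub_eq_zero.1 ((mul_eq_zero.1 h1).resolve_right hne)
    rw [Subtype.ext (Complex.ofReal_injective h2)]
  · rw [h.apply_vertex, h.apply_vertex]
    ext w
    constructor
    · rintro ⟨x, hx, rfl⟩
      obtain ⟨s, rfl⟩ := exists_sidePoint hx
      refine ⟨1 - s, s, sub_nonneg.2 s.2.2, s.2.1, sub_add_cancel _ _, ?_⟩
      simp only [h.apply_side t i hi]
      simp
    · rintro ⟨r, s, hr, hs, hrs, rfl⟩
      refine ⟨sidePoint i ⟨s, hs, by linarith⟩, sidePoint_add_two _ _, ?_⟩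
      simp only [h.apply_side t i hi]
      rw [← eq_sub_of_add_eq hrs]
      simp

end TriangulatedSurface

namespace TriangulatedSurface

variable {n : ℕ} {K : TriangulatedSurface n} {p : ℝ × ℝ → K.Space} {z₀ z : Fin n → ℂ}

theorem eventually_norm_vertex_sub_le (hp : K.IsTorusCovering p) (hz₀ : Nondegenerate z₀)
    {Q₀ : ℝ × ℝ → ℂ} (hQ₀ : K.IsPlacement p z₀ Q₀) (t₀ : K.LiftedTriangle p)
    {F : Set (K.LiftedTriangle p)} (hfin : F.Finite) (w : ℂ) :
    ∃ C : ℝ, ∀ᶠ z in 𝓝 z₀, ∀ Q, Nondegenerate z → K.IsPlacement p z Q →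
      Q (t₀.vertex 0) = Q₀ (t₀.vertex 0) → Q (t₀.vertex 1) = Q₀ (t₀.vertex 1) →
      ∀ t ∈ F, ∀ i, ‖Q (t.vertex i) - w‖ ≤ C := by
  obtain ⟨C, hC⟩ := ((hfin.prod (finite_univ (α := Fin 3))).image
    fun q : K.LiftedTriangle p × Fin 3 => ‖Q₀ (q.1.vertex q.2) - w‖).bddAbove
  -- `C` bounds the finitely many vertices of `F` at `z₀`; the extra `1` leaves room for continuity
  -- in `z`.
  refine ⟨C + 1, ?_⟩
  have key : ∀ t ∈ F, ∀ᶠ z in 𝓝 z₀, ∀ Q, Nondegenerate z → K.IsPlacement p z Q →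
      Q (t₀.vertex 0) = Q₀ (t₀.vertex 0) → Q (t₀.vertex 1) = Q₀ (t₀.vertex 1) →
      ∀ i, ‖Q (t.vertex i) - w‖ ≤ C + 1 := by
    intro t ht
    obtain ⟨P, hPc, hP⟩ := exists_continuousAt_position hp hz₀ t₀ (Q₀ (t₀.vertex 1))
      (Q₀ (t₀.vertex 0)) t
    have h1 : ∀ i, ∀ᶠ z in 𝓝 z₀, ‖P i z - w‖ < C + 1 := by
      intro i
      refine ((hPc i).sub_const w).norm.eventually (gt_mem_nhds ?_)
      rw [← hP z₀ Q₀ hz₀ hQ₀ rfl rfl i]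
      have := hC (mem_image_of_mem _ (show (t, i) ∈ F ×ˢ univ from ⟨ht, mem_univ _⟩))
      exact lt_of_le_of_lt this (lt_add_one C)
    filter_upwards [eventually_all.2 h1] with z hz Q hzn hQ e0 e1 i
    rw [hP z Q hzn hQ e0 e1]
    exact (hz i).le
  have := (eventually_all_finite hfin).2 key
  filter_upwards [this] with z hz Q h1 h2 h3 h4 t ht
  exact hz t ht Q h1 h2 h3 h4

theorem InducesEuclidean.exists_isPlacement (h : K.InducesEuclidean p z₀) :
    ∃ (ω₁ ω₂ : ℂ) (Q : ℝ × ℝ → ℂ), LinearIndependent ℝ ![ω₁, ω₂] ∧ K.IsPlacement p z₀ Q ∧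
      ∀ (x : ℝ × ℝ) (m k : ℤ), Q (x + intVec m k) = Q x + (m * ω₁ + k * ω₂) := by
  obtain ⟨ω₁, ω₂, f, hlin, -, hper, hf⟩ := h
  refine ⟨ω₁, ω₂, f, hlin, fun t => ?_, fun x m k => by rw [hper, add_assoc]⟩
  obtain ⟨a, b, ha, hab⟩ := hf t
  simp only [LiftedTriangle.vertex, hab, stdSimplex.vertex_self,
    stdSimplex.vertex_of_ne (show (1 : Fin 3) ≠ 0 by decide),
    stdSimplex.vertex_of_ne (show (2 : Fin 3) ≠ 0 by decide),
    stdSimplex.vertex_of_ne (show (2 : Fin 3) ≠ 1 by decide),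
    stdSimplex.vertex_of_ne (show (1 : Fin 3) ≠ 2 by decide)]
  constructor
  · intro h
    apply ha
    push_cast at h
    linear_combination h
  · push_cast
    ring

/-- Two flat triangles with a common side lie in one foliated component, so the bigon condition on
inner sides applies. -/
theorem FoliatedByBigons.not_isLongSide_pairing (h : K.FoliatedByBigons z₀) (c : Fin n × Fin 3)
    (hc : IsLongSide z₀ c) : ¬ IsLongSide z₀ (K.pairing c) := by
  intro hc'
  refine (h.bigon c.1 hc.1).long_side c Relation.ReflTransGen.refl ?_ hc hc'
  exact Relation.ReflTransGen.single ⟨hc.1, hc'.1, c.2, (K.pairing c).2, rfl⟩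

/-- The developments with given values at two vertices, and the affine maps
`ζ ↦ a ζ + b`, `ζ ↦ a' ζ + b'` which are their holonomy. -/
structure NormalData (K : TriangulatedSurface n) (p : ℝ × ℝ → K.Space) (z₀ z : Fin n → ℂ)
    (t₀ : K.LiftedTriangle p) (w₀ w₁ a b a' b' : ℂ) (C R : ℝ) (F : Set (K.LiftedTriangle p)) :
    Prop where
  torus : K.IsTorusCovering p
  nondegenerate : Nondegenerate z
  ne : w₁ ≠ w₀
  finite : F.Finite
  saturated : ∀ t t', K.SamePolygon p z₀ t t' → t' ∈ F → t ∈ F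
  covers : ∀ t : K.LiftedTriangle p, (range t.map ∩ unitSquare).Nonempty → t ∈ F
  norm_sub_le : ∀ t ∈ F, ∀ t' ∈ F, ∀ x x', ‖t.map x - t'.map x'‖ ≤ R
  holonomy : ∀ Q, K.IsPlacement p z Q → Q (t₀.vertex 0) = w₀ → Q (t₀.vertex 1) = w₁ →
    ∀ (t : K.LiftedTriangle p) i, Q (t.vertex i + intVec 1 0) = a * Q (t.vertex i) + b
  holonomy' : ∀ Q, K.IsPlacement p z Q → Q (t₀.vertex 0) = w₀ → Q (t₀.vertex 1) = w₁ →
    ∀ (t : K.LiftedTriangle p) i, Q (t.vertex i + intVec 0 1) = a' * Q (t.vertex i) + b'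
  vertex_le : ∀ Q, K.IsPlacement p z Q → Q (t₀.vertex 0) = w₀ → Q (t₀.vertex 1) = w₁ →
    ∀ t ∈ F, ∀ i, ‖Q (t.vertex i) - w₀‖ ≤ C
  small : SmallHolonomy a b a' b' w₀ C R

namespace NormalData

variable {t₀ : K.LiftedTriangle p} {w₀ w₁ a b a' b' : ℂ} {C R : ℝ} {F : Set (K.LiftedTriangle p)}

theorem exists_homeomorph (N : NormalData K p z₀ z t₀ w₀ w₁ a b a' b' C R F) :
    ∃ (e : ℂ → ℂ) (U V : ℂ), (a ≠ 1 → (e = fun ζ => Complex.exp ζ + b / (1 - a)) ∧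
      U = Complex.log a ∧ V = Complex.log a') ∧
      ∀ D, K.IsDevelopment p z₀ z D → D (t₀.vertex 0) = w₀ → D (t₀.vertex 1) = w₁ →
        ∃ L : (ℝ × ℝ) ≃ₜ ℂ, (∀ x, e (L x) = D x) ∧
          (∀ x m k, L (x + intVec m k) = L x + m * U + k * V) ∧
          ∀ x y, ‖x - y‖ ≤ R → D x = D y → x = y := by
  obtain ⟨e, U, V, h, hL⟩ := N.small.exists_homeomorph
  refine ⟨e, U, V, h, fun D hD e0 e1 => hL D hD.isLocalHomeomorph ?_ ?_ ?_⟩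
  · exact hD.apply_add t₀ (N.holonomy D hD.isPlacement e0 e1)
  · exact hD.apply_add t₀ (N.holonomy' D hD.isPlacement e0 e1)
  · exact hD.norm_sub_le_of_mem_unitSquare N.torus N.finite N.saturated N.covers
      (N.vertex_le D hD.isPlacement e0 e1)

theorem hol_eq (N : NormalData K p z₀ z t₀ w₀ w₁ a b a' b' C R F) {Q : ℝ × ℝ → ℂ}
    (hQ : K.IsPlacement p z Q) (e0 : Q (t₀.vertex 0) = w₀) (e1 : Q (t₀.vertex 1) = w₁) :
    (∀ γ, K.IsLoop p 1 0 γ → K.hol z γ = a) ∧ (∀ γ, K.IsLoop p 0 1 γ → K.hol z γ = a') :=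
  ⟨fun _ h => IsPlacement.hol_eq N.torus hQ N.nondegenerate (N.holonomy Q hQ e0 e1) h,
    fun _ h => IsPlacement.hol_eq N.torus hQ N.nondegenerate (N.holonomy' Q hQ e0 e1) h⟩

/-- The equivariance of `D` gives the structure; injectivity of `D` at scale `R`, the size of the
family `F`, gives the embedding of the polygons. -/
theorem exists_defines (N : NormalData K p z₀ z t₀ w₀ w₁ a b a' b' C R F) {Q D : ℝ × ℝ → ℂ}
    (hQ : K.IsPlacement p z Q) (e0 : Q (t₀.vertex 0) = w₀) (e1 : Q (t₀.vertex 1) = w₁)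
    (hD : K.ExtendsPlacement p z₀ Q D) : ∃ s, K.Defines p z₀ z s := by
  have hdev := hD.isDevelopment N.torus N.nondegenerate hQ
  obtain ⟨e, U, V, -, hL⟩ := N.exists_homeomorph
  obtain ⟨-, -, -, hinj⟩ := hL D hdev (by rw [hD.apply_vertex, e0]) (by rw [hD.apply_vertex, e1])
  obtain ⟨s, hs⟩ := exists_develops N.torus.isLocalHomeomorph N.torus.surjective
    nonZeroDivisors_complex hdev.isLocalHomeomorph (fun x x' hxx' => by
      obtain ⟨m, k, rfl⟩ := (N.torus.fibers x x').1 hxx'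
      obtain ⟨α, β, hα, hαβ⟩ := hdev.equivariant m k
      exact ⟨_, continuous_add_intVec m k, rfl, fun y => N.torus.map_add y m k, α,
        mem_nonZeroDivisors_of_ne_zero hα, β, hαβ⟩)
  exact ⟨s, D, hs, hdev.isPlacement, hD.side N.nondegenerate hQ, fun t t' h x x' hxx' =>
    hdev.eq_of_samePolygon N.torus N.saturated N.covers N.norm_sub_le hinj h x x' hxx'⟩

theorem exists_normal_development (N : NormalData K p z₀ z t₀ w₀ w₁ a b a' b' C R F)
    {s : SimilarityStructure K.Space} (hs : K.Defines p z₀ z s) :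
    ∃ D, GeometricStructure.Develops s p D ∧ K.IsDevelopment p z₀ z D ∧
      D (t₀.vertex 0) = w₀ ∧ D (t₀.vertex 1) = w₁ := by
  obtain ⟨D, h1, h2⟩ := hs.exists_isDevelopment N.torus
  obtain ⟨α, β, hα, e0, e1⟩ := h2.isPlacement.exists_normalize t₀ N.ne
  exact ⟨_, h1.affine N.torus.isLocalHomeomorph N.torus.surjective hα β, h2.affine hα β, e0, e1⟩

/-- Normalised at the same two vertices, both developments have the same holonomy, so both are `e`
composed with homeomorphisms `L`, `L'` having the same periods; `L'⁻¹ ∘ L` is the isotopy. -/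
theorem isotopic (N : NormalData K p z₀ z t₀ w₀ w₁ a b a' b' C R F)
    {s s' : SimilarityStructure K.Space} (hs : K.Defines p z₀ z s) (hs' : K.Defines p z₀ z s') :
    s.Isotopic p s' := by
  obtain ⟨e, U, V, -, hL⟩ := N.exists_homeomorph
  obtain ⟨D, h1, h2, h3, h4⟩ := N.exists_normal_development hs
  obtain ⟨D', h1', h2', h3', h4'⟩ := N.exists_normal_development hs'
  obtain ⟨L, hL1, hL2, -⟩ := hL D h2 h3 h4
  obtain ⟨L', hL1', hL2', -⟩ := hL D' h2' h3' h4'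
  refine isotopic_of_comp_eq N.torus.isCoveringMap N.torus.surjective N.torus.fibers h1 h1'
    (L.trans L'.symm) (fun x m k => ?_) fun x => ?_
  · apply L'.injective
    rw [hL2']
    simp only [Homeomorph.trans_apply, Homeomorph.apply_symm_apply]
    exact hL2 x m k
  · rw [← hL1', ← hL1]
    simp only [Homeomorph.trans_apply, Homeomorph.apply_symm_apply]

/-- A compatible Euclidean structure forces `‖a‖ = ‖a'‖ = 1`, so both logarithms are purely
imaginary; for `a ≠ 1` their ratio would be real. If `a = 1`, the holonomy consists of translations.
-/
theorem compatible_iff (N : NormalData K p z₀ z t₀ w₀ w₁ a b a' b' C R F)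
    {s : SimilarityStructure K.Space} (hs : K.Defines p z₀ z s) :
    s.CompatibleWithEuclidean ↔ a = 1 := by
  obtain ⟨D, h1, h2, h3, h4⟩ := N.exists_normal_development hs
  have hl := h2.apply_add t₀ (N.holonomy D h2.isPlacement h3 h4)
  have hm := h2.apply_add t₀ (N.holonomy' D h2.isPlacement h3 h4)
  have hloc := N.torus.isLocalHomeomorph
  constructor
  · intro hc
    have na := norm_eq_one_of_compatible hloc h1 hc (continuous_add_intVec 1 0)
      (fun y => N.torus.map_add y 1 0) hl
    have na' := norm_eq_one_of_compatible hloc h1 hc (continuous_add_intVec 0 1)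
      (fun y => N.torus.map_add y 0 1) hm
    by_contra hne
    refine (N.small.of_ne hne).1 ?_
    have e : ∀ c : ℂ, ‖c‖ = 1 → Complex.log c = (c.arg : ℝ) * Complex.I := fun c hc => by
      apply Complex.ext <;> simp [Complex.log_re, Complex.log_im, hc]
    rw [e a na, e a' na', mul_div_mul_right _ _ Complex.I_ne_zero, ← Complex.ofReal_div,
      Complex.ofReal_im]
  · intro ha
    have ha' := (N.small.of_eq ha).1
    have hper := quasiperiodic_of_generators (L := D) (u := b) (v := b')
      (fun x => by rw [hl, ha, one_mul]) (fun x => by rw [hm, ha', one_mul])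
    refine compatible_of_unitary hloc N.torus.surjective h1 fun x x' hxx' => ?_
    obtain ⟨m, k, rfl⟩ := (N.torus.fibers x x').1 hxx'
    refine ⟨_, continuous_add_intVec m k, rfl, fun y => N.torus.map_add y m k, 1, one_mem _,
      m * b + k * b', fun y => ?_⟩
    rw [hper]
    ring

/-- The linear map `A` has the same periods as `L`, so `L⁻¹ ∘ A` commutes with the lattice and turns
`exp ∘ L` into `exp ∘ A`; the fixed point is removed by a translation. -/
theorem exists_exp_develops (N : NormalData K p z₀ z t₀ w₀ w₁ a b a' b' C R F) (ha : a ≠ 1)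
    {s : SimilarityStructure K.Space} (hs : K.Defines p z₀ z s) :
    ∃ φ : (ℝ × ℝ) ≃ₜ (ℝ × ℝ), CommutesWithIntTranslations φ ∧
      s.IsDevelopingMap (p ∘ φ) fun q =>
        Complex.exp (Complex.log a * q.1 + Complex.log a' * q.2) := by
  obtain ⟨e, U, V, hne, hL⟩ := N.exists_homeomorph
  obtain ⟨rfl, rfl, rfl⟩ := hne ha
  obtain ⟨D, h1, h2, h3, h4⟩ := N.exists_normal_development hs
  obtain ⟨L, hL1, hL2, -⟩ := hL D h2 h3 h4
  obtain ⟨A, hA⟩ := exists_linear (linearIndependent_of_im_div_ne (N.small.of_ne ha).1)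
  let φ : (ℝ × ℝ) ≃ₜ (ℝ × ℝ) := A.toHomeomorph.trans L.symm
  have hφ : ∀ q, L (φ q) = A q := fun q => L.apply_symm_apply _
  refine ⟨φ, fun x m k => ?_, ?_⟩
  · apply L.injective
    rw [hL2, hφ, hφ, hA, hA]
    simp only [intVec, Prod.fst_add, Prod.snd_add]
    push_cast
    ring
  · have h5 := (h1.affine N.torus.isLocalHomeomorph N.torus.surjective one_ne_zero
      (-(b / (1 - a)))).comp φ.continuous
    have h6 : (fun x => 1 * D x + -(b / (1 - a))) ∘ φ = fun q : ℝ × ℝ =>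
        Complex.exp (Complex.log a * q.1 + Complex.log a' * q.2) := by
      funext q
      rw [Function.comp_apply, ← hL1, hφ, hA]
      ring_nf
    rw [h6] at h5
    exact h5

end NormalData

end TriangulatedSurface


/-! ### Assembling the conditions near the given solution. -/

namespace TriangulatedSurface

variable {n : ℕ} {K : TriangulatedSurface n} {p : ℝ × ℝ → K.Space} {z₀ : Fin n → ℂ}

/-- Solutions of the consistency equations close to `z₀` satisfy the conditions of
`NormalData`. -/
theorem exists_eventually_normalData (hp : K.IsTorusCovering p) (hz₀ : Nondegenerate z₀)
    (hnonneg : ∀ j, 0 ≤ (z₀ j).im) (hcons : K.ConsistentArg z₀ z₀)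
    (heucl : K.InducesEuclidean p z₀) (hbigon : K.FoliatedByBigons z₀) (t₀ : K.LiftedTriangle p) :
    ∃ (w₀ w₁ ω₁ ω₂ : ℂ) (a b a' b' : (Fin n → ℂ) → ℂ) (C R : ℝ) (F : Set (K.LiftedTriangle p)),
      LinearIndependent ℝ ![ω₁, ω₂] ∧ Tendsto a (𝓝 z₀) (𝓝 1) ∧ Tendsto b (𝓝 z₀) (𝓝 ω₁) ∧
      Tendsto a' (𝓝 z₀) (𝓝 1) ∧ Tendsto b' (𝓝 z₀) (𝓝 ω₂) ∧
      ∀ᶠ z in 𝓝 z₀, b z ≠ 0 ∧ ‖a z - 1‖ < 1 ∧ ‖a' z - 1‖ < 1 ∧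
        (K.Consistent z → (a' z - 1) * b z = (a z - 1) * b' z ∧
          NormalData K p z₀ z t₀ w₀ w₁ (a z) (b z) (a' z) (b' z) C R F ∧
          ∃ Q D, K.IsPlacement p z Q ∧ Q (t₀.vertex 0) = w₀ ∧ Q (t₀.vertex 1) = w₁ ∧
            K.ExtendsPlacement p z₀ Q D) := by
  obtain ⟨ω₁, ω₂, Q₀, hlin, hQ₀, hper⟩ := heucl.exists_isPlacement
  have hlong := hbigon.not_isLongSide_pairing
  -- The angle sums `2π` at `z₀` give the Euler characteristic count, which is all that is kept of
  -- the arguments for nearby `z`.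
  have hcard : 2 * (range K.vtx).ncard = n := by
    refine two_mul_ncard_vtx hp hz₀ hnonneg fun c => ?_
    rw [← hcons.2 c]
    exact Finset.sum_congr rfl fun c' _ => (cornerArg_self hz₀ c').symm
  obtain ⟨F, hfin, hF, hF'⟩ := exists_finite_saturated hp hz₀ hQ₀ hper hlong
    isCompact_unitSquare.isBounded
  obtain ⟨R, hR⟩ := Metric.isBounded_iff.1
    (hfin.isCompact_biUnion fun t _ => isCompact_range (ContinuousMap.continuous t.map)).isBounded
  obtain ⟨C, hC⟩ := eventually_norm_vertex_sub_le hp hz₀ hQ₀ t₀ hfin (Q₀ (t₀.vertex 0))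
  obtain ⟨a, b, ha, hb, hab⟩ := exists_period_functions (m := 1) (k := 0) (ω := ω₁) hp hz₀ hQ₀
    (fun x => by rw [hper]; simp) t₀
  obtain ⟨a', b', ha', hb', hab'⟩ := exists_period_functions (m := 0) (k := 1) (ω := ω₂) hp hz₀ hQ₀
    (fun x => by rw [hper]; simp) t₀
  refine ⟨Q₀ (t₀.vertex 0), Q₀ (t₀.vertex 1), ω₁, ω₂, a, b, a', b', C, R, F, hlin, ha, hb, ha',
    hb', ?_⟩
  filter_upwards [eventually_nondegenerate hz₀, hC,
    eventually_smallHolonomy hlin ha hb ha' hb' (Q₀ (t₀.vertex 0)) C R,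
    exists_extendsPlacement hp hcard hz₀ hnonneg hQ₀ hper hlong] with z hz hCz hsm hext
  refine ⟨hsm.1, hsm.2.1, hsm.2.2.1, fun hc => ?_⟩
  obtain ⟨Q', hQ'⟩ := exists_isPlacement hp hz (hQ₀.vertex_injective hz₀) hc
  obtain ⟨α, β, hα, e0, e1⟩ := hQ'.exists_normalize t₀ (hQ₀ t₀).1
  have hQ := hQ'.comp_affine hα (b := β)
  obtain ⟨D, hD⟩ := hext _ hQ
  have hdev := hD.isDevelopment hp hz hQ
  have f0 := (hD.apply_vertex t₀ 0).trans e0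
  have f1 := (hD.apply_vertex t₀ 1).trans e1
  have hcomm := holonomy_commute (hdev.apply_add t₀ (hab z D hz hdev.isPlacement f0 f1))
    (hdev.apply_add t₀ (hab' z D hz hdev.isPlacement f0 f1))
  refine ⟨hcomm, ⟨hp, hz, (hQ₀ t₀).1, hfin, hF, hF', fun t ht t' ht' x x' => ?_,
    fun Q hQ => hab z Q hz hQ, fun Q hQ => hab' z Q hz hQ, fun Q hQ => hCz Q hz hQ,
    hsm.2.2.2 hcomm⟩, _, D, hQ, e0, e1, hD⟩
  rw [← dist_eq_norm]
  exact hR (mem_iUnion₂.2 ⟨t, ht, x, rfl⟩) (mem_iUnion₂.2 ⟨t', ht', x', rfl⟩)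

end TriangulatedSurface

end

theorem mainTheorem7 {n : ℕ} (K : TriangulatedSurface n)
    (p : ℝ × ℝ → K.Space) (hp : K.IsTorusCovering p)
    (z₀ : Fin n → ℂ) (hz₀ : Nondegenerate z₀)
    (hnonneg : ∀ j, 0 ≤ (z₀ j).im) (hfat : ∃ j, 0 < (z₀ j).im)
    (hcons : K.ConsistentArg z₀ z₀) (hcompl : K.Complete p z₀)
    (heucl : K.InducesEuclidean p z₀) (hbigon : K.FoliatedByBigons z₀) :
    ∃ U : Set (Fin n → ℂ), IsOpen U ∧ z₀ ∈ U ∧ (∀ z ∈ U, Nondegenerate z) ∧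
      -- arguments are defined by continuity on `U`, and may be neglected in the equations
      (∀ c, ContinuousOn (fun z => cornerArg z₀ z c) U) ∧
      (∀ z ∈ U, K.Consistent z ↔ K.ConsistentArg z₀ z) ∧
      -- every solution defines a similarity structure, unique up to isotopy
      (∀ z ∈ U, K.Consistent z →
        (∃ s, K.Defines p z₀ z s) ∧
        ∀ s s', K.Defines p z₀ z s → K.Defines p z₀ z s' → s.Isotopic p s') ∧
      ∃ τ : ℂ, τ.im ≠ 0 ∧
        -- `γ` and `δ` represent `λ` and `μ`
        ∀ γ δ, K.IsLoop p 1 0 γ → K.IsLoop p 0 1 δ →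
          (∀ z ∈ U, K.Consistent z →
            -- the logarithms of `h(z)(λ)` and `h(z)(μ)` are given by the branch at `1`
            (‖K.hol z γ - 1‖ < 1 ∧ ‖K.hol z δ - 1‖ < 1) ∧
            (K.hol z γ = 1 ↔ K.hol z δ = 1) ∧
            ∀ s, K.Defines p z₀ z s →
              (s.CompatibleWithEuclidean ↔ K.hol z γ = 1) ∧
              (K.hol z γ ≠ 1 →
                -- `p ∘ φ` is the universal covering, with an isotopic identification with `ℝ²`
                ∃ φ : (ℝ × ℝ) ≃ₜ (ℝ × ℝ), CommutesWithIntTranslations φ ∧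
                  s.IsDevelopingMap (p ∘ φ) fun q =>
                    Complex.exp (Complex.log (K.hol z γ) * q.1 +
                      Complex.log (K.hol z δ) * q.2))) ∧
          Tendsto (fun z => Complex.log (K.hol z δ) / Complex.log (K.hol z γ))
            (𝓝[{z | z ∈ U ∧ K.Consistent z ∧ Complex.log (K.hol z γ) ≠ 0}] z₀) (𝓝 τ) := by
  obtain ⟨j₀, -⟩ := hfat
  obtain ⟨t₀, -⟩ := TriangulatedSurface.LiftedTriangle.exists_idx hp j₀
  obtain ⟨w₀, w₁, ω₁, ω₂, a, b, a', b', C, R, F, hlin, ha, hb, ha', hb', hev⟩ :=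
    TriangulatedSurface.exists_eventually_normalData hp hz₀ hnonneg hcons heucl hbigon t₀
  obtain ⟨U, hU, hUo, hzU⟩ := mem_nhds_iff.1 (hev.and
    ((eventually_nondegenerate hz₀).and
      ((TriangulatedSurface.eventually_mem_slitPlane hz₀).and
        (TriangulatedSurface.eventually_consistent_iff hz₀ hcons))))
  have hhol : ∀ z ∈ U, K.Consistent z → ∀ γ δ, K.IsLoop p 1 0 γ → K.IsLoop p 0 1 δ →
      K.hol z γ = a z ∧ K.hol z δ = a' z := by
    intro z hz hc γ δ hγ hδ
    obtain ⟨-, N, Q, D, hQ, e0, e1, -⟩ := (hU hz).1.2.2.2 hc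
    have := N.hol_eq hQ e0 e1
    exact ⟨this.1 γ hγ, this.2 δ hδ⟩
  refine ⟨U, hUo, hzU, fun z hz => (hU hz).2.1, fun c z hz =>
    (TriangulatedSurface.continuousAt_cornerArg (hU hz).2.1
      ((hU hz).2.2.1 c)).continuousWithinAt, fun z hz => (hU hz).2.2.2, fun z hz hc => ?_,
    ω₂ / ω₁, im_div_ne_of_linearIndependent hlin, fun γ δ hγ hδ => ⟨fun z hz hc => ?_, ?_⟩⟩
  · obtain ⟨-, N, Q, D, hQ, e0, e1, hD⟩ := (hU hz).1.2.2.2 hc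
    exact ⟨N.exists_defines hQ e0 e1 hD, fun s s' hs hs' => N.isotopic hs hs'⟩
  · obtain ⟨h1, h2⟩ := hhol z hz hc γ δ hγ hδ
    obtain ⟨-, N, -⟩ := (hU hz).1.2.2.2 hc
    rw [h1, h2]
    exact ⟨⟨(hU hz).1.2.1, (hU hz).1.2.2.1⟩, N.small.eq_one_iff, fun s hs =>
      ⟨N.compatible_iff hs, fun hne => N.exists_exp_develops hne hs⟩⟩
  -- Where the logarithm does not vanish, the quotient coincides with the expression in
  -- `tendsto_ratio`, whose limit exists without that restriction.
  · refine ((tendsto_ratio ha hb ha' hb' (hlin.ne_zero 0)).mono_left nhdsWithin_le_nhds).congr' ?_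
    filter_upwards [self_mem_nhdsWithin] with z hz
    obtain ⟨hz, hc, hne⟩ := hz
    obtain ⟨h1, h2⟩ := hhol z hz hc γ δ hγ hδ
    rw [h1] at hne
    rw [h1, h2, log_div_log_eq ((hU hz).1.2.2.2 hc).1 _ (hU hz).1.1]
    rintro h
    rw [h, Complex.log_one] at hne
    exact hne rfl
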